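/- **Setting.** Let $(M,g)$ be a $C^\infty$ Lorentzian manifold (non-empty, Hausdorff, second countable) of dimension $n=d+1$ and signature $(-,+,\dots,+)$, oriented and time-oriented, with natural volume form $\eta$ ($\eta=\sqrt{-\det(g_{\mu\nu})}\,dx^0\wedge\dots\wedge dx^d$ in positively oriented coordinates). Let $m>0$, $q\in\mathbb R$, let $F$ be a 2-form on $M$, and let $\pi:TM\to M$ be the projection. * $\Theta_{(x,p)}(X)=g_x(p,\pi_*X)$ is the Poincaré one-form on $TM$, $\Omega_s=d\Theta+q\,\pi^*F$, and $\Lambda=\frac{(-1)^{n(n-1)/2}}{n!}\,\Omega_s\wedge\dots\wedge\Omega_s$ ($n$ factors). $H(x,p)=\tfrac12 g_x(p,p)$, and the Liouville vector field $L$ on $TM$ is defined by $dH=\Omega_s(\cdot,L)$. * $P_x^+=\{p\in T_xM: g_x(p,p)=-m^2,\ p \text{ future-directed}\}$, and $\Gamma_m^+=\{(x,p): x\in M,\ p\in P_x^+\}$ is the future mass shell. * $\Omega$ is the pull-back to $\Gamma_m^+$ of $\sigma=i_N\Lambda$, where $N=X/(2H)$ and $X$ generates the rescalings $(x,p)\mapsto(x,e^{s}p)$;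 thus $dH\wedge\sigma=\Lambda$ on $\{H<0\}$. Put $\omega=i_L\Omega$, a $2d$-form on $\Gamma_m^+$. * In the same way $\eta_x$ induces on $P_x^+\subset T_xM$ the volume form $\pi_x=i_{N}\eta_x$ with $N_p=p/g_x(p,p)$; up to orientation, $\pi_x=\frac{\sqrt{-\det g_{\mu\nu}(x)}}{|p_{0}|}\,dp^1\wedge\dots\wedge dp^d$ in linear coordinates $(p^0,\dots,p^d)$ of $T_xM$ restricting to coordinates $(p^1,\dots,p^d)$ of $P_x^+$, with $p_0=g_{0\mu}(x)p^\mu\neq0$. Orientations: $\Gamma_m^+$ is oriented by $\Omega$, $P_x^+$ by $\pi_x$, a spacelike hypersurface $S\subset M$ by $i_T\eta$ for any future-directed timelike $T$, and $\Sigma=\{(x,p):x\in S,\ p\in P_x^+\}$ by $\omega$. Integrals are absolutely convergent Lebesgue integrals. **Lemma.** Let $f:\Gamma_m^+\to\mathbb R$ be $C^\infty$ with compact support. For every $x\in M$ the fibre integrals $\int_{P_x^+}f(x,p)\,\pi_x\in\mathbb R$ and $J_x=\int_{P_x^+}f(x,p)\,p\;\pi_x\in T_xM$ (that is, $J^\mu=\int_{P_x^+}f(x,p)\,p^\mu\,\pi_x$)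 exist. *(Local splitting I.)* Let $K\subset M$ be compact and contained in a coordinate neighbourhood, and let $V=\{(x,p):x\in K,\ p\in P_x^+\}$. Then both integrals below exist and $$\int_V f\,\Omega=\int_K\Big(\int_{P_x^+}f(x,p)\,\pi_x\Big)\,\eta .$$ *(Local splitting II.)* Let $S\subset M$ be a $d$-dimensional embedded spacelike hypersurface (not necessarily closed) contained in a coordinate neighbourhood, and let $\Sigma=\{(x,p):x\in S,\ p\in P_x^+\}$, with inclusions $\iota:\Sigma\to\Gamma_m^+$ and $\hat\iota:S\to M$. If $\Sigma\cap\operatorname{supp}f$ is compact (for example, if $S$ is closed in $M$), then $\iota^*(f\omega)$ is integrable over $\Sigma$. Whenever $\iota^*(f\omega)$ is integrable over $\Sigma$, the form $\hat\iota^*(i_J\eta)$ is integrable over $S$ and $$\int_\Sigma\iota^*(f\omega)=\int_S\hat\iota^*(i_J\eta).$$ -/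

import Mathlib

open Set MeasureTheory
open scoped Manifold ContDiff Topology

/-! ## Integration of differential forms over embedded submanifolds -/

section Integration

variable {E' : Type*} [NormedAddCommGroup E'] [NormedSpace ℝ E']
  {H' : Type*} [TopologicalSpace H'] (I' : ModelWithCorners ℝ E' H')
  {X : Type*} [TopologicalSpace X] [ChartedSpace H' X]

/-- A (pointwise) `k`-form on `X` with values in `G`. -/
abbrev DForm (X : Type*) [TopologicalSpace X] [ChartedSpace H' X] (k : ℕ)
    (G : Type*) [AddCommGroup G] [Module ℝ G] :=
  ∀ x : X, TangentSpace I' x [⋀^Fin k]→ₗ[ℝ] G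

/-- A local parametrization of a `k`-dimensional embedded submanifold `N` of `X`: a smooth map `ψ`
from an open set `U ⊆ ℝᵏ` onto a relatively open part `N ∩ W` of `N`, which has a left inverse `χ`
that is smooth on the open set `W ⊆ X` (so `ψ` is an immersion and a homeomorphism onto `N ∩ W`). -/
structure LocalParam (N : Set X) (k : ℕ) where
  /-- the parametrization -/
  ψ : EuclideanSpace ℝ (Fin k) → X
  /-- the parameter domain -/
  U : Set (EuclideanSpace ℝ (Fin k))
  /-- the smooth left inverse -/
  χ : X → EuclideanSpace ℝ (Fin k)
  /-- the domain of the left inverse -/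
  W : Set X
  isOpen_U : IsOpen U
  isOpen_W : IsOpen W
  smooth_ψ : ContMDiffOn (𝓡 k) I' ∞ ψ U
  smooth_χ : ContMDiffOn I' (𝓡 k) ∞ χ W
  image_eq : ψ '' U = N ∩ W
  left_inv : ∀ u ∈ U, χ (ψ u) = u

/-- `N` is a `k`-dimensional smooth embedded submanifold of `X`. -/
def IsEmbeddedSubmanifold (N : Set X) (k : ℕ) : Prop :=
  ∀ x ∈ N, ∃ P : LocalParam I' N k, x ∈ P.W

/-- A countable family of local parametrizations whose images cover `N`. -/
def IsParamCover {N : Set X} {k : ℕ} (P : ℕ → LocalParam I' N k) : Prop :=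
  N ⊆ ⋃ i, (P i).W

/-- The coefficient of the pull-back `ψ^* α` at the parameter `u`: the value of
`α` at `ψ u` on the coordinate vectors `∂ψ/∂u¹, …, ∂ψ/∂uᵏ`. -/
noncomputable def pullbackCoeff {k : ℕ} {G : Type*} [AddCommGroup G] [Module ℝ G]
    (ψ : EuclideanSpace ℝ (Fin k) → X) (α : DForm I' X k G) (u : EuclideanSpace ℝ (Fin k)) : G :=
  α (ψ u) fun j => mfderiv (𝓡 k) I' ψ u (EuclideanSpace.single j (1 : ℝ))

open Classical in
/-- The integrand, on countably many copies of `ℝᵏ`, of `∫_A α` for a subset `A` of the submanifold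
`N` oriented by the form `β`. On the `i`-th copy only the parameters `u` whose image lies in `A`
and is not reached by an earlier parametrization count, so that every point is counted once; the
sign of `ψᵢ^* β` tells whether `ψᵢ` is positively oriented. -/
noncomputable def formIntegrand {N : Set X} {k : ℕ} {G : Type*} [AddCommGroup G] [Module ℝ G]
    (P : ℕ → LocalParam I' N k) (A : Set X) (β : DForm I' X k ℝ) (α : DForm I' X k G)
    (y : ℕ × EuclideanSpace ℝ (Fin k)) : G :=
  if y.2 ∈ (P y.1).U ∧ (P y.1).ψ y.2 ∈ A ∧ ∀ j < y.1, (P y.1).ψ y.2 ∉ (P j).W then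
    Real.sign (pullbackCoeff I' (P y.1).ψ β y.2) • pullbackCoeff I' (P y.1).ψ α y.2
  else 0

/-- The form `α` is absolutely integrable over the subset `A` of the submanifold `N` oriented by
the form `β`. -/
def FormIntegrable {k : ℕ} {G : Type*} [NormedAddCommGroup G] [NormedSpace ℝ G]
    (N A : Set X) (β : DForm I' X k ℝ) (α : DForm I' X k G) : Prop :=
  ∃ h : ∃ P : ℕ → LocalParam I' N k, IsParamCover I' P,
    Integrable (formIntegrand I' h.choose A β α) (Measure.count.prod volume)

open Classical in
/-- The integral `∫_A α` of the form `α` over the subset `A` of the `k`-dimensional submanifold `N`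
of `X`, where `N` carries the orientation in which the `k`-form `β` is positive. It is computed in
some countable family of local parametrizations; by the change of variables formula, the choice of
the family does not matter. -/
noncomputable def formIntegral {k : ℕ} {G : Type*} [NormedAddCommGroup G] [NormedSpace ℝ G]
    (N A : Set X) (β : DForm I' X k ℝ) (α : DForm I' X k G) : G :=
  if h : ∃ P : ℕ → LocalParam I' N k, IsParamCover I' P then
    ∫ y, formIntegrand I' h.choose A β α y ∂(Measure.count.prod volume)
  else 0

end Integration

/-! ## Exterior calculus -/

/-- The exterior derivative of a `k`-form on a manifold, computed at `x` in the preferred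
chart at `x`. -/
noncomputable def mextDeriv {E' : Type*} [NormedAddCommGroup E'] [NormedSpace ℝ E']
    {H' : Type*} [TopologicalSpace H'] (I' : ModelWithCorners ℝ E' H')
    {X : Type*} [TopologicalSpace X] [ChartedSpace H' X] {k : ℕ}
    (α : ∀ x : X, TangentSpace I' x [⋀^Fin k]→L[ℝ] ℝ) (x : X) :
    TangentSpace I' x [⋀^Fin (k + 1)]→L[ℝ] ℝ :=
  ContinuousAlternatingMap.compContinuousLinearMap
    (extDeriv (fun y : E' => (ContinuousAlternatingMap.compContinuousLinearMap
        (α ((extChartAt I' x).symm y)) (mfderiv 𝓘(ℝ, E') I' (extChartAt I' x).symm y) :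
          E' [⋀^Fin k]→L[ℝ] ℝ)) (extChartAt I' x x))
    (mfderiv I' 𝓘(ℝ, E') (extChartAt I' x) x)

/-- The tensor product `α ⊗ ⋯ ⊗ α` (`n` factors) of a two-form `α`. -/
def twoFormTensorPow {V : Type*} [AddCommGroup V] [Module ℝ V] (α : V [⋀^Fin 2]→ₗ[ℝ] ℝ) (n : ℕ) :
    MultilinearMap ℝ (fun _ : Fin n × Fin 2 => V) ℝ :=
  MultilinearMap.mk' (fun v => ∏ i, α fun b => v (i, b))
    (by
      intro v ⟨i, b⟩ x y
      have h1 : ∀ z : V, (fun b' => Function.update v (i, b) z (i, b')) =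
          Function.update (fun b' => v (i, b')) b z := by
        intro z; ext b'; by_cases hb : b' = b <;> simp [Function.update, hb]
      have h2 : ∀ z : V, ∀ j ∈ Finset.univ.erase i,
          (α fun b' => Function.update v (i, b) z (j, b')) = α fun b' => v (j, b') := by
        intro z j hj
        congr 1; ext b'
        simp [Function.update, Finset.ne_of_mem_erase hj]
      simp only [← Finset.mul_prod_erase Finset.univ _ (Finset.mem_univ i), h1,
        Finset.prod_congr rfl (h2 _), AlternatingMap.map_update_add, add_mul])
    (by
      intro v ⟨i, b⟩ c x
      have h1 : ∀ z : V, (fun b' => Function.update v (i, b) z (i, b')) =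
          Function.update (fun b' => v (i, b')) b z := by
        intro z; ext b'; by_cases hb : b' = b <;> simp [Function.update, hb]
      have h2 : ∀ z : V, ∀ j ∈ Finset.univ.erase i,
          (α fun b' => Function.update v (i, b) z (j, b')) = α fun b' => v (j, b') := by
        intro z j hj
        congr 1; ext b'
        simp [Function.update, Finset.ne_of_mem_erase hj]
      simp only [← Finset.mul_prod_erase Finset.univ _ (Finset.mem_univ i), h1,
        Finset.prod_congr rfl (h2 _), AlternatingMap.map_update_smul, smul_eq_mul, mul_assoc])

/-- The `n`-fold wedge product `α ∧ ⋯ ∧ α` of a two-form `α`, in the convention in which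
`dx¹ ∧ ⋯ ∧ dxᵏ` takes the value `1` on the coordinate vectors; that is, `(2!)⁻ⁿ` times the
signed sum of `α ⊗ ⋯ ⊗ α` over all permutations of the `2 n` arguments. -/
noncomputable def twoFormWedgePow {V : Type*} [AddCommGroup V] [Module ℝ V]
    (α : V [⋀^Fin 2]→ₗ[ℝ] ℝ) (n : ℕ) : V [⋀^Fin (2 * n)]→ₗ[ℝ] ℝ :=
  (((2 : ℝ) ^ n)⁻¹ • MultilinearMap.alternatization (twoFormTensorPow α n)).domDomCongr
    (finProdFinEquiv.trans (finCongr (Nat.mul_comm n 2)))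

/-! ## Lorentzian manifolds of dimension `n = d + 1` -/

section Spacetime

variable (d : ℕ) (M : Type*) [TopologicalSpace M] [ChartedSpace (EuclideanSpace ℝ (Fin (d + 1))) M]
  [IsManifold (𝓡 (d + 1)) ∞ M]

/-- A smooth Lorentzian metric, of signature `(-, +, …, +)`. -/
structure LorentzMetric where
  /-- the metric on each tangent space -/
  val (x : M) : TangentSpace (𝓡 (d + 1)) x →L[ℝ] TangentSpace (𝓡 (d + 1)) x →L[ℝ] ℝ
  symm (x : M) (v w : TangentSpace (𝓡 (d + 1)) x) : val x v w = val x w v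
  signature (x : M) : ∃ b : Module.Basis (Fin (d + 1)) ℝ (TangentSpace (𝓡 (d + 1)) x),
    ∀ i j, val x (b i) (b j) = if i = j then (if i = 0 then -1 else 1) else 0
  contMDiff : ContMDiff (𝓡 (d + 1))
    ((𝓡 (d + 1)).prod 𝓘(ℝ, EuclideanSpace ℝ (Fin (d + 1)) →L[ℝ]
      EuclideanSpace ℝ (Fin (d + 1)) →L[ℝ] ℝ)) ∞
    (fun x => Bundle.TotalSpace.mk' (EuclideanSpace ℝ (Fin (d + 1)) →L[ℝ]
      EuclideanSpace ℝ (Fin (d + 1)) →L[ℝ] ℝ) x (val x))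

/-- An orientation of the manifold `M`: an orientation of every tangent space which is locally
constant in the local trivializations of the tangent bundle. -/
structure ManifoldOrientation where
  /-- the orientation of each tangent space -/
  val (x : M) : Orientation ℝ (TangentSpace (𝓡 (d + 1)) x) (Fin (d + 1))
  locallyConstant (x₀ : M) :
    ∃ o₀ : Orientation ℝ (EuclideanSpace ℝ (Fin (d + 1))) (Fin (d + 1)), ∀ᶠ x in 𝓝 x₀,
      ∀ hx : x ∈ (trivializationAt (EuclideanSpace ℝ (Fin (d + 1)))
          (TangentSpace (𝓡 (d + 1)) : M → Type _) x₀).baseSet,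
        Orientation.map (Fin (d + 1)) ((trivializationAt (EuclideanSpace ℝ (Fin (d + 1)))
          (TangentSpace (𝓡 (d + 1)) : M → Type _) x₀).linearEquivAt ℝ x hx) (val x) = o₀

variable {d M}

/-- A time orientation, given by a continuous timelike vector field, which is declared to be
future-directed. -/
structure TimeOrientation (g : LorentzMetric d M) where
  /-- the vector field -/
  vec (x : M) : TangentSpace (𝓡 (d + 1)) x
  continuous_vec : Continuous fun x => (⟨x, vec x⟩ : TangentBundle (𝓡 (d + 1)) M)
  timelike (x : M) : g.val x (vec x) (vec x) < 0

/-- The natural volume form `η` of an oriented Lorentzian manifold: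
`η_x = √(-det g_{μν}) e⁰ ∧ ⋯ ∧ eᵈ` for any positively oriented basis of `T_x M`, with dual basis
`e⁰, …, eᵈ` and Gram matrix `g_{μν}`. -/
noncomputable def volForm (g : LorentzMetric d M) (o : ManifoldOrientation d M) :
    DForm (𝓡 (d + 1)) M (d + 1) ℝ := fun x =>
  let b : Module.Basis (Fin (d + 1)) ℝ (TangentSpace (𝓡 (d + 1)) x) :=
    Module.Basis.adjustToOrientation
      (EuclideanSpace.basisFun (Fin (d + 1)) ℝ).toBasis (o.val x)
  Real.sqrt (-(Matrix.of fun i j => g.val x (b i) (b j)).det) • b.det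

/-! ### Symplectic geometry of the tangent bundle -/

/-- The differential of the bundle projection `TM → M`. -/
noncomputable def projDeriv (z : TangentBundle (𝓡 (d + 1)) M) :
    TangentSpace (𝓡 (d + 1)).tangent z →L[ℝ] TangentSpace (𝓡 (d + 1)) z.1 :=
  mfderiv (𝓡 (d + 1)).tangent (𝓡 (d + 1))
    (Bundle.TotalSpace.proj : TangentBundle (𝓡 (d + 1)) M → M) z

/-- The Poincaré (Liouville) one-form `Θ_{(x,p)}(X) = g_x(p, π_* X)` on `TM`. -/
noncomputable def poincareForm (g : LorentzMetric d M) (z : TangentBundle (𝓡 (d + 1)) M) :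
    TangentSpace (𝓡 (d + 1)).tangent z [⋀^Fin 1]→L[ℝ] ℝ :=
  ContinuousAlternatingMap.ofSubsingleton ℝ _ _ (0 : Fin 1) ((g.val z.1 z.2).comp (projDeriv z))

/-- The symplectic form `Ω_s = dΘ + q π^*F` on `TM` for particles of charge `q` in the
electromagnetic field `F`. (If `F = dA`, it is the exterior derivative of `Θ + q π^*A`.) -/
noncomputable def symplecticForm (g : LorentzMetric d M) (q : ℝ) (F : DForm (𝓡 (d + 1)) M 2 ℝ) :
    DForm (𝓡 (d + 1)).tangent (TangentBundle (𝓡 (d + 1)) M) 2 ℝ := fun z =>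
  (mextDeriv (𝓡 (d + 1)).tangent (poincareForm g) z).toAlternatingMap +
    q • (F z.1).compLinearMap (projDeriv z).toLinearMap

/-- The volume form `Λ = (-1)^{n(n-1)/2} / n! Ω_s ∧ ⋯ ∧ Ω_s` on `TM`, of degree
`2 n = 2 d + 2`. -/
noncomputable def bundleVolForm (g : LorentzMetric d M) (q : ℝ) (F : DForm (𝓡 (d + 1)) M 2 ℝ) :
    DForm (𝓡 (d + 1)).tangent (TangentBundle (𝓡 (d + 1)) M) (2 * d + 1 + 1) ℝ := fun z =>
  ((-1 : ℝ) ^ ((d + 1) * d / 2) / (Nat.factorial (d + 1) : ℝ)) •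
    (twoFormWedgePow (symplecticForm g q F z) (d + 1) :
      TangentSpace (𝓡 (d + 1)).tangent z [⋀^Fin (2 * d + 1 + 1)]→ₗ[ℝ] ℝ)

/-- The Hamiltonian `H(x,p) = g_x(p,p) / 2`. -/
noncomputable def hamiltonian (g : LorentzMetric d M) (z : TangentBundle (𝓡 (d + 1)) M) : ℝ :=
  g.val z.1 z.2 z.2 / 2

/-- The Liouville vector field `L` on `TM`: the Hamiltonian vector field of `H`, that is, the vector
field with `dH = Ω_s(·, L)`. -/
noncomputable def liouvilleField (g : LorentzMetric d M) (q : ℝ) (F : DForm (𝓡 (d + 1)) M 2 ℝ)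
    (z : TangentBundle (𝓡 (d + 1)) M) : TangentSpace (𝓡 (d + 1)).tangent z :=
  Classical.epsilon fun L : TangentSpace (𝓡 (d + 1)).tangent z =>
    ∀ v : TangentSpace (𝓡 (d + 1)).tangent z, symplecticForm g q F z ![v, L] =
      (mfderiv (𝓡 (d + 1)).tangent 𝓘(ℝ, ℝ) (hamiltonian g) z v : ℝ)

/-- The generator `X` of the rescalings `(x, p) ↦ (x, e^s p)` of the fibres of `TM`. -/
noncomputable def dilationField (z : TangentBundle (𝓡 (d + 1)) M) :
    TangentSpace (𝓡 (d + 1)).tangent z :=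
  mfderiv 𝓘(ℝ, ℝ) (𝓡 (d + 1)).tangent
    (fun s : ℝ => (⟨z.1, Real.exp s • z.2⟩ : TangentBundle (𝓡 (d + 1)) M)) 0 (1 : ℝ)

/-! ### The mass shell -/

/-- The future mass hyperboloid `P_x^+ = {p ∈ T_x M | g_x(p,p) = -m², p future-directed}`. -/
def futureHyperboloid (g : LorentzMetric d M) (τ : TimeOrientation g) (m : ℝ) (x : M) :
    Set (TangentSpace (𝓡 (d + 1)) x) :=
  {p | g.val x p p = -m ^ 2 ∧ g.val x (τ.vec x) p < 0}

/-- The part `{(x,p) | x ∈ A, p ∈ P_x^+}` of the future mass shell over `A ⊆ M`. -/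
def shellOver (g : LorentzMetric d M) (τ : TimeOrientation g) (m : ℝ) (A : Set M) :
    Set (TangentBundle (𝓡 (d + 1)) M) :=
  {z | z.1 ∈ A ∧ z.2 ∈ futureHyperboloid g τ m z.1}

/-- The future mass shell `Γ_m^+`. -/
def futureShell (g : LorentzMetric d M) (τ : TimeOrientation g) (m : ℝ) :
    Set (TangentBundle (𝓡 (d + 1)) M) :=
  shellOver g τ m univ

/-- The form `σ = i_N Λ` of degree `2 n - 1 = 2 d + 1` on `{H < 0} ⊆ TM`, where `N = X / (2 H)`, so
that `dH(N) = 1` and `dH ∧ σ = Λ`. Its pull-back to `Γ_m^+` is the volume form `Ω`. -/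
noncomputable def shellForm (g : LorentzMetric d M) (q : ℝ) (F : DForm (𝓡 (d + 1)) M 2 ℝ) :
    DForm (𝓡 (d + 1)).tangent (TangentBundle (𝓡 (d + 1)) M) (2 * d + 1) ℝ := fun z =>
  (bundleVolForm g q F z).curryLeft ((2 * hamiltonian g z)⁻¹ • dilationField z)

/-- The form `ω = i_L Ω` of degree `2 d`. -/
noncomputable def fluxForm (g : LorentzMetric d M) (q : ℝ) (F : DForm (𝓡 (d + 1)) M 2 ℝ) :
    DForm (𝓡 (d + 1)).tangent (TangentBundle (𝓡 (d + 1)) M) (2 * d) ℝ := fun z =>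
  (shellForm g q F z).curryLeft (liouvilleField g q F z)

/-- The volume form `π_x` induced by `η_x` on the hyperboloids `g_x(p,p) = const` in the vector
space `T_x M`: with `h(p) = g_x(p,p) / 2` one has `dh ∧ π_x = η_x`, namely `π_x = i_N η_x` for
`N_p = p / g_x(p,p)`, which satisfies `dh(N) = 1`. -/
noncomputable def fibreForm (g : LorentzMetric d M) (o : ManifoldOrientation d M) (x : M) :
    DForm (𝓡 (d + 1)) (EuclideanSpace ℝ (Fin (d + 1))) d ℝ := fun p =>
  ((volForm g o x).curryLeft ((g.val x p p)⁻¹ • p) :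
    EuclideanSpace ℝ (Fin (d + 1)) [⋀^Fin d]→ₗ[ℝ] ℝ)

/-- The `G`-valued form `φ π_x`, for a `G`-valued function `φ` on `T_x M`. -/
noncomputable def fibreDensity (g : LorentzMetric d M) (o : ManifoldOrientation d M) (x : M)
    {G : Type*} [AddCommGroup G] [Module ℝ G] (φ : TangentSpace (𝓡 (d + 1)) x → G) :
    DForm (𝓡 (d + 1)) (EuclideanSpace ℝ (Fin (d + 1))) d G := fun p =>
  (LinearMap.toSpanSingleton ℝ G (φ p)).compAlternatingMap (fibreForm g o x p)

/-- `φ π_x` is integrable over `P_x^+`. -/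
def FibreIntegrable (g : LorentzMetric d M) (τ : TimeOrientation g) (o : ManifoldOrientation d M)
    (m : ℝ) (x : M) {G : Type*} [NormedAddCommGroup G] [NormedSpace ℝ G]
    (φ : TangentSpace (𝓡 (d + 1)) x → G) : Prop :=
  FormIntegrable (X := EuclideanSpace ℝ (Fin (d + 1))) (𝓡 (d + 1))
    (futureHyperboloid g τ m x) (futureHyperboloid g τ m x)
    (fibreForm g o x) (fibreDensity g o x φ)

/-- The fibre integral `∫_{P_x^+} φ π_x`, with `P_x^+` oriented by its volume form `π_x`. -/
noncomputable def fibreIntegral (g : LorentzMetric d M) (τ : TimeOrientation g)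
    (o : ManifoldOrientation d M) (m : ℝ) (x : M)
    {G : Type*} [NormedAddCommGroup G] [NormedSpace ℝ G]
    (φ : TangentSpace (𝓡 (d + 1)) x → G) : G :=
  formIntegral (X := EuclideanSpace ℝ (Fin (d + 1))) (𝓡 (d + 1))
    (futureHyperboloid g τ m x) (futureHyperboloid g τ m x)
    (fibreForm g o x) (fibreDensity g o x φ)

/-- The integrand `p ↦ f(x,p) p` of the current density, a vector in `T_x M` (which Mathlib
identifies with the model space `ℝⁿ` through the preferred chart at `x`). -/
noncomputable def currentIntegrand (f : TangentBundle (𝓡 (d + 1)) M → ℝ) (x : M)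
    (p : TangentSpace (𝓡 (d + 1)) x) : EuclideanSpace ℝ (Fin (d + 1)) :=
  (f ⟨x, p⟩ • p : TangentSpace (𝓡 (d + 1)) x)

/-- The current density `J_x = ∫_{P_x^+} f(x,p) p π_x ∈ T_x M`. -/
noncomputable def currentDensity (g : LorentzMetric d M) (τ : TimeOrientation g)
    (o : ManifoldOrientation d M) (m : ℝ) (f : TangentBundle (𝓡 (d + 1)) M → ℝ) (x : M) :
    TangentSpace (𝓡 (d + 1)) x :=
  fibreIntegral (G := EuclideanSpace ℝ (Fin (d + 1))) g τ o m x (currentIntegrand f x)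

/-- The contraction `i_Y η` of the volume form with a vector field `Y`. -/
noncomputable def contractVol (g : LorentzMetric d M) (o : ManifoldOrientation d M)
    (Y : ∀ x : M, TangentSpace (𝓡 (d + 1)) x) : DForm (𝓡 (d + 1)) M d ℝ := fun x =>
  (volForm g o x).curryLeft (Y x)

/-- The hypersurface `S` is spacelike: `g` is positive definite on its tangent spaces. -/
def IsSpacelike (g : LorentzMetric d M) (S : Set M) : Prop :=
  ∀ (P : LocalParam (𝓡 (d + 1)) S d), ∀ u ∈ P.U, ∀ v : EuclideanSpace ℝ (Fin d), v ≠ 0 →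
    0 < g.val (P.ψ u) (mfderiv (𝓡 d) (𝓡 (d + 1)) P.ψ u v) (mfderiv (𝓡 d) (𝓡 (d + 1)) P.ψ u v)

end Spacetime

/-! ## Integrals over countably many disjoint parametrized pieces -/

section Countable

variable {Z G : Type*} [MeasurableSpace Z] {μ : Measure Z} [NormedAddCommGroup G]

theorem integrable_iff_forall_integrableOn_and_summable {ν : Type*} [Countable ν] {s : ν → Set Z}
    (hs : ∀ n, MeasurableSet (s n)) (hd : Pairwise (Function.onFun Disjoint s)) {F : Z → G}
    (hF : Function.support F ⊆ ⋃ n, s n) :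
    Integrable F μ ↔ (∀ n, IntegrableOn F (s n) μ) ∧ Summable fun n => ∫ z in s n, ‖F z‖ ∂μ := by
  rw [← integrableOn_iff_integrable_of_support_subset hF]
  refine ⟨fun h => ⟨fun n => h.mono_set (subset_iUnion s n), ?_⟩,
    fun h => integrableOn_iUnion_of_summable_integral_norm h.1 h.2⟩
  exact (hasSum_integral_iUnion hs hd h.norm).summable

theorem integral_eq_tsum_of_support_subset [NormedSpace ℝ G] {ν : Type*} [Countable ν]
    {s : ν → Set Z}
    (hs : ∀ n, MeasurableSet (s n)) (hd : Pairwise (Function.onFun Disjoint s)) {F : Z → G}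
    (hF : Function.support F ⊆ ⋃ n, s n) (hi : Integrable F μ) :
    ∫ z, F z ∂μ = ∑' n, ∫ z in s n, F z ∂μ := by
  rw [← integral_iUnion hs hd hi.integrableOn, setIntegral_eq_integral_of_forall_compl_eq_zero]
  exact fun z hz => by_contra fun h => hz (hF h)

variable {ι Y : Type*} [MeasurableSpace ι] [MeasurableSingletonClass ι] [Countable ι]
  [MeasurableSpace Y] {vol : Measure Y} [SFinite vol]

theorem count_prod_restrict_singleton_prod (i : ι) (s : Set Y) :
    (Measure.count.prod vol).restrict ({i} ×ˢ s) = (vol.restrict s).map (Prod.mk i) := by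
  rw [← Measure.prod_restrict, Measure.restrict_singleton, Measure.count_singleton, one_smul,
    Measure.dirac_prod]

theorem integrableOn_singleton_prod_iff (i : ι) (s : Set Y) (F : ι × Y → G) :
    IntegrableOn F ({i} ×ˢ s) (Measure.count.prod vol) ↔
      IntegrableOn (fun y => F (i, y)) s vol := by
  rw [IntegrableOn, count_prod_restrict_singleton_prod,
    (measurableEmbedding_prodMk_left i).integrable_map_iff]
  rfl

theorem setIntegral_singleton_prod [NormedSpace ℝ G] (i : ι) (s : Set Y) (F : ι × Y → G) :
    ∫ z in {i} ×ˢ s, F z ∂(Measure.count.prod vol) = ∫ y in s, F (i, y) ∂vol := by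
  rw [count_prod_restrict_singleton_prod, (measurableEmbedding_prodMk_left i).integral_map]

end Countable

theorem Real.sign_mul' (a b : ℝ) : Real.sign (a * b) = Real.sign a * Real.sign b := by
  rcases lt_trichotomy a 0 with ha | rfl | ha <;> rcases lt_trichotomy b 0 with hb | rfl | hb <;>
    simp [Real.sign_of_neg, Real.sign_of_pos, *, mul_pos_of_neg_of_neg, mul_neg_of_neg_of_pos,
      mul_neg_of_pos_of_neg]

theorem Real.sign_mul_self_eq_abs (a : ℝ) : Real.sign a * a = |a| := by
  rcases lt_trichotomy a 0 with ha | rfl | ha <;>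
    simp [Real.sign_of_neg, Real.sign_of_pos, abs_of_neg, abs_of_pos, *]

theorem AlternatingMap.map_linearMap_basis {ι V G : Type*} [Fintype ι] [DecidableEq ι]
    [AddCommGroup V] [Module ℝ V] [AddCommGroup G] [Module ℝ G] (b : Module.Basis ι ℝ V)
    (f : V [⋀^ι]→ₗ[ℝ] G) (A : V →ₗ[ℝ] V) :
    f (fun i => A (b i)) = LinearMap.det A • f b := by
  have h : f = (LinearMap.toSpanSingleton ℝ G (f b)).compAlternatingMap b.det := by
    refine Module.Basis.ext_alternating b fun v hv => ?_
    have hv' : Function.Bijective v := Finite.injective_iff_bijective.1 hv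
    have : (fun i => b (v i)) = b ∘ (Equiv.ofBijective v hv') := rfl
    rw [this, AlternatingMap.map_perm, AlternatingMap.map_perm]
    simp [Module.Basis.det_self]
  conv_lhs => rw [h]
  have h2 : b.det (fun i => A (b i)) = LinearMap.det A := by
    have := LinearMap.det_toMatrix b A
    rw [Module.Basis.det_apply, ← this]
    congr 1
    ext i j
    simp [LinearMap.toMatrix_apply, Module.Basis.toMatrix_apply]
  simp [h2]

section Pieces

variable {E' : Type*} [NormedAddCommGroup E'] [NormedSpace ℝ E']
  {H' : Type*} [TopologicalSpace H'] {I' : ModelWithCorners ℝ E' H'}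
  {X : Type*} [TopologicalSpace X] [ChartedSpace H' X] {N : Set X} {k : ℕ}

namespace LocalParam

variable (P Q : LocalParam I' N k)

theorem injOn : InjOn P.ψ P.U := LeftInvOn.injOn (f₁' := P.χ) P.left_inv

theorem mem_of_mem {u} (hu : u ∈ P.U) : P.ψ u ∈ N ∩ P.W := by
  rw [← P.image_eq]; exact mem_image_of_mem _ hu

theorem right_inv {x : X} (hx : x ∈ N) (hW : x ∈ P.W) : P.χ x ∈ P.U ∧ P.ψ (P.χ x) = x := by
  obtain ⟨u, hu, rfl⟩ : x ∈ P.ψ '' P.U := by rw [P.image_eq]; exact ⟨hx, hW⟩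
  rw [P.left_inv u hu]
  exact ⟨hu, rfl⟩

theorem continuousOn_ψ : ContinuousOn P.ψ P.U := P.smooth_ψ.continuousOn

theorem isOpen_overlap : IsOpen (P.U ∩ P.ψ ⁻¹' Q.W) :=
  P.continuousOn_ψ.isOpen_inter_preimage P.isOpen_U Q.isOpen_W

/-- The transition map between two local parametrizations. -/
def transition (u : EuclideanSpace ℝ (Fin k)) : EuclideanSpace ℝ (Fin k) := Q.χ (P.ψ u)

theorem transition_spec {u} (hu : u ∈ P.U ∩ P.ψ ⁻¹' Q.W) :
    P.transition Q u ∈ Q.U ∧ Q.ψ (P.transition Q u) = P.ψ u :=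
  Q.right_inv (P.mem_of_mem hu.1).1 hu.2

theorem contMDiffOn_transition :
    ContMDiffOn (𝓡 k) (𝓡 k) ∞ (P.transition Q) (P.U ∩ P.ψ ⁻¹' Q.W) :=
  Q.smooth_χ.comp (P.smooth_ψ.mono inter_subset_left) fun _ hu => hu.2

theorem differentiableAt_transition {u} (hu : u ∈ P.U ∩ P.ψ ⁻¹' Q.W) :
    DifferentiableAt ℝ (P.transition Q) u :=
  (((P.contMDiffOn_transition Q).contMDiffAt
    ((P.isOpen_overlap Q).mem_nhds hu)).mdifferentiableAt (by simp)).differentiableAt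

theorem mdifferentiableAt_ψ {u} (hu : u ∈ P.U) : MDifferentiableAt (𝓡 k) I' P.ψ u :=
  (P.smooth_ψ.contMDiffAt (P.isOpen_U.mem_nhds hu)).mdifferentiableAt (by simp)

theorem pullbackCoeff_transition {G : Type*} [AddCommGroup G] [Module ℝ G]
    (α : DForm I' X k G) {u} (hu : u ∈ P.U ∩ P.ψ ⁻¹' Q.W) :
    pullbackCoeff I' P.ψ α u =
      (fderiv ℝ (P.transition Q) u).det • pullbackCoeff I' Q.ψ α (P.transition Q u) := by
  obtain ⟨h1, h2⟩ := P.transition_spec Q hu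
  have hd := P.differentiableAt_transition Q hu
  have he : P.ψ =ᶠ[𝓝 u] Q.ψ ∘ P.transition Q := by
    filter_upwards [(P.isOpen_overlap Q).mem_nhds hu] with v hv
    exact (P.transition_spec Q hv).2.symm
  have hm : mfderiv (𝓡 k) I' P.ψ u =
      (mfderiv (𝓡 k) I' Q.ψ (P.transition Q u)).comp (fderiv ℝ (P.transition Q) u) := by
    rw [he.mfderiv_eq, mfderiv_comp u (Q.mdifferentiableAt_ψ h1) hd.mdifferentiableAt,
      mfderiv_eq_fderiv]
    rfl
  let a : X → E' [⋀^Fin k]→ₗ[ℝ] G := α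
  let A : EuclideanSpace ℝ (Fin k) →L[ℝ] E' := mfderiv (𝓡 k) I' Q.ψ (P.transition Q u)
  have key := AlternatingMap.map_linearMap_basis (EuclideanSpace.basisFun (Fin k) ℝ).toBasis
    ((a (Q.ψ (P.transition Q u))).compLinearMap A.toLinearMap)
    (fderiv ℝ (P.transition Q) u).toLinearMap
  simp only [AlternatingMap.compLinearMap_apply, OrthonormalBasis.coe_toBasis,
    EuclideanSpace.basisFun_apply] at key
  change a (P.ψ u) (fun j => mfderiv (𝓡 k) I' P.ψ u (EuclideanSpace.single j (1 : ℝ))) =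
    (fderiv ℝ (P.transition Q) u).det •
      a (Q.ψ (P.transition Q u)) fun j => A (EuclideanSpace.single j (1 : ℝ))
  rw [h2] at key ⊢
  rw [hm]
  exact key

theorem sign_smul_pullbackCoeff_transition {G : Type*} [AddCommGroup G] [Module ℝ G]
    (β : DForm I' X k ℝ) (α : DForm I' X k G) {u} (hu : u ∈ P.U ∩ P.ψ ⁻¹' Q.W) :
    Real.sign (pullbackCoeff I' P.ψ β u) • pullbackCoeff I' P.ψ α u =
      |(fderiv ℝ (P.transition Q) u).det| •
        Real.sign (pullbackCoeff I' Q.ψ β (P.transition Q u)) •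
          pullbackCoeff I' Q.ψ α (P.transition Q u) := by
  rw [P.pullbackCoeff_transition Q β hu, P.pullbackCoeff_transition Q α hu, smul_eq_mul,
    Real.sign_mul', smul_smul, smul_smul, ← Real.sign_mul_self_eq_abs]
  congr 1
  ring

end LocalParam

variable (I' N k) in
/-- A family of disjoint measurable pieces of a submanifold, each in the range of a local
parametrization. -/
structure ParamPieces (ι : Type*) where
  /-- the local parametrizations -/
  param : ι → LocalParam I' N k
  /-- the parameter domains of the pieces -/
  dom : ι → Set (EuclideanSpace ℝ (Fin k))
  measurableSet_dom : ∀ i, MeasurableSet (dom i)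
  dom_subset : ∀ i, dom i ⊆ (param i).U
  disjoint : ∀ i j u v, u ∈ dom i → v ∈ dom j → (param i).ψ u = (param j).ψ v → i = j

namespace ParamPieces

variable {ι κ : Type*} {G : Type*} [NormedAddCommGroup G] [NormedSpace ℝ G]

/-- The pieces cover `A`. -/
def Covers (D : ParamPieces I' N k ι) (A : Set X) : Prop :=
  ∀ x ∈ A, ∃ i, ∃ u ∈ D.dom i, (D.param i).ψ u = x

open Classical in
/-- The integrand of `∫_A α` on the parameter domains of the pieces. -/
noncomputable def integrand (D : ParamPieces I' N k ι) (A : Set X) (β : DForm I' X k ℝ)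
    (α : DForm I' X k G) (y : ι × EuclideanSpace ℝ (Fin k)) : G :=
  if y.2 ∈ D.dom y.1 ∧ (D.param y.1).ψ y.2 ∈ A then
    Real.sign (pullbackCoeff I' (D.param y.1).ψ β y.2) • pullbackCoeff I' (D.param y.1).ψ α y.2
  else 0

/-- The part of the `i`-th piece of `D` that lies in the `j`-th piece of `D'`. -/
def overlap (D : ParamPieces I' N k ι) (D' : ParamPieces I' N k κ) (i : ι) (j : κ) :
    Set (EuclideanSpace ℝ (Fin k)) :=
  {u | u ∈ D.dom i ∧ ∃ v ∈ D'.dom j, (D'.param j).ψ v = (D.param i).ψ u}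

variable (D : ParamPieces I' N k ι) (D' : ParamPieces I' N k κ)

theorem overlap_subset (i : ι) (j : κ) :
    D.overlap D' i j ⊆ (D.param i).U ∩ (D.param i).ψ ⁻¹' (D'.param j).W := by
  rintro u ⟨hu, v, hv, h⟩
  refine ⟨D.dom_subset i hu, ?_⟩
  rw [mem_preimage, ← h]
  exact ((D'.param j).mem_of_mem (D'.dom_subset j hv)).2

theorem measurableSet_overlap (i : ι) (j : κ) : MeasurableSet (D.overlap D' i j) := by
  set P := D.param i
  set Q := D'.param j
  have h : D.overlap D' i j = D.dom i ∩
      ((P.U ∩ P.ψ ⁻¹' Q.W) ∩ P.transition Q ⁻¹' D'.dom j) := by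
    ext u
    constructor
    · intro hu
      refine ⟨hu.1, D.overlap_subset D' i j hu, ?_⟩
      obtain ⟨hu, v, hv, h⟩ := hu
      have : P.transition Q u = v := by
        rw [LocalParam.transition, ← h]; exact Q.left_inv v (D'.dom_subset j hv)
      rw [mem_preimage, this]
      exact hv
    · rintro ⟨h1, h2, h3⟩
      exact ⟨h1, _, h3, (P.transition_spec Q h2).2⟩
  rw [h]
  refine (D.measurableSet_dom i).inter ?_
  have hO := (P.isOpen_overlap Q).measurableSet
  have hc : Measurable ((P.U ∩ P.ψ ⁻¹' Q.W).domRestrict (P.transition Q)) :=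
    ((P.contMDiffOn_transition Q).continuousOn.domRestrict).measurable
  have := hO.subtype_image (hc (D'.measurableSet_dom j))
  convert this using 1
  ext u
  simp only [mem_inter_iff, mem_preimage, mem_image, domRestrict_apply, Subtype.exists,
    exists_and_right, exists_eq_right, exists_prop]

theorem transition_image_overlap (i : ι) (j : κ) :
    (D.param i).transition (D'.param j) '' D.overlap D' i j = D'.overlap D j i := by
  ext v
  constructor
  · rintro ⟨u, ⟨hu, v, hv, h⟩, rfl⟩
    have : (D.param i).transition (D'.param j) u = v := by
      rw [LocalParam.transition, ← h]; exact (D'.param j).left_inv v (D'.dom_subset j hv)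
    rw [this]
    exact ⟨hv, u, hu, h.symm⟩
  · rintro ⟨hv, u, hu, h⟩
    refine ⟨u, ⟨hu, v, hv, h.symm⟩, ?_⟩
    rw [LocalParam.transition, h]
    exact (D'.param j).left_inv v (D'.dom_subset j hv)

theorem injOn_transition (i : ι) (j : κ) :
    InjOn ((D.param i).transition (D'.param j)) (D.overlap D' i j) := by
  intro u hu v hv h
  have hu' := D.overlap_subset D' i j hu
  have hv' := D.overlap_subset D' i j hv
  refine (D.param i).injOn hu'.1 hv'.1 ?_
  rw [← (LocalParam.transition_spec _ _ hu').2, ← (LocalParam.transition_spec _ _ hv').2, h]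

variable {D D'} (A : Set X) (β : DForm I' X k ℝ) (α : DForm I' X k G)

theorem integrand_transition {i : ι} {j : κ} {u} (hu : u ∈ D.overlap D' i j) :
    D.integrand A β α (i, u) =
      |(fderiv ℝ ((D.param i).transition (D'.param j)) u).det| •
        D'.integrand A β α (j, (D.param i).transition (D'.param j) u) := by
  have h' := D.overlap_subset D' i j hu
  have h2 : (D.param i).transition (D'.param j) u ∈ D'.overlap D j i := by
    rw [← transition_image_overlap]; exact mem_image_of_mem _ hu
  have h3 := (LocalParam.transition_spec _ _ h').2
  by_cases hA : (D.param i).ψ u ∈ A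
  · rw [integrand, integrand, if_pos ⟨hu.1, hA⟩, if_pos ⟨h2.1, by rwa [h3]⟩]
    exact LocalParam.sign_smul_pullbackCoeff_transition _ _ β α h'
  · rw [integrand, integrand, if_neg fun h => hA h.2, if_neg fun h => hA (h3 ▸ h.2), smul_zero]

theorem integrableOn_overlap_iff (i : ι) (j : κ) :
    IntegrableOn (fun u => D.integrand A β α (i, u)) (D.overlap D' i j) ↔
      IntegrableOn (fun u => D'.integrand A β α (j, u)) (D'.overlap D j i) := by
  rw [← transition_image_overlap D D', integrableOn_image_iff_integrableOn_abs_det_fderiv_smul volume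
    (D.measurableSet_overlap D' i j)
    (fun u hu => ((D.param i).differentiableAt_transition _
      (D.overlap_subset D' i j hu)).hasFDerivAt.hasFDerivWithinAt)
    (D.injOn_transition D' i j)]
  exact integrableOn_congr_fun (fun u hu => integrand_transition A β α hu)
    (D.measurableSet_overlap D' i j)

theorem setIntegral_overlap (i : ι) (j : κ) :
    ∫ u in D.overlap D' i j, D.integrand A β α (i, u) =
      ∫ u in D'.overlap D j i, D'.integrand A β α (j, u) := by
  rw [← transition_image_overlap D D', integral_image_eq_integral_abs_det_fderiv_smul volume
    (D.measurableSet_overlap D' i j)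
    (fun u hu => ((D.param i).differentiableAt_transition _
      (D.overlap_subset D' i j hu)).hasFDerivAt.hasFDerivWithinAt)
    (D.injOn_transition D' i j)]
  exact setIntegral_congr_fun (D.measurableSet_overlap D' i j)
    fun u hu => integrand_transition A β α hu

theorem setIntegral_norm_overlap (i : ι) (j : κ) :
    ∫ u in D.overlap D' i j, ‖D.integrand A β α (i, u)‖ =
      ∫ u in D'.overlap D j i, ‖D'.integrand A β α (j, u)‖ := by
  rw [← transition_image_overlap D D', integral_image_eq_integral_abs_det_fderiv_smul volume
    (D.measurableSet_overlap D' i j)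
    (fun u hu => ((D.param i).differentiableAt_transition _
      (D.overlap_subset D' i j hu)).hasFDerivAt.hasFDerivWithinAt)
    (D.injOn_transition D' i j)]
  refine setIntegral_congr_fun (D.measurableSet_overlap D' i j) fun u hu => ?_
  simp only [integrand_transition A β α hu, norm_smul, Real.norm_eq_abs, abs_abs, smul_eq_mul]

theorem pairwise_disjoint_overlap (D : ParamPieces I' N k ι) (D' : ParamPieces I' N k κ) :
    Pairwise (Function.onFun Disjoint fun n : ι × κ => ({n.1} : Set ι) ×ˢ D.overlap D' n.1 n.2) := by
  rintro ⟨i, j⟩ ⟨i', j'⟩ hne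
  refine disjoint_left.2 ?_
  rintro ⟨i'', u⟩ ⟨h1, hu⟩ ⟨h2, hu'⟩
  simp only [mem_singleton_iff] at h1 h2 hu hu'
  subst h1 h2
  obtain ⟨-, v, hv, h⟩ := hu
  obtain ⟨-, v', hv', h'⟩ := hu'
  exact hne (by rw [D'.disjoint j j' v v' hv hv' (h.trans h'.symm)])

theorem support_integrand_subset (hD' : D'.Covers A) :
    Function.support (D.integrand A β α) ⊆
      ⋃ n : ι × κ, ({n.1} : Set ι) ×ˢ D.overlap D' n.1 n.2 := by
  rintro ⟨i, u⟩ hy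
  by_cases h : u ∈ D.dom i ∧ (D.param i).ψ u ∈ A
  · obtain ⟨j, v, hv, hvu⟩ := hD' _ h.2
    exact mem_iUnion.2 ⟨(i, j), rfl, h.1, v, hv, hvu⟩
  · exact absurd (if_neg h) hy

variable [MeasurableSpace ι] [MeasurableSingletonClass ι] [Countable ι]
  [MeasurableSpace κ] [MeasurableSingletonClass κ] [Countable κ]

/-- Integrability does not depend on the decomposition into parametrized pieces. -/
theorem integrable_integrand_iff (hD : D.Covers A) (hD' : D'.Covers A) :
    Integrable (D.integrand A β α) (Measure.count.prod volume) ↔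
      Integrable (D'.integrand A β α) (Measure.count.prod volume) := by
  rw [integrable_iff_forall_integrableOn_and_summable
      (fun n : ι × κ => (measurableSet_singleton n.1).prod (D.measurableSet_overlap D' n.1 n.2))
      (pairwise_disjoint_overlap D D') (support_integrand_subset A β α hD'),
    integrable_iff_forall_integrableOn_and_summable
      (fun n : κ × ι => (measurableSet_singleton n.1).prod (D'.measurableSet_overlap D n.1 n.2))
      (pairwise_disjoint_overlap D' D) (support_integrand_subset A β α hD)]
  simp only [integrableOn_singleton_prod_iff, setIntegral_singleton_prod,
    setIntegral_norm_overlap (D := D) (D' := D') A β α,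
    integrableOn_overlap_iff (D := D) (D' := D') A β α]
  refine and_congr (Prod.swap_surjective.forall.trans Iff.rfl) ?_
  exact (Equiv.prodComm κ ι).summable_iff
    (f := fun n : ι × κ => ∫ u in D'.overlap D n.2 n.1, ‖D'.integrand A β α (n.2, u)‖) |>.symm

/-- The integral does not depend on the decomposition into parametrized pieces. -/
theorem integral_integrand_eq (hD : D.Covers A) (hD' : D'.Covers A) :
    ∫ y, D.integrand A β α y ∂(Measure.count.prod volume) =
      ∫ y, D'.integrand A β α y ∂(Measure.count.prod volume) := by
  by_cases hi : Integrable (D.integrand A β α) (Measure.count.prod volume)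
  · have hi' := (integrable_integrand_iff A β α hD hD').1 hi
    rw [integral_eq_tsum_of_support_subset
        (fun n : ι × κ => (measurableSet_singleton n.1).prod (D.measurableSet_overlap D' n.1 n.2))
        (pairwise_disjoint_overlap D D') (support_integrand_subset A β α hD') hi,
      integral_eq_tsum_of_support_subset
        (fun n : κ × ι => (measurableSet_singleton n.1).prod (D'.measurableSet_overlap D n.1 n.2))
        (pairwise_disjoint_overlap D' D) (support_integrand_subset A β α hD) hi']
    simp only [setIntegral_singleton_prod, setIntegral_overlap (D := D) (D' := D') A β α]
    exact (Equiv.prodComm κ ι).tsum_eq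
      (fun n : ι × κ => ∫ u in D'.overlap D n.2 n.1, D'.integrand A β α (n.2, u)) |>.symm
  · rw [integral_undef hi,
      integral_undef fun h => hi ((integrable_integrand_iff A β α hD hD').2 h)]

end ParamPieces

/-- The pieces of a countable well-ordered family of local parametrizations on which each of them
is the first one to reach the point. -/
def firstPieces {ι : Type*} [LinearOrder ι] [Countable ι] (P : ι → LocalParam I' N k) :
    ParamPieces I' N k ι where
  param := P
  dom i := {u | u ∈ (P i).U ∧ ∀ j < i, (P i).ψ u ∉ (P j).W}
  measurableSet_dom i := by
    have : {u | u ∈ (P i).U ∧ ∀ j < i, (P i).ψ u ∉ (P j).W} =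
        (P i).U \ ⋃ j, ⋃ (_ : j < i), (P i).U ∩ (P i).ψ ⁻¹' (P j).W := by
      ext u
      simp only [mem_ofPred_eq, mem_sdiff, mem_iUnion, mem_inter_iff, mem_preimage, not_exists,
        not_and]
      grind
    rw [this]
    refine (P i).isOpen_U.measurableSet.diff (.iUnion fun j => .iUnion fun _ => ?_)
    exact ((P i).isOpen_overlap (P j)).measurableSet
  dom_subset i u hu := hu.1
  disjoint i j u v hu hv h := by
    by_contra hne
    rcases lt_or_gt_of_ne hne with hlt | hlt
    · exact hv.2 i hlt (h ▸ ((P i).mem_of_mem hu.1).2)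
    · exact hu.2 j hlt (h ▸ ((P j).mem_of_mem hv.1).2)

theorem covers_firstPieces {ι : Type*} [LinearOrder ι] [Countable ι] [WellFoundedLT ι]
    {P : ι → LocalParam I' N k} {A : Set X} (hA : A ⊆ N) (hP : A ⊆ ⋃ i, (P i).W) :
    (firstPieces P).Covers A := by
  intro x hx
  obtain ⟨i, hi, hmin⟩ := wellFounded_lt.has_min {i | x ∈ (P i).W} (mem_iUnion.1 (hP hx))
  obtain ⟨h1, h2⟩ := (P i).right_inv (hA hx) hi
  refine ⟨i, _, ⟨h1, fun j hj => ?_⟩, h2⟩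
  rw [h2]
  exact fun h => hmin j h hj

/-- The restriction of a local parametrization to an open set. -/
def LocalParam.restrict (P : LocalParam I' N k) {V : Set X} (hV : IsOpen V) :
    LocalParam I' N k where
  ψ := P.ψ
  U := P.U ∩ P.ψ ⁻¹' V
  χ := P.χ
  W := P.W ∩ V
  isOpen_U := P.continuousOn_ψ.isOpen_inter_preimage P.isOpen_U hV
  isOpen_W := P.isOpen_W.inter hV
  smooth_ψ := P.smooth_ψ.mono inter_subset_left
  smooth_χ := P.smooth_χ.mono inter_subset_left
  image_eq := by
    rw [image_inter_preimage, P.image_eq, inter_assoc]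
  left_inv u hu := P.left_inv u hu.1

variable {G : Type*} [NormedAddCommGroup G] [NormedSpace ℝ G]

theorem formIntegrand_eq_integrand (P : ℕ → LocalParam I' N k) (A : Set X) (β : DForm I' X k ℝ)
    (α : DForm I' X k G) : formIntegrand I' P A β α = (firstPieces P).integrand A β α := by
  funext y
  by_cases h : y.2 ∈ (firstPieces P).dom y.1 ∧ ((firstPieces P).param y.1).ψ y.2 ∈ A
  · rw [formIntegrand, ParamPieces.integrand, if_pos h, if_pos ⟨h.1.1, h.2, h.1.2⟩]
    rfl
  · rw [formIntegrand, ParamPieces.integrand, if_neg h, if_neg fun h' => h ⟨⟨h'.1, h'.2.2⟩, h'.2.1⟩]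

theorem ParamPieces.integrand_inter {ι : Type*} (D : ParamPieces I' N k ι) {A : Set X}
    (β : DForm I' X k ℝ) {α : DForm I' X k G} {C : Set X}
    (hA : A ⊆ N) (hC : N ∩ C ⊆ A) (hα : ∀ x ∈ A, x ∉ C → α x = 0) :
    D.integrand A β α = D.integrand (N ∩ C) β α := by
  funext y
  by_cases h1 : y.2 ∈ D.dom y.1 ∧ (D.param y.1).ψ y.2 ∈ A
  · by_cases h2 : (D.param y.1).ψ y.2 ∈ C
    · rw [integrand, integrand, if_pos h1, if_pos ⟨h1.1, hA h1.2, h2⟩]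
    · rw [integrand, integrand, if_pos h1, if_neg fun h => h2 h.2.2]
      have : pullbackCoeff I' (D.param y.1).ψ α y.2 = 0 :=
        congrArg (fun a : E' [⋀^Fin k]→ₗ[ℝ] G => a _) (hα _ h1.2 h2)
      rw [this, smul_zero]
  · rw [integrand, integrand, if_neg h1, if_neg fun h => h1 ⟨h.1, hC h.2⟩]

variable {ι : Type*} [MeasurableSpace ι] [MeasurableSingletonClass ι] [Countable ι]
  (D : ParamPieces I' N k ι) {A : Set X}

theorem formIntegrable_iff (hP : ∃ P : ℕ → LocalParam I' N k, IsParamCover I' P) (hA : A ⊆ N)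
    (hD : D.Covers A) (β : DForm I' X k ℝ) (α : DForm I' X k G) :
    FormIntegrable I' N A β α ↔
      Integrable (D.integrand A β α) (Measure.count.prod volume) := by
  rw [FormIntegrable, exists_prop_of_true hP, formIntegrand_eq_integrand]
  exact ParamPieces.integrable_integrand_iff A β α
    (covers_firstPieces hA (hA.trans hP.choose_spec)) hD

theorem formIntegral_eq (hP : ∃ P : ℕ → LocalParam I' N k, IsParamCover I' P) (hA : A ⊆ N)
    (hD : D.Covers A) (β : DForm I' X k ℝ) (α : DForm I' X k G) :
    formIntegral I' N A β α = ∫ y, D.integrand A β α y ∂(Measure.count.prod volume) := by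
  rw [formIntegral, dif_pos hP, formIntegrand_eq_integrand]
  exact ParamPieces.integral_integrand_eq A β α
    (covers_firstPieces hA (hA.trans hP.choose_spec)) hD

theorem ParamPieces.integrable_integrand_of_finite {ι : Type*} [Finite ι] [MeasurableSpace ι]
    [MeasurableSingletonClass ι] (D : ParamPieces I' N k ι) (β : DForm I' X k ℝ)
    (α : DForm I' X k G) {C : Set X} (hC : IsClosed C) (K : ι → Set (EuclideanSpace ℝ (Fin k)))
    (hK : ∀ i, IsCompact (K i)) (hDK : ∀ i, D.dom i ⊆ K i)
    (hcont : ∀ i, ContinuousOn (fun u => Real.sign (pullbackCoeff I' (D.param i).ψ β u) •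
      pullbackCoeff I' (D.param i).ψ α u) (K i)) :
    Integrable (D.integrand (N ∩ C) β α) (Measure.count.prod volume) := by
  classical
  have hsupp : Function.support (D.integrand (N ∩ C) β α) ⊆
      ⋃ i : ι, ({i} : Set ι) ×ˢ (D.dom i ∩ ((D.param i).U ∩ (D.param i).ψ ⁻¹' C)) := by
    rintro ⟨i, u⟩ hy
    by_cases h : u ∈ D.dom i ∧ (D.param i).ψ u ∈ N ∩ C
    · exact mem_iUnion.2 ⟨i, rfl, h.1, D.dom_subset i h.1, h.2.2⟩
    · exact absurd (if_neg h) hy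
  have hmeas : ∀ i, MeasurableSet (D.dom i ∩ ((D.param i).U ∩ (D.param i).ψ ⁻¹' C)) := by
    intro i
    have := (D.param i).continuousOn_ψ.isOpen_inter_preimage (D.param i).isOpen_U hC.isOpen_compl
    have h2 : (D.param i).U ∩ (D.param i).ψ ⁻¹' C =
        (D.param i).U \ ((D.param i).U ∩ (D.param i).ψ ⁻¹' Cᶜ) := by
      ext u; simp
    rw [h2]
    exact (D.measurableSet_dom i).inter ((D.param i).isOpen_U.measurableSet.diff this.measurableSet)
  rw [integrable_iff_forall_integrableOn_and_summable
    (fun i => (measurableSet_singleton i).prod (hmeas i)) ?_ hsupp]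
  · refine ⟨fun i => ?_, Summable.of_finite⟩
    rw [integrableOn_singleton_prod_iff]
    have h1 := ((hcont i).integrableOn_compact (μ := volume) (hK i)).mono_set
      (inter_subset_left.trans (hDK i) :
        D.dom i ∩ ((D.param i).U ∩ (D.param i).ψ ⁻¹' C) ⊆ K i)
    refine (integrableOn_congr_fun (fun u hu => ?_) (hmeas i)).1 h1
    exact (if_pos (⟨hu.1, ((D.param i).mem_of_mem hu.2.1).1, hu.2.2⟩ :
      u ∈ D.dom i ∧ (D.param i).ψ u ∈ N ∩ C)).symm
  · intro i j hij
    refine disjoint_left.2 ?_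
    rintro ⟨i', u⟩ ⟨h1, -⟩ ⟨h2, -⟩
    exact hij (h1.symm.trans h2)

/-- A form with compact support is integrable if its coefficients are continuous in suitable local
parametrizations. -/
theorem formIntegrable_of_isCompact (hP : ∃ P : ℕ → LocalParam I' N k, IsParamCover I' P)
    (hA : A ⊆ N) (β : DForm I' X k ℝ) (α : DForm I' X k G) {C : Set X} (hC : IsClosed C)
    (hNC : N ∩ C ⊆ A) (hcomp : IsCompact (N ∩ C)) (hα : ∀ x ∈ A, x ∉ C → α x = 0)
    (hcov : ∀ x ∈ N, ∃ P : LocalParam I' N k, x ∈ P.W ∧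
      ContinuousOn (fun u => Real.sign (pullbackCoeff I' P.ψ β u) • pullbackCoeff I' P.ψ α u)
        P.U) :
    FormIntegrable I' N A β α := by
  have h0 : FormIntegrable I' N A β α ↔ FormIntegrable I' N (N ∩ C) β α := by
    simp only [FormIntegrable, formIntegrand_eq_integrand]
    refine exists_congr fun h => ?_
    rw [ParamPieces.integrand_inter _ β hA hNC hα]
  rw [h0]
  have hloc : ∀ x ∈ N ∩ C, ∃ V : Set X, x ∈ V ∧ ∃ R : LocalParam I' N k, R.W = V ∧
      ∃ K : Set (EuclideanSpace ℝ (Fin k)), ∃ P : LocalParam I' N k, IsCompact K ∧ K ⊆ P.U ∧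
        R.U ⊆ K ∧ R.ψ = P.ψ ∧
        ContinuousOn (fun u => Real.sign (pullbackCoeff I' P.ψ β u) • pullbackCoeff I' P.ψ α u)
          P.U := by
    rintro x ⟨hxN, -⟩
    obtain ⟨P, hxP, hc⟩ := hcov x hxN
    obtain ⟨h1, h2⟩ := P.right_inv hxN hxP
    obtain ⟨r, hr, hrU⟩ := Metric.nhds_basis_closedBall.mem_iff.1 (P.isOpen_U.mem_nhds h1)
    have hV : IsOpen (P.W ∩ P.χ ⁻¹' Metric.ball (P.χ x) r) :=
      P.smooth_χ.continuousOn.isOpen_inter_preimage P.isOpen_W Metric.isOpen_ball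
    refine ⟨_, ?_, P.restrict hV, rfl, Metric.closedBall (P.χ x) r, P, isCompact_closedBall _ _,
      hrU, ?_, rfl, hc⟩
    · exact ⟨hxP, hxP, Metric.mem_ball_self hr⟩
    · rintro u ⟨hu, -, hu2⟩
      rw [mem_preimage, P.left_inv u hu] at hu2
      exact Metric.ball_subset_closedBall hu2
  choose V hxV R hRV K P' hK hKU hRK hψ hcont using hloc
  obtain ⟨t, ht⟩ := hcomp.elim_nhds_subcover' V fun x hx => by
    rw [← hRV x hx]
    exact (R x hx).isOpen_W.mem_nhds (by rw [hRV x hx]; exact hxV x hx)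
  let e := t.equivFin
  let Q : Fin t.card → LocalParam I' N k := fun l => R (e.symm l) (e.symm l).1.2
  have hcovers : (firstPieces Q).Covers (N ∩ C) := by
    refine covers_firstPieces inter_subset_left fun x hx => ?_
    obtain ⟨y, hy, hxy⟩ := mem_iUnion₂.1 (ht hx)
    refine mem_iUnion.2 ⟨e ⟨y, hy⟩, ?_⟩
    have h1 : e.symm (e ⟨y, hy⟩) = ⟨y, hy⟩ := e.symm_apply_apply _
    change x ∈ (R (e.symm (e ⟨y, hy⟩)) (e.symm (e ⟨y, hy⟩)).1.2).W
    rw [h1, hRV]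
    exact hxy
  rw [formIntegrable_iff (firstPieces Q) hP inter_subset_left hcovers]
  refine ParamPieces.integrable_integrand_of_finite _ β α hC
    (fun l => K (e.symm l) (e.symm l).1.2) (fun l => hK _ _)
    (fun l => ((firstPieces Q).dom_subset l).trans (hRK _ _)) fun l => ?_
  change ContinuousOn (fun u =>
    Real.sign (pullbackCoeff I' (R (e.symm l) (e.symm l).1.2).ψ β u) •
      pullbackCoeff I' (R (e.symm l) (e.symm l).1.2).ψ α u) _
  rw [hψ]
  exact (hcont _ _).mono (hKU _ _)

/-- The local parametrization with empty domain. -/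
noncomputable def LocalParam.empty [Nonempty X] : LocalParam I' N k where
  ψ _ := Classical.arbitrary X
  U := ∅
  χ _ := 0
  W := ∅
  isOpen_U := isOpen_empty
  isOpen_W := isOpen_empty
  smooth_ψ := fun _ h => h.elim
  smooth_χ := fun _ h => h.elim
  image_eq := by simp
  left_inv u hu := hu.elim

/-- A submanifold of a second countable manifold which is covered by local parametrizations has a
countable cover. -/
theorem exists_isParamCover [SecondCountableTopology X] [Nonempty X]
    {p : LocalParam I' N k → Prop} (hp : p LocalParam.empty)
    (h : ∀ x ∈ N, ∃ P : LocalParam I' N k, x ∈ P.W ∧ p P) :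
    ∃ P : ℕ → LocalParam I' N k, IsParamCover I' P ∧ ∀ i, p (P i) := by
  choose P hxP hpP using h
  obtain ⟨T, hT, hTU⟩ := TopologicalSpace.isOpen_iUnion_countable
    (fun x : N => (P x x.2).W) fun x => (P x x.2).isOpen_W
  rcases T.eq_empty_or_nonempty with rfl | hne
  · refine ⟨fun _ => LocalParam.empty, fun x hx => ?_, fun _ => hp⟩
    have : x ∈ ⋃ x : N, (P x x.2).W := mem_iUnion.2 ⟨⟨x, hx⟩, hxP x hx⟩
    rw [← hTU] at this
    simp at this
  · obtain ⟨f, rfl⟩ := hT.exists_eq_range hne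
    refine ⟨fun n => P (f n) (f n).2, fun x hx => ?_, fun n => hpP _ _⟩
    have : x ∈ ⋃ x : N, (P x x.2).W := mem_iUnion.2 ⟨⟨x, hx⟩, hxP x hx⟩
    rw [← hTU] at this
    simpa using this

end Pieces

section WedgePower

variable {V : Type*} [AddCommGroup V] [Module ℝ V]

/-- The permutation of `n` pairs which permutes the pairs by `p.1` and the `i`-th pair by
`p.2 i`. -/
def pairPerm {n : ℕ} (p : Equiv.Perm (Fin n) × (Fin n → Equiv.Perm (Fin 2))) :
    Equiv.Perm (Fin n × Fin 2) :=
  (Equiv.prodCongrLeft fun _ => p.1) * (Equiv.prodCongrRight p.2)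

theorem pairPerm_apply {n : ℕ} (p : Equiv.Perm (Fin n) × (Fin n → Equiv.Perm (Fin 2)))
    (i : Fin n) (b : Fin 2) : pairPerm p (i, b) = (p.1 i, p.2 i b) := rfl

theorem sign_pairPerm {n : ℕ} (p : Equiv.Perm (Fin n) × (Fin n → Equiv.Perm (Fin 2))) :
    Equiv.Perm.sign (pairPerm p) = ∏ i, Equiv.Perm.sign (p.2 i) := by
  rw [pairPerm, Equiv.Perm.sign_mul, Equiv.Perm.sign_prodCongrLeft, Equiv.Perm.sign_prodCongrRight]
  simp

theorem pairPerm_injective {n : ℕ} : Function.Injective (pairPerm (n := n)) := by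
  intro p q h
  have h' : ∀ i b, (p.1 i, p.2 i b) = (q.1 i, q.2 i b) := fun i b => by
    rw [← pairPerm_apply, h, pairPerm_apply]
  refine Prod.ext (Equiv.ext fun i => congrArg Prod.fst (h' i 0)) ?_
  funext i
  exact Equiv.ext fun b => congrArg Prod.snd (h' i b)

theorem exists_pairPerm {n : ℕ} (σ : Equiv.Perm (Fin n × Fin 2))
    (h : ∀ i, (σ (i, 0)).1 = (σ (i, 1)).1) : ∃ p, pairPerm p = σ := by
  have h' : ∀ i b, (σ (i, b)).1 = (σ (i, 0)).1 := by
    intro i b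
    fin_cases b
    · rfl
    · exact (h i).symm
  have hs : Function.Surjective fun i => (σ (i, 0)).1 := fun j =>
    ⟨(σ.symm (j, 0)).1, by
      change (σ ((σ.symm (j, 0)).1, 0)).1 = j
      rw [← h' _ (σ.symm (j, 0)).2]; simp⟩
  have hi : ∀ i, Function.Injective fun b => (σ (i, b)).2 := by
    intro i b c hbc
    have : σ (i, b) = σ (i, c) := Prod.ext ((h' i b).trans (h' i c).symm) hbc
    exact congrArg Prod.snd (σ.injective this)
  refine ⟨(Equiv.ofBijective _ (Finite.surjective_iff_bijective.1 hs),
    fun i => Equiv.ofBijective _ (Finite.injective_iff_bijective.1 (hi i))), ?_⟩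
  ext1 ⟨i, b⟩
  exact Prod.ext (h' i b).symm rfl

variable (α : V [⋀^Fin 2]→ₗ[ℝ] ℝ) {n : ℕ} {v : Fin n × Fin 2 → V} {c : Fin n → ℝ}

theorem fst_eq_of_prod_ne_zero (hff : ∀ i j, α ![v (i, 1), v (j, 1)] = 0)
    (hef : ∀ i j, i ≠ j → α ![v (i, 0), v (j, 1)] = 0) (σ : Equiv.Perm (Fin n × Fin 2))
    (hσ : ∏ i, α (fun b => v (σ (i, b))) ≠ 0) (i : Fin n) : (σ (i, 0)).1 = (σ (i, 1)).1 := by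
  have hne : ∀ i, α ![v (σ (i, 0)), v (σ (i, 1))] ≠ 0 := by
    intro i
    have := Finset.prod_ne_zero_iff.1 hσ i (Finset.mem_univ i)
    convert this using 2
    ext b; fin_cases b <;> rfl
  have hswap : ∀ x y : V, α ![x, y] = -α ![y, x] := by
    intro x y
    have := α.map_swap ![y, x] (show (0 : Fin 2) ≠ 1 by decide)
    rw [← this]
    congr 1
    ext b; fin_cases b <;> rfl
  let t : Fin n → ℕ := fun i => (σ (i, 0)).2 + (σ (i, 1)).2
  have h2 : ∀ b : Fin 2, b = 0 ∨ b = 1 := by decide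
  have ht : ∀ i ∈ Finset.univ, t i ≤ 1 := by
    intro i _
    by_contra hcon
    have h0 : (σ (i, 0)).2 = 1 := by
      rcases h2 (σ (i, 0)).2 with h | h
      · simp only [t, h] at hcon; omega
      · exact h
    have h1 : (σ (i, 1)).2 = 1 := by
      rcases h2 (σ (i, 1)).2 with h | h
      · simp only [t, h] at hcon; omega
      · exact h
    apply hne i
    have e0 : σ (i, 0) = ((σ (i, 0)).1, 1) := Prod.ext rfl h0
    have e1 : σ (i, 1) = ((σ (i, 1)).1, 1) := Prod.ext rfl h1
    rw [e0, e1]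
    exact hff _ _
  have hsum : ∑ i, t i = ∑ _i : Fin n, 1 := by
    have h3 : ∑ i, t i = ∑ p : Fin n × Fin 2, ((σ p).2 : ℕ) := by
      rw [Fintype.sum_prod_type]
      simp [t]
    rw [h3, Equiv.sum_comp σ (fun p => (p.2 : ℕ)), Fintype.sum_prod_type]
    simp
  have ht1 := (Finset.sum_eq_sum_iff_of_le ht).1 hsum i (Finset.mem_univ i)
  by_contra hcon
  apply hne i
  rcases h2 (σ (i, 0)).2 with h0 | h0 <;> rcases h2 (σ (i, 1)).2 with h1 | h1
  · simp [t, h0, h1] at ht1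
  · have e0 : σ (i, 0) = ((σ (i, 0)).1, 0) := Prod.ext rfl h0
    have e1 : σ (i, 1) = ((σ (i, 1)).1, 1) := Prod.ext rfl h1
    rw [e0, e1]
    exact hef _ _ hcon
  · have e0 : σ (i, 0) = ((σ (i, 0)).1, 1) := Prod.ext rfl h0
    have e1 : σ (i, 1) = ((σ (i, 1)).1, 0) := Prod.ext rfl h1
    rw [hswap, e0, e1, hef _ _ (Ne.symm hcon), neg_zero]
  · simp [t, h0, h1] at ht1

theorem alternatization_twoFormTensorPow (hff : ∀ i j, α ![v (i, 1), v (j, 1)] = 0)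
    (hef : ∀ i j, α ![v (i, 0), v (j, 1)] = if i = j then c i else 0) :
    MultilinearMap.alternatization (twoFormTensorPow α n) v = n.factorial * 2 ^ n * ∏ i, c i := by
  rw [MultilinearMap.alternatization_apply]
  have hterm : ∀ p : Equiv.Perm (Fin n) × (Fin n → Equiv.Perm (Fin 2)),
      (∏ i, c i) = Equiv.Perm.sign (pairPerm p) •
        (twoFormTensorPow α n).domDomCongr (pairPerm p) v := by
    intro p
    have h1 : (twoFormTensorPow α n).domDomCongr (pairPerm p) v =
        ∏ i, ((Equiv.Perm.sign (p.2 i) : ℤ) : ℝ) * c (p.1 i) := by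
      change ∏ i, α (fun b => v (pairPerm p (i, b))) = _
      refine Finset.prod_congr rfl fun i _ => ?_
      have h2 : (fun b => v (pairPerm p (i, b))) = (fun b => v (p.1 i, b)) ∘ p.2 i := rfl
      have h3 : (fun b => v (p.1 i, b)) = ![v (p.1 i, 0), v (p.1 i, 1)] := by
        ext b; fin_cases b <;> rfl
      rw [h2, AlternatingMap.map_perm, h3, hef, if_pos rfl, Units.smul_def, zsmul_eq_mul]
    rw [h1, Finset.prod_mul_distrib, Equiv.prod_comp p.1 c, sign_pairPerm, Units.smul_def,
      zsmul_eq_mul, ← mul_assoc]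
    push_cast
    rw [← Finset.prod_mul_distrib]
    have : ∀ i, ((Equiv.Perm.sign (p.2 i) : ℤ) : ℝ) * ((Equiv.Perm.sign (p.2 i) : ℤ) : ℝ) = 1 := by
      intro i
      rw [← Int.cast_mul, ← Units.val_mul, Int.units_mul_self]
      simp
    simp [this]
  have := Finset.sum_of_injOn (s := Finset.univ) (t := Finset.univ) (pairPerm (n := n))
    (f := fun _ => ∏ i, c i)
    (g := fun σ => Equiv.Perm.sign σ • (twoFormTensorPow α n).domDomCongr σ v)
    pairPerm_injective.injOn (fun _ _ => Finset.mem_coe.2 (Finset.mem_univ _)) ?_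
    (fun p _ => hterm p)
  · rw [← this]
    simp [Fintype.card_perm]
  · intro σ _ hσ
    by_contra hne
    obtain ⟨p, hp⟩ := exists_pairPerm σ (fst_eq_of_prod_ne_zero α hff
      (fun i j hij => by rw [hef, if_neg hij]) σ fun h0 => hne (by
        change _ • (∏ i, α (fun b => v (σ (i, b)))) = 0
        rw [h0, smul_zero]))
    exact hσ ⟨p, by simp, hp⟩

theorem twoFormWedgePow_apply (hff : ∀ i j, α ![v (i, 1), v (j, 1)] = 0)
    (hef : ∀ i j, α ![v (i, 0), v (j, 1)] = if i = j then c i else 0) {w : Fin (2 * n) → V}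
    (hw : ∀ p, w ((finProdFinEquiv.trans (finCongr (Nat.mul_comm n 2))) p) = v p) :
    twoFormWedgePow α n w = n.factorial * ∏ i, c i := by
  have h : twoFormWedgePow α n w =
      ((2 : ℝ) ^ n)⁻¹ * MultilinearMap.alternatization (twoFormTensorPow α n) v := by
    have : (fun p => w ((finProdFinEquiv.trans (finCongr (Nat.mul_comm n 2))) p)) = v := funext hw
    rw [← this]
    rfl
  rw [h, alternatization_twoFormTensorPow α hff hef]
  field_simp

end WedgePower

section Gram

variable {E : Type*} [AddCommGroup E] [Module ℝ E] {ι : Type*} [Fintype ι] [DecidableEq ι]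

theorem det_gram_eq (G : E →ₗ[ℝ] E →ₗ[ℝ] ℝ) (b : Module.Basis ι ℝ E) (v : ι → E) :
    (Matrix.of fun i j => G (v i) (v j)).det =
      (Matrix.of fun i j => G (b i) (b j)).det * b.det v ^ 2 := by
  have h : (Matrix.of fun i j => G (v i) (v j)) =
      (b.toMatrix v).transpose * (Matrix.of fun i j => G (b i) (b j)) * b.toMatrix v := by
    ext i j
    conv_lhs => rw [Matrix.of_apply, ← b.sum_repr (v i), ← b.sum_repr (v j)]
    simp only [map_sum, LinearMap.sum_apply, map_smul, LinearMap.smul_apply, smul_eq_mul,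
      Matrix.mul_apply, Matrix.transpose_apply, Matrix.of_apply, Module.Basis.toMatrix_apply,
      Finset.sum_mul, Finset.mul_sum]
    refine Finset.sum_congr rfl fun k _ => Finset.sum_congr rfl fun l _ => ?_
    ring
  rw [h, Matrix.det_mul, Matrix.det_mul, Matrix.det_transpose, Module.Basis.det_apply]
  ring

variable {d : ℕ} {G : E →ₗ[ℝ] E →ₗ[ℝ] ℝ}

theorem det_gram_of_orthonormal (b : Module.Basis (Fin (d + 1)) ℝ E)
    (hb : ∀ i j, G (b i) (b j) = if i = j then (if i = 0 then -1 else 1) else 0)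
    (v : Fin (d + 1) → E) :
    (Matrix.of fun i j => G (v i) (v j)).det = -b.det v ^ 2 := by
  rw [det_gram_eq G b]
  have : (Matrix.of fun i j => G (b i) (b j)) =
      Matrix.diagonal fun i : Fin (d + 1) => if i = 0 then (-1 : ℝ) else 1 := by
    ext i j
    simp [hb, Matrix.diagonal]
  rw [this, Matrix.det_diagonal, Fin.prod_univ_succ]
  simp

theorem sqrt_neg_det_gram (b : Module.Basis (Fin (d + 1)) ℝ E)
    (hb : ∀ i j, G (b i) (b j) = if i = j then (if i = 0 then -1 else 1) else 0)
    (v : Fin (d + 1) → E) :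
    Real.sqrt (-(Matrix.of fun i j => G (v i) (v j)).det) = |b.det v| := by
  rw [det_gram_of_orthonormal b hb, neg_neg, Real.sqrt_sq_eq_abs]

theorem abs_basis_volume (b : Module.Basis (Fin (d + 1)) ℝ E)
    (hb : ∀ i j, G (b i) (b j) = if i = j then (if i = 0 then -1 else 1) else 0)
    (b' : Module.Basis (Fin (d + 1)) ℝ E) (v : Fin (d + 1) → E) :
    |Real.sqrt (-(Matrix.of fun i j => G (b' i) (b' j)).det) * b'.det v| = |b.det v| := by
  have h := det_gram_eq G b' v
  rw [det_gram_of_orthonormal b hb, det_gram_of_orthonormal b hb] at h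
  rw [sqrt_neg_det_gram b hb]
  refine (sq_eq_sq₀ (abs_nonneg _) (abs_nonneg _)).1 ?_
  rw [sq_abs, sq_abs, mul_pow, sq_abs]
  linarith

end Gram

section Block

variable {E : Type*} [AddCommGroup E] [Module ℝ E] {n : ℕ}

theorem Module.Basis.prod_det_block (b : Module.Basis (Fin n) ℝ E) (v : Fin n ⊕ Fin n → E × E)
    (hv : ∀ j, (v (Sum.inr j)).1 = 0) :
    (b.prod b).det v = b.det (fun i => (v (Sum.inl i)).1) * b.det (fun j => (v (Sum.inr j)).2) := by
  have : (b.prod b).toMatrix v = Matrix.fromBlocks (b.toMatrix fun i => (v (Sum.inl i)).1) 0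
      (b.toMatrix fun i => (v (Sum.inl i)).2) (b.toMatrix fun j => (v (Sum.inr j)).2) := by
    ext (i | i) (j | j) <;> simp [Module.Basis.toMatrix_apply, hv]
  rw [Module.Basis.det_apply, this, Matrix.det_fromBlocks_zero₁₂]
  rfl

/-- The value of the `n`-th power of a two-form on `E × E` on `2 n` vectors of which `n` are
vertical. -/
theorem abs_twoFormWedgePow_block (α : (E × E) [⋀^Fin 2]→ₗ[ℝ] ℝ) (b : Module.Basis (Fin n) ℝ E)
    (hvv : ∀ p q : E, α ![(0, p), (0, q)] = 0)
    (hb : ∀ i j, |α ![(b i, 0), (0, b j)]| = if i = j then 1 else 0)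
    (v : Fin (2 * n) → E × E) (e : Fin n ⊕ Fin n ≃ Fin (2 * n))
    (hv : ∀ j, (v (e (Sum.inr j))).1 = 0) :
    |twoFormWedgePow α n v| = n.factorial * (|b.det fun i => (v (e (Sum.inl i))).1| *
      |b.det fun j => (v (e (Sum.inr j))).2|) := by
  let e₀ : Fin n ⊕ Fin n ≃ Fin (2 * n) :=
    ((Equiv.boolProdEquivSum (Fin n)).symm.trans ((finTwoEquiv.symm.prodCongr (Equiv.refl _)).trans
      (Equiv.prodComm _ _))).trans (finProdFinEquiv.trans (finCongr (Nat.mul_comm n 2)))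
  have hperm : ∀ (f : (E × E) [⋀^Fin (2 * n)]→ₗ[ℝ] ℝ) (w : Fin n ⊕ Fin n → E × E),
      |f (w ∘ e.symm)| = |f (w ∘ e₀.symm)| := by
    intro f w
    have : w ∘ e.symm = (w ∘ e₀.symm) ∘ (e.symm.trans e₀) := by
      ext1 i; simp
    rw [this, AlternatingMap.map_perm, Units.smul_def, zsmul_eq_mul, abs_mul]
    rcases Int.units_eq_one_or (Equiv.Perm.sign (e.symm.trans e₀)) with h | h <;> rw [h] <;> simp
  have h0 : |twoFormWedgePow α n ((b.prod b) ∘ e₀.symm)| = n.factorial := by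
    rw [twoFormWedgePow_apply α (v := fun p => if p.2 = 0 then (b p.1, 0) else (0, b p.1))
      (c := fun i => α ![(b i, 0), (0, b i)])]
    · rw [abs_mul, Finset.abs_prod]
      simp [hb]
    · intro i j
      simpa using hvv _ _
    · intro i j
      by_cases hij : i = j
      · subst hij; simp
      · simpa [hij] using hb i j
    · rintro ⟨i, k⟩
      have : e₀.symm ((finProdFinEquiv.trans (finCongr (Nat.mul_comm n 2))) (i, k)) =
          if k = 0 then Sum.inl i else Sum.inr i := by
        rw [Equiv.symm_apply_eq]
        fin_cases k <;> rfl
      rw [Function.comp_apply, this]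
      split_ifs <;> simp
  let f := (twoFormWedgePow α n).domDomCongr e.symm
  have hf : f = f (b.prod b) • (b.prod b).det := f.eq_smul_basis_det (b.prod b)
  have h1 : twoFormWedgePow α n v = f (v ∘ e) := by
    change _ = twoFormWedgePow α n ((v ∘ e) ∘ e.symm)
    congr 1
    ext1 i; simp
  have h2 : |f (b.prod b)| = n.factorial := by
    rw [← h0, ← hperm]
    rfl
  rw [h1, hf, AlternatingMap.smul_apply, smul_eq_mul, abs_mul, h2,
    Module.Basis.prod_det_block b _ hv, abs_mul]
  rfl

end Block

section TangentBundleLemmas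

variable {d : ℕ} {M : Type*} [TopologicalSpace M]
  [ChartedSpace (EuclideanSpace ℝ (Fin (d + 1))) M] [IsManifold (𝓡 (d + 1)) ∞ M]

namespace LorentzMetric

variable (g : LorentzMetric d M)

theorem contMDiffOn_apply {E' : Type*} [NormedAddCommGroup E'] [NormedSpace ℝ E']
    {H' : Type*} [TopologicalSpace H'] {J : ModelWithCorners ℝ E' H'}
    {Y : Type*} [TopologicalSpace Y] [ChartedSpace H' Y] {b : Y → M} {s : Set Y}
    {v w : ∀ y, TangentSpace (𝓡 (d + 1)) (b y)}
    (hv : ContMDiffOn J (𝓡 (d + 1)).tangent ∞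
      (fun y => (⟨b y, v y⟩ : TangentBundle (𝓡 (d + 1)) M)) s)
    (hw : ContMDiffOn J (𝓡 (d + 1)).tangent ∞
      (fun y => (⟨b y, w y⟩ : TangentBundle (𝓡 (d + 1)) M)) s) :
    ContMDiffOn J 𝓘(ℝ, ℝ) ∞ (fun y => g.val (b y) (v y) (w y)) s := by
  intro y hy
  have hb : ContMDiffWithinAt J (𝓡 (d + 1)) ∞ b s y :=
    (Bundle.contMDiffWithinAt_totalSpace.1 (hv y hy)).1
  have h : ContMDiffWithinAt J ((𝓡 (d + 1)).prod 𝓘(ℝ)) ∞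
      (fun m ↦ Bundle.TotalSpace.mk' ℝ (E := Bundle.Trivial M ℝ) (b m)
        (g.val (b m) (v m) (w m))) s y :=
    ContMDiffWithinAt.clm_bundle_apply₂ (F₁ := EuclideanSpace ℝ (Fin (d + 1)))
      (F₂ := EuclideanSpace ℝ (Fin (d + 1)))
      (ContMDiffAt.comp_contMDiffWithinAt y g.contMDiff.contMDiffAt hb) (hv y hy) (hw y hy)
  exact (Bundle.contMDiffWithinAt_totalSpace.1 h).2

theorem continuousOn_apply {Y : Type*} [TopologicalSpace Y] {b : Y → M} {s : Set Y}
    {v w : ∀ y, TangentSpace (𝓡 (d + 1)) (b y)}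
    (hv : ContinuousOn (fun y => (⟨b y, v y⟩ : TangentBundle (𝓡 (d + 1)) M)) s)
    (hw : ContinuousOn (fun y => (⟨b y, w y⟩ : TangentBundle (𝓡 (d + 1)) M)) s) :
    ContinuousOn (fun y => g.val (b y) (v y) (w y)) s := by
  intro y hy
  have hb : ContinuousWithinAt b s y :=
    ((FiberBundle.continuousWithinAt_totalSpace _ _).1 (hv y hy)).1
  have h : ContinuousWithinAt
      (fun m ↦ Bundle.TotalSpace.mk' ℝ (E := Bundle.Trivial M ℝ) (b m)
        (g.val (b m) (v m) (w m))) s y :=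
    ContinuousWithinAt.clm_bundle_apply₂ (F₁ := EuclideanSpace ℝ (Fin (d + 1)))
      (F₂ := EuclideanSpace ℝ (Fin (d + 1)))
      (g.contMDiff.continuous.continuousAt.comp_continuousWithinAt hb) (hv y hy) (hw y hy)
  exact ((FiberBundle.continuousWithinAt_totalSpace _ _).1 h).2

end LorentzMetric

theorem projDeriv_eq_fst (z : TangentBundle (𝓡 (d + 1)) M) :
    projDeriv z = ContinuousLinearMap.fst ℝ (EuclideanSpace ℝ (Fin (d + 1)))
      (EuclideanSpace ℝ (Fin (d + 1))) := by
  have hp : MDifferentiableAt (𝓡 (d + 1)).tangent (𝓡 (d + 1))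
      (Bundle.TotalSpace.proj : TangentBundle (𝓡 (d + 1)) M → M) z :=
    (Bundle.contMDiff_proj (n := ∞) (TangentSpace (𝓡 (d + 1)) : M → Type _)
      z).mdifferentiableAt (by simp)
  have h1 : (extChartAt (𝓡 (d + 1)) z.1) ∘ (Bundle.TotalSpace.proj : TangentBundle _ M → M) =
      Prod.fst ∘ (extChartAt (𝓡 (d + 1)).tangent z) := by
    funext w
    rfl
  have h2 := mfderiv_comp z (mdifferentiableAt_extChartAt (I := 𝓡 (d + 1))
    (mem_chart_source _ z.1)) hp
  have h3 := mfderiv_comp (I' := 𝓘(ℝ, EuclideanSpace ℝ (Fin (d + 1)) × EuclideanSpace ℝ (Fin (d + 1))))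
    (I'' := 𝓡 (d + 1)) (g := Prod.fst) z
    (differentiableAt_fst.mdifferentiableAt)
    (mdifferentiableAt_extChartAt (I := (𝓡 (d + 1)).tangent) (mem_chart_source _ z))
  rw [mfderiv_extChartAt_self] at h2 h3
  have h4 : mfderiv (𝓡 (d + 1)).tangent (𝓡 (d + 1))
      ((extChartAt (𝓡 (d + 1)) z.1) ∘ (Bundle.TotalSpace.proj : TangentBundle _ M → M)) z =
      mfderiv (𝓡 (d + 1)).tangent (𝓡 (d + 1)) (Prod.fst ∘ (extChartAt (𝓡 (d + 1)).tangent z)) z := by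
    rw [h1]
  have h5 := h2.symm.trans (h4.trans h3)
  refine h5.trans ?_
  rw [mfderiv_eq_fderiv]
  exact fderiv_fst

theorem trivializationAt_mk_self (x : M) (p : TangentSpace (𝓡 (d + 1)) x) :
    (trivializationAt (EuclideanSpace ℝ (Fin (d + 1))) (TangentSpace (𝓡 (d + 1))) x
      (⟨x, p⟩ : TangentBundle (𝓡 (d + 1)) M)).2 = p :=
  (tangentBundleCore (𝓡 (d + 1)) M).coordChange_self (achart _ x) x (mem_chart_source _ x) p

/-- The vector at `x` with given components in the chart at `x₀`. -/
noncomputable def chartVec (x₀ x : M) :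
    EuclideanSpace ℝ (Fin (d + 1)) →L[ℝ] EuclideanSpace ℝ (Fin (d + 1)) :=
  (trivializationAt (EuclideanSpace ℝ (Fin (d + 1)))
    (TangentSpace (𝓡 (d + 1)) : M → Type _) x₀).symmL ℝ x

theorem chartVec_self (x : M) (p : EuclideanSpace ℝ (Fin (d + 1))) : chartVec x x p = p := by
  rw [chartVec, TangentBundle.symmL_trivializationAt_eq_core (mem_chart_source _ x)]
  exact (tangentBundleCore (𝓡 (d + 1)) M).coordChange_self (achart _ x) x (mem_chart_source _ x) p

theorem mk_chartVec {x₀ x : M} (hx : x ∈ (chartAt (EuclideanSpace ℝ (Fin (d + 1))) x₀).source)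
    (p : EuclideanSpace ℝ (Fin (d + 1))) :
    (⟨x, chartVec x₀ x p⟩ : TangentBundle (𝓡 (d + 1)) M) =
      (trivializationAt (EuclideanSpace ℝ (Fin (d + 1)))
        (TangentSpace (𝓡 (d + 1)) : M → Type _) x₀).toOpenPartialHomeomorph.symm (x, p) := by
  rw [← Bundle.Trivialization.mk_symm _ hx p]
  exact congrArg (Bundle.TotalSpace.mk' (EuclideanSpace ℝ (Fin (d + 1))) x)
    (Bundle.Trivialization.symmL_apply (R := ℝ) _ hx p)

/-- The metric as a bilinear form on the model space. -/
noncomputable def LorentzMetric.bilin (g : LorentzMetric d M) (x : M) :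
    EuclideanSpace ℝ (Fin (d + 1)) →L[ℝ] EuclideanSpace ℝ (Fin (d + 1)) →L[ℝ] ℝ := g.val x

theorem contMDiff_fiberMk (x : M) :
    ContMDiff 𝓘(ℝ, EuclideanSpace ℝ (Fin (d + 1))) (𝓡 (d + 1)).tangent ∞
      (fun p : EuclideanSpace ℝ (Fin (d + 1)) => (⟨x, p⟩ : TangentBundle (𝓡 (d + 1)) M)) := by
  intro p
  refine Bundle.contMDiffAt_totalSpace.2 ⟨contMDiffAt_const, ?_⟩
  exact contMDiffAt_id.congr_of_eventuallyEq
    (Filter.Eventually.of_forall fun q => trivializationAt_mk_self x q)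

theorem mfderiv_fiberMk (x : M) (p : EuclideanSpace ℝ (Fin (d + 1))) :
    mfderiv 𝓘(ℝ, EuclideanSpace ℝ (Fin (d + 1))) (𝓡 (d + 1)).tangent
      (fun p : EuclideanSpace ℝ (Fin (d + 1)) => (⟨x, p⟩ : TangentBundle (𝓡 (d + 1)) M)) p =
      ContinuousLinearMap.inr ℝ (EuclideanSpace ℝ (Fin (d + 1)))
        (EuclideanSpace ℝ (Fin (d + 1))) := by
  set z : TangentBundle (𝓡 (d + 1)) M := ⟨x, p⟩ with hz
  let mk : EuclideanSpace ℝ (Fin (d + 1)) → TangentBundle (𝓡 (d + 1)) M := fun p => ⟨x, p⟩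
  have h1 : (extChartAt (𝓡 (d + 1)).tangent z) ∘ mk = fun q => (extChartAt (𝓡 (d + 1)) x x, q) := by
    funext q
    exact Prod.ext rfl (trivializationAt_mk_self x q)
  have h2 := mfderiv_comp (I := 𝓘(ℝ, EuclideanSpace ℝ (Fin (d + 1)))) (f := mk) p
    (mdifferentiableAt_extChartAt (I := (𝓡 (d + 1)).tangent) (mem_chart_source _ z))
    ((contMDiff_fiberMk x p).mdifferentiableAt (by simp))
  have h3 : mfderiv (𝓡 (d + 1)).tangent
      𝓘(ℝ, EuclideanSpace ℝ (Fin (d + 1)) × EuclideanSpace ℝ (Fin (d + 1)))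
      (extChartAt (𝓡 (d + 1)).tangent z) (mk p) = ContinuousLinearMap.id ℝ _ :=
    mfderiv_extChartAt_self (x := z)
  rw [h3, h1] at h2
  refine h2.symm.trans ?_
  rw [mfderiv_eq_fderiv]
  exact (hasFDerivAt_prodMk_right _ _).fderiv

variable (g : LorentzMetric d M)

/-- The metric in the chart at `x₀`. -/
noncomputable def LorentzMetric.inChart (x₀ : M) (y : EuclideanSpace ℝ (Fin (d + 1))) :
    EuclideanSpace ℝ (Fin (d + 1)) →L[ℝ] EuclideanSpace ℝ (Fin (d + 1)) →L[ℝ] ℝ :=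
  (g.bilin ((extChartAt (𝓡 (d + 1)) x₀).symm y)).bilinearComp
    (chartVec x₀ ((extChartAt (𝓡 (d + 1)) x₀).symm y))
    (chartVec x₀ ((extChartAt (𝓡 (d + 1)) x₀).symm y))

theorem contMDiffOn_mk_chartVec {E' : Type*} [NormedAddCommGroup E'] [NormedSpace ℝ E']
    {H' : Type*} [TopologicalSpace H'] {J : ModelWithCorners ℝ E' H'}
    {Y : Type*} [TopologicalSpace Y] [ChartedSpace H' Y] {b : Y → M} {s : Set Y}
    {p : Y → EuclideanSpace ℝ (Fin (d + 1))} {x₀ : M}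
    (hb : ContMDiffOn J (𝓡 (d + 1)) ∞ b s)
    (hp : ContMDiffOn J 𝓘(ℝ, EuclideanSpace ℝ (Fin (d + 1))) ∞ p s)
    (hs : ∀ y ∈ s, b y ∈ (chartAt (EuclideanSpace ℝ (Fin (d + 1))) x₀).source) :
    ContMDiffOn J (𝓡 (d + 1)).tangent ∞
      (fun y => (⟨b y, chartVec x₀ (b y) (p y)⟩ : TangentBundle (𝓡 (d + 1)) M)) s := by
  set e := trivializationAt (EuclideanSpace ℝ (Fin (d + 1)))
    (TangentSpace (𝓡 (d + 1)) : M → Type _) x₀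
  have h := (Bundle.Trivialization.contMDiffOn_symm (n := ∞) (IB := 𝓡 (d + 1)) e).comp
    (t := e.target) (hb.prodMk hp) (fun y hy => e.mem_target.2 (hs y hy))
  exact h.congr fun y hy => mk_chartVec (hs y hy) (p y)

theorem continuousOn_mk_chartVec {Y : Type*} [TopologicalSpace Y] {b : Y → M} {s : Set Y}
    {p : Y → EuclideanSpace ℝ (Fin (d + 1))} {x₀ : M} (hb : ContinuousOn b s)
    (hp : ContinuousOn p s)
    (hs : ∀ y ∈ s, b y ∈ (chartAt (EuclideanSpace ℝ (Fin (d + 1))) x₀).source) :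
    ContinuousOn
      (fun y => (⟨b y, chartVec x₀ (b y) (p y)⟩ : TangentBundle (𝓡 (d + 1)) M)) s := by
  set e := trivializationAt (EuclideanSpace ℝ (Fin (d + 1)))
    (TangentSpace (𝓡 (d + 1)) : M → Type _) x₀
  have h := (e.toOpenPartialHomeomorph.continuousOn_symm).comp
    (t := e.target) (hb.prodMk hp) (fun y hy => e.mem_target.2 (hs y hy))
  exact h.congr fun y hy => mk_chartVec (hs y hy) (p y)

theorem contDiffOn_inChart (x₀ : M) :
    ContDiffOn ℝ ∞ (g.inChart x₀) (extChartAt (𝓡 (d + 1)) x₀).target := by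
  rw [contDiffOn_clm_apply]
  intro u
  rw [contDiffOn_clm_apply]
  intro v
  rw [← contMDiffOn_iff_contDiffOn]
  have hs : ∀ y ∈ (extChartAt (𝓡 (d + 1)) x₀).target, (extChartAt (𝓡 (d + 1)) x₀).symm y ∈
      (chartAt (EuclideanSpace ℝ (Fin (d + 1))) x₀).source := by
    intro y hy
    have := (extChartAt (𝓡 (d + 1)) x₀).map_target hy
    rwa [extChartAt_source] at this
  have h (u : EuclideanSpace ℝ (Fin (d + 1))) :=
    contMDiffOn_mk_chartVec (p := fun _ => u) (contMDiffOn_extChartAt_symm (n := ∞) x₀)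
      contMDiffOn_const hs
  exact g.contMDiffOn_apply (v := fun y => chartVec x₀ ((extChartAt (𝓡 (d + 1)) x₀).symm y) u)
    (w := fun y => chartVec x₀ ((extChartAt (𝓡 (d + 1)) x₀).symm y) v) (h u) (h v)

theorem inChart_self (x : M) (u v : EuclideanSpace ℝ (Fin (d + 1))) :
    g.inChart x (extChartAt (𝓡 (d + 1)) x x) u v = g.bilin x u v := by
  rw [LorentzMetric.inChart, ContinuousLinearMap.bilinearComp_apply, extChartAt_to_inv,
    chartVec_self, chartVec_self]

theorem mfderiv_extChartAt_symm_eq_chartVec (x₀ : M) {y : EuclideanSpace ℝ (Fin (d + 1))}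
    (hy : y ∈ (extChartAt (𝓡 (d + 1)) x₀).target) :
    mfderiv 𝓘(ℝ, EuclideanSpace ℝ (Fin (d + 1))) (𝓡 (d + 1)) (extChartAt (𝓡 (d + 1)) x₀).symm y =
      chartVec x₀ ((extChartAt (𝓡 (d + 1)) x₀).symm y) := by
  have hx : (extChartAt (𝓡 (d + 1)) x₀).symm y ∈
      (chartAt (EuclideanSpace ℝ (Fin (d + 1))) x₀).source := by
    have := (extChartAt (𝓡 (d + 1)) x₀).map_target hy
    rwa [extChartAt_source] at this
  have h := TangentBundle.symmL_trivializationAt (I := 𝓡 (d + 1)) hx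
  rw [(extChartAt (𝓡 (d + 1)) x₀).right_inv hy, ModelWithCorners.Boundaryless.range_eq_univ,
    mfderivWithin_univ] at h
  exact h.symm

theorem snd_extChartAt_symm (z : TangentBundle (𝓡 (d + 1)) M)
    {y : EuclideanSpace ℝ (Fin (d + 1)) × EuclideanSpace ℝ (Fin (d + 1))}
    (hy : y.1 ∈ (extChartAt (𝓡 (d + 1)) z.1).target) :
    (extChartAt (𝓡 (d + 1)).tangent z).symm y =
      ⟨(extChartAt (𝓡 (d + 1)) z.1).symm y.1,
        chartVec z.1 ((extChartAt (𝓡 (d + 1)) z.1).symm y.1) y.2⟩ := by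
  have hx : (extChartAt (𝓡 (d + 1)) z.1).symm y.1 ∈
      (chartAt (EuclideanSpace ℝ (Fin (d + 1))) z.1).source := by
    have := (extChartAt (𝓡 (d + 1)) z.1).map_target hy
    rwa [extChartAt_source] at this
  rw [mk_chartVec hx]
  rfl

end TangentBundleLemmas

theorem hasFDerivAt_comp_fst {E E₂ F : Type*} [NormedAddCommGroup E] [NormedSpace ℝ E]
    [NormedAddCommGroup E₂] [NormedSpace ℝ E₂] [NormedAddCommGroup F] [NormedSpace ℝ F]
    {G : E → F} {D : E →L[ℝ] F} {y : E × E₂} (hD : HasFDerivAt G D y.1) :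
    HasFDerivAt (fun y : E × E₂ => G y.1) (D.comp (ContinuousLinearMap.fst ℝ E E₂)) y :=
  hD.comp y hasFDerivAt_fst

/-- The exterior derivative of the one-form `(y, v) ↦ G_y (v, dy)`, contracted with a vertical
vector. -/
theorem extDeriv_bilinear_vertical {E : Type*} [NormedAddCommGroup E] [NormedSpace ℝ E]
    {G : E → E →L[ℝ] E →L[ℝ] ℝ} {y₀ : E × E} (hG : DifferentiableAt ℝ G y₀.1) (p a b : E) :
    extDeriv (fun y : E × E => ContinuousAlternatingMap.ofSubsingleton ℝ _ _ (0 : Fin 1)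
      ((G y.1 y.2).comp (ContinuousLinearMap.fst ℝ E E))) y₀ ![(0, p), (a, b)] = G y₀.1 p a := by
  obtain ⟨D, hD⟩ := hG
  have hfst : HasFDerivAt (fun y : E × E => G y.1)
      (D.comp (ContinuousLinearMap.fst ℝ _ _)) y₀ :=
    hasFDerivAt_comp_fst (F := E →L[ℝ] E →L[ℝ] ℝ) hD
  have hsnd := hfst.clm_apply (hasFDerivAt_snd (𝕜 := ℝ) (p := y₀))
  have hcoef : ∀ w : E × E, fderiv ℝ (fun y => (ContinuousAlternatingMap.ofSubsingleton ℝ _ _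
      (0 : Fin 1) ((G y.1 y.2).comp (ContinuousLinearMap.fst ℝ E E))) ![w]) y₀ =
      fderiv ℝ (fun y : E × E => G y.1 y.2 w.1) y₀ := fun w => rfl
  have hdiff : DifferentiableAt ℝ (fun y : E × E => ContinuousAlternatingMap.ofSubsingleton ℝ _ _
      (0 : Fin 1) ((G y.1 y.2).comp (ContinuousLinearMap.fst ℝ E E))) y₀ :=
    (ContinuousAlternatingMap.ofSubsingletonLIE (𝕜 := ℝ) (E := E × E) (F := ℝ)
      (0 : Fin 1)).toContinuousLinearEquiv.differentiableAt.comp y₀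
        (hsnd.differentiableAt.clm_comp (differentiableAt_const _))
  have hval : ∀ v w : E × E, fderiv ℝ (fun y : E × E => G y.1 y.2 w.1) y₀ v =
      G y₀.1 v.2 w.1 + D v.1 y₀.2 w.1 := by
    intro v w
    have := hsnd.clm_apply (hasFDerivAt_const w.1 y₀)
    rw [this.fderiv]
    simp
  rw [extDeriv_apply hdiff, Fin.sum_univ_two]
  have e0 : (0 : Fin 2).removeNth ![((0 : E), p), (a, b)] = ![(a, b)] := by
    ext i : 1; fin_cases i; rfl
  have e1 : (1 : Fin 2).removeNth ![((0 : E), p), (a, b)] = ![(0, p)] := by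
    ext i : 1; fin_cases i; rfl
  rw [e0, e1, hcoef, hcoef, hval, hval]
  simp

section TangentBundleLemmas

variable {d : ℕ} {M : Type*} [TopologicalSpace M]
  [ChartedSpace (EuclideanSpace ℝ (Fin (d + 1))) M] [IsManifold (𝓡 (d + 1)) ∞ M]
  (g : LorentzMetric d M)

theorem poincareForm_inChart (z : TangentBundle (𝓡 (d + 1)) M)
    (y : EuclideanSpace ℝ (Fin (d + 1)) × EuclideanSpace ℝ (Fin (d + 1)))
    (hy : y ∈ (extChartAt (𝓡 (d + 1)).tangent z).target) :
    (ContinuousAlternatingMap.compContinuousLinearMap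
        (poincareForm g ((extChartAt (𝓡 (d + 1)).tangent z).symm y))
        (mfderiv 𝓘(ℝ, EuclideanSpace ℝ (Fin (d + 1)) × EuclideanSpace ℝ (Fin (d + 1)))
          (𝓡 (d + 1)).tangent (extChartAt (𝓡 (d + 1)).tangent z).symm y) :
          (EuclideanSpace ℝ (Fin (d + 1)) × EuclideanSpace ℝ (Fin (d + 1))) [⋀^Fin 1]→L[ℝ] ℝ) =
      ContinuousAlternatingMap.ofSubsingleton ℝ _ _ (0 : Fin 1)
        ((g.inChart z.1 y.1 y.2).comp (ContinuousLinearMap.fst ℝ _ _)) := by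
  have hy1 : y.1 ∈ (extChartAt (𝓡 (d + 1)) z.1).target := by
    have := FiberBundle.extChartAt_target (IB := 𝓡 (d + 1)) z
    rw [this] at hy
    exact hy.1.1
  have hp : MDifferentiableAt (𝓡 (d + 1)).tangent (𝓡 (d + 1))
      (Bundle.TotalSpace.proj : TangentBundle (𝓡 (d + 1)) M → M)
        ((extChartAt (𝓡 (d + 1)).tangent z).symm y) :=
    (Bundle.contMDiff_proj (n := ∞) (TangentSpace (𝓡 (d + 1)) : M → Type _)
      _).mdifferentiableAt (by simp)
  have hs : MDifferentiableAt
      𝓘(ℝ, EuclideanSpace ℝ (Fin (d + 1)) × EuclideanSpace ℝ (Fin (d + 1)))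
      (𝓡 (d + 1)).tangent (extChartAt (𝓡 (d + 1)).tangent z).symm y :=
    ((contMDiffOn_extChartAt_symm (n := ∞) z).contMDiffAt
      ((isOpen_extChartAt_target z).mem_nhds hy)).mdifferentiableAt (by simp)
  have hs1 : MDifferentiableAt 𝓘(ℝ, EuclideanSpace ℝ (Fin (d + 1)))
      (𝓡 (d + 1)) (extChartAt (𝓡 (d + 1)) z.1).symm y.1 :=
    ((contMDiffOn_extChartAt_symm (n := ∞) z.1).contMDiffAt
      ((isOpen_extChartAt_target z.1).mem_nhds hy1)).mdifferentiableAt (by simp)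
  have h1 : (Bundle.TotalSpace.proj : TangentBundle (𝓡 (d + 1)) M → M) ∘
      (extChartAt (𝓡 (d + 1)).tangent z).symm =
      (extChartAt (𝓡 (d + 1)) z.1).symm ∘ Prod.fst := by
    funext w
    rfl
  have h2 := mfderiv_comp y hp hs
  have h3 := mfderiv_comp (I := 𝓘(ℝ, EuclideanSpace ℝ (Fin (d + 1)) × EuclideanSpace ℝ (Fin (d + 1))))
    (I' := 𝓘(ℝ, EuclideanSpace ℝ (Fin (d + 1)))) (f := Prod.fst) y hs1
    differentiableAt_fst.mdifferentiableAt
  rw [h1] at h2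
  have h4 := h2.symm.trans h3
  have h5 : ∀ w : EuclideanSpace ℝ (Fin (d + 1)) × EuclideanSpace ℝ (Fin (d + 1)),
      (projDeriv ((extChartAt (𝓡 (d + 1)).tangent z).symm y)
        (mfderiv 𝓘(ℝ, EuclideanSpace ℝ (Fin (d + 1)) × EuclideanSpace ℝ (Fin (d + 1)))
          (𝓡 (d + 1)).tangent (extChartAt (𝓡 (d + 1)).tangent z).symm y w) :
          EuclideanSpace ℝ (Fin (d + 1))) =
        chartVec z.1 ((extChartAt (𝓡 (d + 1)) z.1).symm y.1) w.1 := by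
    intro w
    rw [← mfderiv_extChartAt_symm_eq_chartVec z.1 hy1]
    refine (congrArg (fun L : EuclideanSpace ℝ (Fin (d + 1)) × EuclideanSpace ℝ (Fin (d + 1)) →L[ℝ]
      EuclideanSpace ℝ (Fin (d + 1)) => L w) h4).trans ?_
    rw [mfderiv_eq_fderiv, fderiv_fst]
    rfl
  have h6 : ∀ (z' z'' : TangentBundle (𝓡 (d + 1)) M) (w : EuclideanSpace ℝ (Fin (d + 1))),
      z' = z'' → g.bilin z'.1 z'.2 w = g.bilin z''.1 z''.2 w := by
    rintro z' _ w rfl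
    rfl
  ext v
  exact (congrArg (g.bilin _ _) (h5 (v 0))).trans (h6 _ _ _ (snd_extChartAt_symm z hy1))

/-- The exterior derivative of the Poincaré form, contracted with a vertical vector. -/
theorem mextDeriv_poincareForm_vertical (z : TangentBundle (𝓡 (d + 1)) M)
    (p a b : EuclideanSpace ℝ (Fin (d + 1))) :
    (mextDeriv (𝓡 (d + 1)).tangent (poincareForm g) z : (EuclideanSpace ℝ (Fin (d + 1)) ×
      EuclideanSpace ℝ (Fin (d + 1))) [⋀^Fin 2]→L[ℝ] ℝ) ![(0, p), (a, b)] = g.bilin z.1 p a := by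
  have h2 := Filter.EventuallyEq.extDeriv_eq (Filter.eventually_of_mem
    ((isOpen_extChartAt_target (I := (𝓡 (d + 1)).tangent) z).mem_nhds
      (mem_extChartAt_target z)) (poincareForm_inChart g z))
  have h3 : mfderiv (𝓡 (d + 1)).tangent
      𝓘(ℝ, EuclideanSpace ℝ (Fin (d + 1)) × EuclideanSpace ℝ (Fin (d + 1)))
      (extChartAt (𝓡 (d + 1)).tangent z) z = ContinuousLinearMap.id ℝ _ :=
    mfderiv_extChartAt_self (x := z)
  have h4 : ∀ (A : (EuclideanSpace ℝ (Fin (d + 1)) × EuclideanSpace ℝ (Fin (d + 1))) [⋀^Fin 2]→L[ℝ]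
      ℝ) (L : EuclideanSpace ℝ (Fin (d + 1)) × EuclideanSpace ℝ (Fin (d + 1)) →L[ℝ]
        EuclideanSpace ℝ (Fin (d + 1)) × EuclideanSpace ℝ (Fin (d + 1))),
      L = ContinuousLinearMap.id ℝ _ → A.compContinuousLinearMap L = A := by
    rintro A _ rfl
    rfl
  have h5 := extDeriv_bilinear_vertical (G := g.inChart z.1)
    (y₀ := ((extChartAt (𝓡 (d + 1)) z.1 z.1,
      (extChartAt (𝓡 (d + 1)).tangent z z).2)))
    (((contDiffOn_inChart g z.1).contDiffAt ((isOpen_extChartAt_target z.1).mem_nhds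
      (mem_extChartAt_target z.1))).differentiableAt (by simp)) p a b
  rw [inChart_self] at h5
  rw [← h5]
  refine congrArg (fun A : (EuclideanSpace ℝ (Fin (d + 1)) × EuclideanSpace ℝ (Fin (d + 1)))
    [⋀^Fin 2]→L[ℝ] ℝ => A ![(0, p), (a, b)]) ?_
  exact (h4 _ _ h3).trans h2

theorem symplecticForm_vertical (q : ℝ) (F : DForm (𝓡 (d + 1)) M 2 ℝ)
    (z : TangentBundle (𝓡 (d + 1)) M) (p a b : EuclideanSpace ℝ (Fin (d + 1))) :
    (symplecticForm g q F z : (EuclideanSpace ℝ (Fin (d + 1)) × EuclideanSpace ℝ (Fin (d + 1)))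
      [⋀^Fin 2]→ₗ[ℝ] ℝ) ![(0, p), (a, b)] = g.bilin z.1 p a := by
  have hF : (F z.1 : EuclideanSpace ℝ (Fin (d + 1)) [⋀^Fin 2]→ₗ[ℝ] ℝ)
      (fun i => projDeriv z ((![(0, p), (a, b)] : Fin 2 → EuclideanSpace ℝ (Fin (d + 1)) ×
        EuclideanSpace ℝ (Fin (d + 1))) i)) = 0 := by
    refine AlternatingMap.map_coord_zero _ (0 : Fin 2) ?_
    rw [projDeriv_eq_fst]
    rfl
  have h := mextDeriv_poincareForm_vertical g z p a b
  refine (congrArg₂ (fun s t : ℝ => s + q * t) h hF).trans ?_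
  rw [mul_zero, add_zero]

namespace LorentzMetric

theorem exists_orthonormalBasis (x : M) :
    ∃ b : Module.Basis (Fin (d + 1)) ℝ (EuclideanSpace ℝ (Fin (d + 1))),
      ∀ i j, g.bilin x (b i) (b j) = if i = j then (if i = 0 then -1 else 1) else 0 :=
  g.signature x

theorem bilin_symm (x : M) (v w : EuclideanSpace ℝ (Fin (d + 1))) :
    g.bilin x v w = g.bilin x w v :=
  g.symm x v w

theorem eq_zero_of_bilin_eq_zero {x : M} {w : EuclideanSpace ℝ (Fin (d + 1))}
    (h : ∀ v, g.bilin x v w = 0) : w = 0 := by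
  obtain ⟨b, hb⟩ := g.exists_orthonormalBasis x
  refine b.ext_elem fun i => ?_
  have hi := h (b i)
  rw [← b.sum_repr w, map_sum] at hi
  simp only [map_smul, hb, smul_eq_mul, mul_ite, mul_zero, Finset.sum_ite_eq, Finset.mem_univ,
    if_true] at hi
  rw [map_zero, Finsupp.zero_apply]
  split_ifs at hi <;> linarith

end LorentzMetric

theorem contMDiff_hamiltonian :
    ContMDiff (𝓡 (d + 1)).tangent 𝓘(ℝ, ℝ) ∞ (hamiltonian g) := by
  have h := g.contMDiffOn_apply (b := fun z : TangentBundle (𝓡 (d + 1)) M => z.1)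
    (v := fun z => z.2) (w := fun z => z.2) (s := univ) (J := (𝓡 (d + 1)).tangent)
    contMDiff_id.contMDiffOn contMDiff_id.contMDiffOn
  exact (contMDiffOn_univ.1 h).div_const 2

theorem mfderiv_hamiltonian_vertical (x : M) (p₀ p : EuclideanSpace ℝ (Fin (d + 1))) :
    (mfderiv (𝓡 (d + 1)).tangent 𝓘(ℝ, ℝ) (hamiltonian g) (⟨x, p₀⟩ : TangentBundle (𝓡 (d + 1)) M) :
      EuclideanSpace ℝ (Fin (d + 1)) × EuclideanSpace ℝ (Fin (d + 1)) →L[ℝ] ℝ) (0, p) =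
      g.bilin x p p₀ := by
  let mk : EuclideanSpace ℝ (Fin (d + 1)) → TangentBundle (𝓡 (d + 1)) M := fun p => ⟨x, p⟩
  have h := mfderiv_comp (I := 𝓘(ℝ, EuclideanSpace ℝ (Fin (d + 1)))) (f := mk) p₀
    ((contMDiff_hamiltonian g).mdifferentiableAt (x := mk p₀) (by simp))
    ((contMDiff_fiberMk x p₀).mdifferentiableAt (by simp))
  have h1 : HasFDerivAt (hamiltonian g ∘ mk) (g.bilin x p₀) p₀ := by
    have h2 := (((g.bilin x).hasFDerivAt (x := p₀)).clm_apply (hasFDerivAt_id p₀)).mul_const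
      (2⁻¹ : ℝ)
    refine h2.congr_fderiv ?_
    ext v
    have h3 := g.bilin_symm x v p₀
    change 2⁻¹ * (g.bilin x p₀ v + g.bilin x v p₀) = g.bilin x p₀ v
    rw [h3]
    ring
  have h2 := mfderiv_eq_fderiv.symm.trans h
  have h3 := congrArg (fun L : EuclideanSpace ℝ (Fin (d + 1)) →L[ℝ] ℝ => L p)
    (h1.fderiv.symm.trans h2)
  rw [g.bilin_symm]
  refine Eq.trans ?_ h3.symm
  refine congrArg (mfderiv (𝓡 (d + 1)).tangent 𝓘(ℝ, ℝ) (hamiltonian g) (⟨x, p₀⟩ :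
    TangentBundle (𝓡 (d + 1)) M) : EuclideanSpace ℝ (Fin (d + 1)) ×
      EuclideanSpace ℝ (Fin (d + 1)) →L[ℝ] ℝ) ?_
  exact (congrArg (fun L : EuclideanSpace ℝ (Fin (d + 1)) →L[ℝ] EuclideanSpace ℝ (Fin (d + 1)) ×
    EuclideanSpace ℝ (Fin (d + 1)) => L p) (mfderiv_fiberMk x p₀)).symm

theorem AlternatingMap.map_pair_swap {V : Type*} [AddCommGroup V] [Module ℝ V]
    (α : V [⋀^Fin 2]→ₗ[ℝ] ℝ) (v w : V) : α ![v, w] = -α ![w, v] := by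
  have h := α.map_swap ![w, v] (i := 0) (j := 1) (by decide)
  rw [← h]
  congr 1
  ext i
  fin_cases i <;> rfl

/-- If `α` pairs the vertical vectors nondegenerately with the horizontal ones, then every covector
is represented by a vector. -/
theorem AlternatingMap.exists_pair_eq {E : Type*} [AddCommGroup E] [Module ℝ E]
    [FiniteDimensional ℝ E] (α : (E × E) [⋀^Fin 2]→ₗ[ℝ] ℝ) {G : E → E → ℝ}
    (hα : ∀ p a b, α ![(0, p), (a, b)] = G p a) (hl : ∀ a, (∀ p, G p a = 0) → a = 0)
    (hr : ∀ p, (∀ a, G p a = 0) → p = 0) (φ : E × E →ₗ[ℝ] ℝ) :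
    ∃ L : E × E, ∀ v, α ![v, L] = φ v := by
  have u0 : ∀ L v : E × E, ![L, v] = Function.update ![0, v] 0 L := fun L v => by
    ext i : 1; fin_cases i <;> rfl
  have u1 : ∀ L v : E × E, ![L, v] = Function.update ![L, 0] 1 v := fun L v => by
    ext i : 1; fin_cases i <;> rfl
  let B : E × E →ₗ[ℝ] Module.Dual ℝ (E × E) :=
    LinearMap.mk₂ ℝ (fun L v => α ![L, v])
      (fun L L' v => by rw [u0, α.map_update_add, ← u0, ← u0])
      (fun c L v => by rw [u0, α.map_update_smul, ← u0])
      (fun L v v' => by rw [u1, α.map_update_add, ← u1, ← u1])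
      (fun c L v => by rw [u1, α.map_update_smul, ← u1])
  have hB : Function.Injective B := by
    rw [← LinearMap.ker_eq_bot, LinearMap.ker_eq_bot']
    intro L hL
    have h : ∀ v, α ![L, v] = 0 := fun v => LinearMap.congr_fun hL v
    have h1 : L.1 = 0 := hl _ fun p => by
      rw [← hα p L.1 L.2, α.map_pair_swap, h, neg_zero]
    have h2 : L.2 = 0 := hr _ fun a => by
      rw [← hα L.2 a 0, ← h (a, 0), ← h1]
    exact Prod.ext h1 h2
  obtain ⟨L, hL⟩ := (LinearMap.injective_iff_surjective_of_finrank_eq_finrank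
    (Subspace.dual_finrank_eq (K := ℝ) (V := E × E)).symm).1 hB (-φ)
  refine ⟨L, fun v => ?_⟩
  rw [α.map_pair_swap]
  have := LinearMap.congr_fun hL v
  change α ![L, v] = -φ v at this
  rw [this, neg_neg]

theorem liouvilleField_fst (q : ℝ) (F : DForm (𝓡 (d + 1)) M 2 ℝ)
    (x : M) (p₀ : EuclideanSpace ℝ (Fin (d + 1))) :
    (liouvilleField g q F (⟨x, p₀⟩ : TangentBundle (𝓡 (d + 1)) M) :
      EuclideanSpace ℝ (Fin (d + 1)) × EuclideanSpace ℝ (Fin (d + 1))).1 = p₀ := by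
  set z : TangentBundle (𝓡 (d + 1)) M := ⟨x, p₀⟩ with hz
  have h := Classical.epsilon_spec (AlternatingMap.exists_pair_eq
    (symplecticForm g q F z : (EuclideanSpace ℝ (Fin (d + 1)) × EuclideanSpace ℝ (Fin (d + 1)))
        [⋀^Fin 2]→ₗ[ℝ] ℝ) (symplecticForm_vertical g q F z)
    (fun a => g.eq_zero_of_bilin_eq_zero)
    (fun p hp => g.eq_zero_of_bilin_eq_zero fun a => (g.bilin_symm x a p).trans (hp a))
    (mfderiv (𝓡 (d + 1)).tangent 𝓘(ℝ, ℝ) (hamiltonian g) z : EuclideanSpace ℝ (Fin (d + 1)) ×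
      EuclideanSpace ℝ (Fin (d + 1)) →L[ℝ] ℝ).toLinearMap)
  change ∀ v : EuclideanSpace ℝ (Fin (d + 1)) × EuclideanSpace ℝ (Fin (d + 1)),
    (symplecticForm g q F z : (EuclideanSpace ℝ (Fin (d + 1)) × EuclideanSpace ℝ (Fin (d + 1)))
        [⋀^Fin 2]→ₗ[ℝ] ℝ) ![v, liouvilleField g q F z] =
      (mfderiv (𝓡 (d + 1)).tangent 𝓘(ℝ, ℝ) (hamiltonian g) z : EuclideanSpace ℝ (Fin (d + 1)) ×
      EuclideanSpace ℝ (Fin (d + 1)) →L[ℝ] ℝ) v at h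
  generalize (liouvilleField g q F z : EuclideanSpace ℝ (Fin (d + 1)) ×
      EuclideanSpace ℝ (Fin (d + 1))) = L at h ⊢
  refine sub_eq_zero.1 (g.eq_zero_of_bilin_eq_zero (x := x) fun p => ?_)
  have h1 := (h (0, p)).trans (mfderiv_hamiltonian_vertical g x p₀ p)
  rw [map_sub, sub_eq_zero]
  exact (symplecticForm_vertical g q F z p L.1 L.2).symm.trans h1

theorem dilationField_eq (x : M) (p : EuclideanSpace ℝ (Fin (d + 1))) :
    (dilationField (⟨x, p⟩ : TangentBundle (𝓡 (d + 1)) M) : EuclideanSpace ℝ (Fin (d + 1)) ×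
      EuclideanSpace ℝ (Fin (d + 1))) = (0, p) := by
  let e : ℝ → EuclideanSpace ℝ (Fin (d + 1)) := fun s => Real.exp s • p
  have he : HasFDerivAt e ((1 : ℝ →L[ℝ] ℝ).smulRight p) 0 := by
    have := ((Real.hasDerivAt_exp 0).smul_const p).hasFDerivAt
    rw [Real.exp_zero, one_smul] at this
    exact this
  have h := mfderiv_comp (I := 𝓘(ℝ, ℝ)) (I' := 𝓘(ℝ, EuclideanSpace ℝ (Fin (d + 1)))) (f := e) 0
    ((contMDiff_fiberMk x (e 0)).mdifferentiableAt (by simp)) he.differentiableAt.mdifferentiableAt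
  rw [mfderiv_eq_fderiv, he.fderiv] at h
  refine (congrArg (fun L : ℝ →L[ℝ] EuclideanSpace ℝ (Fin (d + 1)) ×
    EuclideanSpace ℝ (Fin (d + 1)) => L 1) h).trans ?_
  have h2 := congrArg (fun L : EuclideanSpace ℝ (Fin (d + 1)) →L[ℝ] EuclideanSpace ℝ (Fin (d + 1)) ×
    EuclideanSpace ℝ (Fin (d + 1)) => L p) (mfderiv_fiberMk x (e 0))
  refine Eq.trans ?_ h2
  refine congrArg (mfderiv 𝓘(ℝ, EuclideanSpace ℝ (Fin (d + 1))) (𝓡 (d + 1)).tangent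
      (fun p : EuclideanSpace ℝ (Fin (d + 1)) => (⟨x, p⟩ : TangentBundle (𝓡 (d + 1)) M)) (e 0) :
      EuclideanSpace ℝ (Fin (d + 1)) →L[ℝ] EuclideanSpace ℝ (Fin (d + 1)) ×
    EuclideanSpace ℝ (Fin (d + 1))) ?_
  change (1 : ℝ) • p = p
  rw [one_smul]

end TangentBundleLemmas

/-- Prepending an element of the left index set. -/
noncomputable def consLeftEquiv {a b n : ℕ} (e : Fin a ⊕ Fin b ≃ Fin n) :
    Fin (a + 1) ⊕ Fin b ≃ Fin (n + 1) :=
  Equiv.ofBijective (Sum.elim (Fin.cases 0 fun i => (e (Sum.inl i)).succ)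
    fun j => (e (Sum.inr j)).succ) <| by
    refine (Fintype.bijective_iff_injective_and_card _).2 ⟨?_, ?_⟩
    · rintro (i | i) (j | j) h
      · refine Fin.cases ?_ (fun i => ?_) i h <;> refine Fin.cases ?_ (fun j => ?_) j <;> intro h
        · rfl
        · exact absurd h (Fin.succ_ne_zero _).symm
        · exact absurd h (Fin.succ_ne_zero _)
        · exact congrArg (fun k => Sum.inl (Fin.succ k))
            (Sum.inl_injective (e.injective (Fin.succ_injective _ h)))
      · refine Fin.cases ?_ (fun i => ?_) i h <;> intro h
        · exact absurd h (Fin.succ_ne_zero _).symm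
        · have := e.injective (Fin.succ_injective _ h)
          simp at this
      · refine Fin.cases ?_ (fun j => ?_) j h <;> intro h
        · exact absurd h (Fin.succ_ne_zero _)
        · have := e.injective (Fin.succ_injective _ h)
          simp at this
      · exact congrArg Sum.inr (Sum.inr_injective (e.injective (Fin.succ_injective _ h)))
    · have := Fintype.card_congr e
      simp only [Fintype.card_sum, Fintype.card_fin] at this ⊢
      omega

/-- Prepending an element of the right index set. -/
noncomputable def consRightEquiv {a b n : ℕ} (e : Fin a ⊕ Fin b ≃ Fin n) :
    Fin a ⊕ Fin (b + 1) ≃ Fin (n + 1) :=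
  (Equiv.sumComm _ _).trans (consLeftEquiv ((Equiv.sumComm _ _).trans e))

section VolumeForms

variable {d : ℕ} {M : Type*} [TopologicalSpace M]
  [ChartedSpace (EuclideanSpace ℝ (Fin (d + 1))) M] [IsManifold (𝓡 (d + 1)) ∞ M]
  (g : LorentzMetric d M) (o : ManifoldOrientation d M)

theorem abs_volForm_eq_abs_det {x : M}
    {b : Module.Basis (Fin (d + 1)) ℝ (EuclideanSpace ℝ (Fin (d + 1)))}
    (hb : ∀ i j, g.bilin x (b i) (b j) = if i = j then (if i = 0 then -1 else 1) else 0)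
    (v : Fin (d + 1) → EuclideanSpace ℝ (Fin (d + 1))) :
    |(volForm g o x : EuclideanSpace ℝ (Fin (d + 1)) [⋀^Fin (d + 1)]→ₗ[ℝ] ℝ) v| = |b.det v| :=
  abs_basis_volume (G := (ContinuousLinearMap.coeLM ℝ).comp (g.bilin x).toLinearMap) b hb _ v

theorem abs_volForm (x : M) (v : Fin (d + 1) → EuclideanSpace ℝ (Fin (d + 1))) :
    |(volForm g o x : EuclideanSpace ℝ (Fin (d + 1)) [⋀^Fin (d + 1)]→ₗ[ℝ] ℝ) v| =
      Real.sqrt (-(Matrix.of fun i j => g.bilin x (v i) (v j)).det) := by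
  obtain ⟨b, hb⟩ := g.exists_orthonormalBasis x
  rw [abs_volForm_eq_abs_det g o hb]
  exact (sqrt_neg_det_gram (G := (ContinuousLinearMap.coeLM ℝ).comp (g.bilin x).toLinearMap)
    b hb v).symm

theorem continuousOn_abs_volForm {Y : Type*} [TopologicalSpace Y] {b : Y → M} {s : Set Y}
    {v : Y → Fin (d + 1) → EuclideanSpace ℝ (Fin (d + 1))}
    (hv : ∀ i, ContinuousOn (fun y => (⟨b y, v y i⟩ : TangentBundle (𝓡 (d + 1)) M)) s) :
    ContinuousOn (fun y => |(volForm g o (b y) : EuclideanSpace ℝ (Fin (d + 1))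
      [⋀^Fin (d + 1)]→ₗ[ℝ] ℝ) (v y)|) s := by
  have hG : ContinuousOn (fun y => Real.sqrt
      (-(Matrix.of fun i j => g.bilin (b y) (v y i) (v y j)).det)) s := by
    refine Real.continuous_sqrt.comp_continuousOn (ContinuousOn.neg ?_)
    simp only [Matrix.det_apply]
    refine continuousOn_finsetSum _ fun σ _ => ContinuousOn.const_smul ?_ _
    refine continuousOn_finsetProd _ fun i _ => ?_
    exact g.continuousOn_apply (v := fun y => v y (σ i)) (w := fun y => v y i) (hv _) (hv _)
  exact hG.congr fun y _ => abs_volForm g o (b y) (v y)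

theorem abs_bundleVolForm (q : ℝ) (F : DForm (𝓡 (d + 1)) M 2 ℝ) (z : TangentBundle (𝓡 (d + 1)) M)
    (v : Fin (2 * d + 1 + 1) → EuclideanSpace ℝ (Fin (d + 1)) × EuclideanSpace ℝ (Fin (d + 1)))
    (e : Fin (d + 1) ⊕ Fin (d + 1) ≃ Fin (2 * d + 1 + 1)) (hv : ∀ j, (v (e (Sum.inr j))).1 = 0) :
    |(bundleVolForm g q F z : (EuclideanSpace ℝ (Fin (d + 1)) × EuclideanSpace ℝ (Fin (d + 1)))
      [⋀^Fin (2 * d + 1 + 1)]→ₗ[ℝ] ℝ) v| =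
      |(volForm g o z.1 : EuclideanSpace ℝ (Fin (d + 1)) [⋀^Fin (d + 1)]→ₗ[ℝ] ℝ)
          fun i => (v (e (Sum.inl i))).1| *
        |(volForm g o z.1 : EuclideanSpace ℝ (Fin (d + 1)) [⋀^Fin (d + 1)]→ₗ[ℝ] ℝ)
          fun j => (v (e (Sum.inr j))).2| := by
  obtain ⟨b, hb⟩ := g.exists_orthonormalBasis z.1
  rw [abs_volForm_eq_abs_det g o hb, abs_volForm_eq_abs_det g o hb]
  have h := abs_twoFormWedgePow_block
    (symplecticForm g q F z : (EuclideanSpace ℝ (Fin (d + 1)) × EuclideanSpace ℝ (Fin (d + 1)))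
        [⋀^Fin 2]→ₗ[ℝ] ℝ) b
    (fun p p' => (symplecticForm_vertical g q F z p 0 p').trans (map_zero _))
    (fun i j => by
      have h1 := (AlternatingMap.map_pair_swap (symplecticForm g q F z :
        (EuclideanSpace ℝ (Fin (d + 1)) × EuclideanSpace ℝ (Fin (d + 1))) [⋀^Fin 2]→ₗ[ℝ] ℝ)
        (b i, 0) (0, b j)).trans (congrArg Neg.neg (symplecticForm_vertical g q F z (b j) (b i) 0))
      refine (congrArg abs h1).trans ?_
      rw [hb, abs_neg]
      by_cases hij : i = j
      · subst hij
        by_cases h0 : i = 0 <;> simp [h0]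
      · rw [if_neg (Ne.symm hij), if_neg hij, abs_zero]) v e hv
  have hfac : (0 : ℝ) < (d + 1).factorial := by positivity
  change |((-1 : ℝ) ^ ((d + 1) * d / 2) / (Nat.factorial (d + 1) : ℝ)) * _| = _
  refine (abs_mul _ _).trans ?_
  refine (congrArg (_ * ·) h).trans ?_
  rw [abs_div, abs_pow, abs_neg, abs_one, one_pow, abs_of_pos hfac, ← mul_assoc,
    one_div_mul_cancel hfac.ne', one_mul]

theorem abs_shellForm (q : ℝ) (F : DForm (𝓡 (d + 1)) M 2 ℝ) (x : M)
    (p : EuclideanSpace ℝ (Fin (d + 1)))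
    (v : Fin (2 * d + 1) → EuclideanSpace ℝ (Fin (d + 1)) × EuclideanSpace ℝ (Fin (d + 1)))
    (e : Fin (d + 1) ⊕ Fin d ≃ Fin (2 * d + 1)) (hv : ∀ j, (v (e (Sum.inr j))).1 = 0) :
    |(shellForm g q F (⟨x, p⟩ : TangentBundle (𝓡 (d + 1)) M) :
      (EuclideanSpace ℝ (Fin (d + 1)) × EuclideanSpace ℝ (Fin (d + 1)))
      [⋀^Fin (2 * d + 1)]→ₗ[ℝ] ℝ) v| =
      |(volForm g o x : EuclideanSpace ℝ (Fin (d + 1)) [⋀^Fin (d + 1)]→ₗ[ℝ] ℝ)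
          fun i => (v (e (Sum.inl i))).1| *
        |(fibreForm g o x p : EuclideanSpace ℝ (Fin (d + 1)) [⋀^Fin d]→ₗ[ℝ] ℝ)
          fun j => (v (e (Sum.inr j))).2| := by
  have hN : ((2 * hamiltonian g (⟨x, p⟩ : TangentBundle (𝓡 (d + 1)) M))⁻¹ •
      (dilationField (⟨x, p⟩ : TangentBundle (𝓡 (d + 1)) M) : EuclideanSpace ℝ (Fin (d + 1)) ×
      EuclideanSpace ℝ (Fin (d + 1)))) = (0, (g.bilin x p p)⁻¹ • p) := by
    rw [dilationField_eq]
    refine Prod.ext (smul_zero _) ?_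
    have : 2 * hamiltonian g (⟨x, p⟩ : TangentBundle (𝓡 (d + 1)) M) = g.bilin x p p :=
      mul_div_cancel₀ (g.bilin x p p) two_ne_zero
    rw [this]
    rfl
  have h := abs_bundleVolForm g o q F (⟨x, p⟩ : TangentBundle (𝓡 (d + 1)) M)
    (Matrix.vecCons (0, (g.bilin x p p)⁻¹ • p) v) (consRightEquiv e) (by
      intro j
      refine Fin.cases ?_ (fun j => ?_) j
      · rfl
      · exact hv j)
  rw [← hN] at h
  refine h.trans ?_
  refine congrArg₂ (fun s t : ℝ => s * |t|) rfl ?_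
  refine congrArg (volForm g o x : EuclideanSpace ℝ (Fin (d + 1)) [⋀^Fin (d + 1)]→ₗ[ℝ] ℝ) ?_
  funext j
  refine Fin.cases ?_ (fun j => ?_) j
  · exact congrArg Prod.snd hN
  · rfl

theorem abs_fluxForm (q : ℝ) (F : DForm (𝓡 (d + 1)) M 2 ℝ) (x : M)
    (p : EuclideanSpace ℝ (Fin (d + 1)))
    (v : Fin (2 * d) → EuclideanSpace ℝ (Fin (d + 1)) × EuclideanSpace ℝ (Fin (d + 1)))
    (e : Fin d ⊕ Fin d ≃ Fin (2 * d)) (hv : ∀ j, (v (e (Sum.inr j))).1 = 0) :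
    |(fluxForm g q F (⟨x, p⟩ : TangentBundle (𝓡 (d + 1)) M) :
      (EuclideanSpace ℝ (Fin (d + 1)) × EuclideanSpace ℝ (Fin (d + 1)))
      [⋀^Fin (2 * d)]→ₗ[ℝ] ℝ) v| =
      |(volForm g o x : EuclideanSpace ℝ (Fin (d + 1)) [⋀^Fin (d + 1)]→ₗ[ℝ] ℝ)
          (Matrix.vecCons p fun i => (v (e (Sum.inl i))).1)| *
        |(fibreForm g o x p : EuclideanSpace ℝ (Fin (d + 1)) [⋀^Fin d]→ₗ[ℝ] ℝ)
          fun j => (v (e (Sum.inr j))).2| := by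
  have hL := liouvilleField_fst g q F x p
  have h := abs_shellForm g o q F x p
    (Matrix.vecCons (liouvilleField g q F (⟨x, p⟩ : TangentBundle (𝓡 (d + 1)) M) :
      EuclideanSpace ℝ (Fin (d + 1)) × EuclideanSpace ℝ (Fin (d + 1))) v) (consLeftEquiv e) hv
  refine h.trans ?_
  refine congrArg₂ (fun s t : ℝ => |s| * t) ?_ rfl
  refine congrArg (volForm g o x : EuclideanSpace ℝ (Fin (d + 1)) [⋀^Fin (d + 1)]→ₗ[ℝ] ℝ) ?_
  funext i
  refine Fin.cases ?_ (fun i => ?_) i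
  · exact hL
  · rfl

end VolumeForms

section Cone

variable {d : ℕ} {M : Type*} [TopologicalSpace M]
  [ChartedSpace (EuclideanSpace ℝ (Fin (d + 1))) M] [IsManifold (𝓡 (d + 1)) ∞ M]
  (g : LorentzMetric d M)

namespace LorentzMetric

theorem bilin_eq_sum {x : M} {b : Module.Basis (Fin (d + 1)) ℝ (EuclideanSpace ℝ (Fin (d + 1)))}
    (hb : ∀ i j, g.bilin x (b i) (b j) = if i = j then (if i = 0 then -1 else 1) else 0)
    (v w : EuclideanSpace ℝ (Fin (d + 1))) :
    g.bilin x v w = -(b.repr v 0 * b.repr w 0) + ∑ i : Fin d, b.repr v i.succ * b.repr w i.succ := by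
  conv_lhs => rw [← b.sum_repr v, ← b.sum_repr w]
  simp only [map_sum, sum_apply, map_smul, smul_apply, smul_eq_mul, hb, mul_ite, mul_zero]
  rw [Fin.sum_univ_succ]
  simp [Fin.succ_ne_zero, mul_comm]

/-- Two timelike vectors are never orthogonal, and their product is negative exactly if they have
time components of the same sign. -/
theorem exists_timeComponent (x : M) : ∃ t : EuclideanSpace ℝ (Fin (d + 1)) → ℝ, ∀ v w,
    g.bilin x v v < 0 → g.bilin x w w < 0 →
      (0 < t v * t w ∧ g.bilin x v w < 0) ∨ (t v * t w < 0 ∧ 0 < g.bilin x v w) := by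
  obtain ⟨b, hb⟩ := g.exists_orthonormalBasis x
  refine ⟨fun v => b.repr v 0, fun v w hv hw => ?_⟩
  rw [g.bilin_eq_sum hb] at hv hw
  rw [g.bilin_eq_sum hb]
  have hcs := Finset.sum_mul_sq_le_sq_mul_sq Finset.univ (fun i : Fin d => b.repr v i.succ)
    (fun i : Fin d => b.repr w i.succ)
  have h1 : 0 ≤ ∑ i : Fin d, b.repr v i.succ ^ 2 := Finset.sum_nonneg fun i _ => sq_nonneg _
  have h2 : 0 ≤ ∑ i : Fin d, b.repr w i.succ ^ 2 := Finset.sum_nonneg fun i _ => sq_nonneg _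
  simp only [← sq] at hv hw
  set A := ∑ i : Fin d, b.repr v i.succ ^ 2
  set B := ∑ i : Fin d, b.repr w i.succ ^ 2
  set C := ∑ i : Fin d, b.repr v i.succ * b.repr w i.succ
  set s := b.repr v 0
  set t := b.repr w 0
  have h3 : C ^ 2 < (s * t) ^ 2 := by
    rw [mul_pow]
    refine hcs.trans_lt ?_
    exact mul_lt_mul'' (by linarith) (by linarith) h1 h2
  rw [sq_lt_sq] at h3
  rcases lt_trichotomy (s * t) 0 with h | h | h
  · right
    rw [abs_of_neg h] at h3
    exact ⟨h, by linarith [neg_abs_le C]⟩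
  · rw [h, abs_zero] at h3
    exact absurd h3 (abs_nonneg C).not_gt
  · left
    rw [abs_of_pos h] at h3
    exact ⟨h, by linarith [le_abs_self C]⟩

variable {g}

theorem bilin_ne_zero_of_timelike {x : M} {v w : EuclideanSpace ℝ (Fin (d + 1))}
    (hv : g.bilin x v v < 0) (hw : g.bilin x w w < 0) : g.bilin x v w ≠ 0 := by
  obtain ⟨t, ht⟩ := g.exists_timeComponent x
  rcases ht v w hv hw with h | h
  · exact h.2.ne
  · exact h.2.ne'

/-- Two timelike vectors in the same cone as `T` have a negative product. -/
theorem bilin_neg_of_same_cone {x : M} {T v w : EuclideanSpace ℝ (Fin (d + 1))}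
    (hT : g.bilin x T T < 0) (hv : g.bilin x v v < 0) (hw : g.bilin x w w < 0)
    (hTv : g.bilin x T v < 0) (hTw : g.bilin x T w < 0) : g.bilin x v w < 0 := by
  obtain ⟨t, ht⟩ := g.exists_timeComponent x
  rcases ht T v hT hv with ⟨h1, -⟩ | h
  swap
  · exact absurd hTv h.2.le.not_gt
  rcases ht T w hT hw with ⟨h2, -⟩ | h
  swap
  · exact absurd hTw h.2.le.not_gt
  rcases ht v w hv hw with h | h
  · exact h.2
  · nlinarith [mul_pos h1 h2, sq_nonneg (t T), mul_nonneg (sq_nonneg (t T)) (neg_nonneg.2 h.1.le)]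

theorem bilin_add_smul_self (x : M) (v w : EuclideanSpace ℝ (Fin (d + 1))) (c : ℝ) :
    g.bilin x (v + c • w) (v + c • w) =
      g.bilin x v v + 2 * c * g.bilin x v w + c ^ 2 * g.bilin x w w := by
  simp only [map_add, add_apply, map_smul, smul_apply,
    smul_eq_mul, g.bilin_symm x w v]
  ring

theorem bilin_add_smul_neg {x : M} {T v w : EuclideanSpace ℝ (Fin (d + 1))}
    (hT : g.bilin x T T < 0) (hv : g.bilin x v v < 0) (hw : g.bilin x w w < 0)
    (hTv : g.bilin x T v < 0) (hTw : g.bilin x T w < 0) {c : ℝ} (hc : 0 ≤ c) :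
    g.bilin x (v + c • w) (v + c • w) < 0 := by
  rw [bilin_add_smul_self]
  have h := bilin_neg_of_same_cone hT hv hw hTv hTw
  nlinarith [mul_nonneg hc (neg_nonneg.2 h.le), mul_nonneg (sq_nonneg c) (neg_nonneg.2 hw.le)]

end LorentzMetric

end Cone

section ShellChart

variable {d : ℕ} {M : Type*} [TopologicalSpace M]
  [ChartedSpace (EuclideanSpace ℝ (Fin (d + 1))) M] [IsManifold (𝓡 (d + 1)) ∞ M]

/-- A frame of the tangent bundle over an open set, which splits the tangent spaces into a future
timelike line and a spacelike hyperplane. -/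
structure SplittingFrame (g : LorentzMetric d M) (τ : TimeOrientation g) where
  /-- the centre of a chart -/
  center : M
  /-- the open set -/
  V : Set M
  /-- the components, in the chart, of the constant frame -/
  comp : (ℝ × EuclideanSpace ℝ (Fin d)) ≃L[ℝ] EuclideanSpace ℝ (Fin (d + 1))
  isOpen_V : IsOpen V
  subset_source : V ⊆ (chartAt (EuclideanSpace ℝ (Fin (d + 1))) center).source
  timelike : ∀ x ∈ V,
    g.bilin x (chartVec center x (comp (1, 0))) (chartVec center x (comp (1, 0))) < 0
  future : ∀ x ∈ V, g.bilin x (τ.vec x) (chartVec center x (comp (1, 0))) < 0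
  spacelike : ∀ x ∈ V, ∀ u, u ≠ 0 →
    0 < g.bilin x (chartVec center x (comp (0, u))) (chartVec center x (comp (0, u)))

namespace SplittingFrame

variable {g : LorentzMetric d M} {τ : TimeOrientation g} (C : SplittingFrame g τ)

/-- The vector at `x` with given time component and space components. -/
noncomputable def vec (x : M) :
    ℝ × EuclideanSpace ℝ (Fin d) →L[ℝ] EuclideanSpace ℝ (Fin (d + 1)) :=
  (chartVec C.center x).comp C.comp.toContinuousLinearMap

/-- The components of a vector at `x`. -/
noncomputable def coord (x : M) :
    EuclideanSpace ℝ (Fin (d + 1)) →L[ℝ] ℝ × EuclideanSpace ℝ (Fin d) :=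
  C.comp.symm.toContinuousLinearMap.comp ((trivializationAt (EuclideanSpace ℝ (Fin (d + 1)))
    (TangentSpace (𝓡 (d + 1)) : M → Type _) C.center).continuousLinearMapAt ℝ x)

theorem coord_vec {x : M} (hx : x ∈ C.V) (w : ℝ × EuclideanSpace ℝ (Fin d)) :
    C.coord x (C.vec x w) = w := by
  have h := (trivializationAt (EuclideanSpace ℝ (Fin (d + 1)))
    (TangentSpace (𝓡 (d + 1)) : M → Type _) C.center).continuousLinearMapAt_symmL (R := ℝ)
      (C.subset_source hx) (C.comp w)
  exact (congrArg C.comp.symm h).trans (C.comp.symm_apply_apply w)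

theorem vec_coord {x : M} (hx : x ∈ C.V) (p : EuclideanSpace ℝ (Fin (d + 1))) :
    C.vec x (C.coord x p) = p := by
  have h := (trivializationAt (EuclideanSpace ℝ (Fin (d + 1)))
    (TangentSpace (𝓡 (d + 1)) : M → Type _) C.center).symmL_continuousLinearMapAt (R := ℝ)
      (C.subset_source hx) p
  refine Eq.trans ?_ h
  exact congrArg (chartVec C.center x) (C.comp.apply_symm_apply _)

theorem vec_mk (x : M) (t : ℝ) (u : EuclideanSpace ℝ (Fin d)) :
    C.vec x (t, u) = C.vec x (0, u) + t • C.vec x (1, 0) := by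
  rw [← map_smul, ← map_add]
  simp

variable (m : ℝ)

/-- The positive time component of the vectors of mass `m` with space components `u`. -/
noncomputable def energy (x : M) (u : EuclideanSpace ℝ (Fin d)) : ℝ :=
  (-g.bilin x (C.vec x (0, u)) (C.vec x (1, 0)) -
    Real.sqrt (g.bilin x (C.vec x (0, u)) (C.vec x (1, 0)) ^ 2 -
      g.bilin x (C.vec x (1, 0)) (C.vec x (1, 0)) *
        (g.bilin x (C.vec x (0, u)) (C.vec x (0, u)) + m ^ 2))) /
    g.bilin x (C.vec x (1, 0)) (C.vec x (1, 0))

/-- The vector at `x` on the future mass hyperboloid with space components `u`. -/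
noncomputable def lift (x : M) (u : EuclideanSpace ℝ (Fin d)) : EuclideanSpace ℝ (Fin (d + 1)) :=
  C.vec x (C.energy m x u, u)

theorem timelike_vec {x : M} (hx : x ∈ C.V) :
    g.bilin x (C.vec x (1, 0)) (C.vec x (1, 0)) < 0 := C.timelike x hx

theorem future_vec {x : M} (hx : x ∈ C.V) : g.bilin x (τ.vec x) (C.vec x (1, 0)) < 0 :=
  C.future x hx

theorem bilin_spatial_nonneg {x : M} (hx : x ∈ C.V) (u : EuclideanSpace ℝ (Fin d)) :
    0 ≤ g.bilin x (C.vec x (0, u)) (C.vec x (0, u)) := by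
  rcases eq_or_ne u 0 with rfl | hu
  · rw [← Prod.zero_eq_mk, map_zero, map_zero]
  · exact (C.spacelike x hx u hu).le

variable {m}

theorem discriminant_pos (hm : 0 < m) {x : M} (hx : x ∈ C.V) (u : EuclideanSpace ℝ (Fin d)) :
    g.bilin x (C.vec x (0, u)) (C.vec x (1, 0)) ^ 2 <
      g.bilin x (C.vec x (0, u)) (C.vec x (1, 0)) ^ 2 -
      g.bilin x (C.vec x (1, 0)) (C.vec x (1, 0)) *
        (g.bilin x (C.vec x (0, u)) (C.vec x (0, u)) + m ^ 2) := by
  have h1 := C.timelike_vec hx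
  have h2 := C.bilin_spatial_nonneg hx u
  have h3 : 0 < m ^ 2 := by positivity
  nlinarith [mul_pos_of_neg_of_neg h1 (neg_lt_zero.2 (add_pos_of_nonneg_of_pos h2 h3))]

theorem energy_pos (hm : 0 < m) {x : M} (hx : x ∈ C.V) (u : EuclideanSpace ℝ (Fin d)) :
    0 < C.energy m x u := by
  refine div_pos_of_neg_of_neg ?_ (C.timelike_vec hx)
  have h := (Real.lt_sqrt (abs_nonneg _)).2 ((sq_abs _).trans_lt (C.discriminant_pos hm hx u))
  linarith [neg_abs_le (g.bilin x (C.vec x (0, u)) (C.vec x (1, 0)))]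

theorem bilin_vec_mk (x : M) (t : ℝ) (u : EuclideanSpace ℝ (Fin d)) :
    g.bilin x (C.vec x (t, u)) (C.vec x (t, u)) = g.bilin x (C.vec x (0, u)) (C.vec x (0, u)) +
      2 * t * g.bilin x (C.vec x (0, u)) (C.vec x (1, 0)) +
        t ^ 2 * g.bilin x (C.vec x (1, 0)) (C.vec x (1, 0)) := by
  rw [C.vec_mk, LorentzMetric.bilin_add_smul_self]

theorem bilin_lift (hm : 0 < m) {x : M} (hx : x ∈ C.V) (u : EuclideanSpace ℝ (Fin d)) :
    g.bilin x (C.lift m x u) (C.lift m x u) = -m ^ 2 := by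
  rw [lift, bilin_vec_mk, energy]
  have h1 := (C.timelike_vec hx).ne
  have h2 := Real.sq_sqrt ((sq_nonneg _).trans_lt (C.discriminant_pos hm hx u)).le
  set r := Real.sqrt (g.bilin x (C.vec x (0, u)) (C.vec x (1, 0)) ^ 2 -
      g.bilin x (C.vec x (1, 0)) (C.vec x (1, 0)) *
        (g.bilin x (C.vec x (0, u)) (C.vec x (0, u)) + m ^ 2))
  generalize g.bilin x (C.vec x (1, 0)) (C.vec x (1, 0)) = a at *
  generalize g.bilin x (C.vec x (0, u)) (C.vec x (1, 0)) = b at *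
  generalize g.bilin x (C.vec x (0, u)) (C.vec x (0, u)) = c at *
  field_simp
  linear_combination h2

theorem lift_mem (hm : 0 < m) {x : M} (hx : x ∈ C.V) (u : EuclideanSpace ℝ (Fin d)) :
    C.lift m x u ∈ futureHyperboloid g τ m x := by
  refine ⟨C.bilin_lift hm hx u, ?_⟩
  change g.bilin x (τ.vec x) (C.lift m x u) < 0
  have hp : g.bilin x (C.lift m x u) (C.lift m x u) < 0 := by
    rw [C.bilin_lift hm hx]
    exact neg_lt_zero.2 (by positivity)
  by_contra! h
  have hτ : g.bilin x (τ.vec x) (τ.vec x) < 0 := τ.timelike x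
  have h' := lt_of_le_of_ne h (LorentzMetric.bilin_ne_zero_of_timelike hτ hp).symm
  have h1 := LorentzMetric.bilin_add_smul_neg hτ (v := -C.lift m x u) (w := C.vec x (1, 0))
    (by simpa using hp) (C.timelike_vec hx) (by simpa using h') (C.future_vec hx)
    (C.energy_pos hm hx u).le
  have h2 : -C.lift m x u + C.energy m x u • C.vec x (1, 0) = -C.vec x (0, u) := by
    rw [lift, C.vec_mk]
    abel
  rw [h2] at h1
  have h3 := C.bilin_spatial_nonneg hx u
  simp only [map_neg, neg_apply, neg_neg] at h1
  linarith

theorem coord_lift {x : M} (hx : x ∈ C.V) (u : EuclideanSpace ℝ (Fin d)) :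
    (C.coord x (C.lift m x u)).2 = u := by
  rw [lift, C.coord_vec hx]

theorem lift_coord (hm : 0 < m) {x : M} (hx : x ∈ C.V) {p : EuclideanSpace ℝ (Fin (d + 1))}
    (hp : p ∈ futureHyperboloid g τ m x) : C.lift m x (C.coord x p).2 = p := by
  obtain ⟨hp1, hp2⟩ := hp
  change g.bilin x p p = -m ^ 2 at hp1
  change g.bilin x (τ.vec x) p < 0 at hp2
  have hτ : g.bilin x (τ.vec x) (τ.vec x) < 0 := τ.timelike x
  have hm2 : 0 < m ^ 2 := by positivity
  have hp3 : g.bilin x p p < 0 := by linarith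
  obtain ⟨t, u, hu⟩ : ∃ t u, C.coord x p = (t, u) := ⟨_, _, rfl⟩
  have hv : p = C.vec x (t, u) := by rw [← hu, C.vec_coord hx]
  have ht : 0 < t := by
    by_contra! ht
    have h1 := LorentzMetric.bilin_add_smul_neg hτ hp3 (C.timelike_vec hx) hp2 (C.future_vec hx)
      (neg_nonneg.2 ht)
    have h2 : p + (-t) • C.vec x (1, 0) = C.vec x (0, u) := by
      rw [hv, C.vec_mk x t, neg_smul]
      abel
    rw [h2] at h1
    exact absurd h1 (C.bilin_spatial_nonneg hx u).not_gt
  have h1 := C.bilin_vec_mk x t u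
  rw [← hv, hp1] at h1
  have h2 := C.bilin_vec_mk x (C.energy m x u) u
  rw [← lift, C.bilin_lift hm hx] at h2
  have hy := C.energy_pos hm hx u
  have ha := C.timelike_vec hx
  have hc := C.bilin_spatial_nonneg hx u
  rw [hu, hv]
  refine congrArg (fun s => C.vec x (s, u)) ?_
  generalize C.energy m x u = y at *
  generalize g.bilin x (C.vec x (1, 0)) (C.vec x (1, 0)) = a at *
  generalize g.bilin x (C.vec x (0, u)) (C.vec x (1, 0)) = b at *
  generalize g.bilin x (C.vec x (0, u)) (C.vec x (0, u)) = c at *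
  by_contra hne
  have h3 : (y - t) * (a * (y + t) + 2 * b) = 0 := by linear_combination h1 - h2
  have h4 := (mul_eq_zero.1 h3).resolve_left (sub_ne_zero.2 hne)
  have h5 : a * (t * y) = c + m ^ 2 := by linear_combination t * h4 + h1
  nlinarith [mul_pos ht hy]

end SplittingFrame

end ShellChart

section ShellChart

variable {d : ℕ} {M : Type*} [TopologicalSpace M]
  [ChartedSpace (EuclideanSpace ℝ (Fin (d + 1))) M] [IsManifold (𝓡 (d + 1)) ∞ M]

namespace SplittingFrame

variable {g : LorentzMetric d M} {τ : TimeOrientation g} (C : SplittingFrame g τ) {m : ℝ}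

section Smooth

variable {E' : Type*} [NormedAddCommGroup E'] [NormedSpace ℝ E']
  {H' : Type*} [TopologicalSpace H'] {J : ModelWithCorners ℝ E' H'}
  {Y : Type*} [TopologicalSpace Y] [ChartedSpace H' Y] {b : Y → M} {s : Set Y}

theorem contMDiffOn_vec {w : Y → ℝ × EuclideanSpace ℝ (Fin d)}
    (hb : ContMDiffOn J (𝓡 (d + 1)) ∞ b s) (hs : ∀ y ∈ s, b y ∈ C.V)
    (hw : ContMDiffOn J 𝓘(ℝ, ℝ × EuclideanSpace ℝ (Fin d)) ∞ w s) :
    ContMDiffOn J (𝓡 (d + 1)).tangent ∞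
      (fun y => (⟨b y, C.vec (b y) (w y)⟩ : TangentBundle (𝓡 (d + 1)) M)) s :=
  contMDiffOn_mk_chartVec hb (C.comp.contDiff.contMDiff.comp_contMDiffOn hw)
    fun y hy => C.subset_source (hs y hy)

theorem continuousOn_vec {Y : Type*} [TopologicalSpace Y] {b : Y → M} {s : Set Y}
    {w : Y → ℝ × EuclideanSpace ℝ (Fin d)} (hb : ContinuousOn b s) (hs : ∀ y ∈ s, b y ∈ C.V)
    (hw : ContinuousOn w s) :
    ContinuousOn (fun y => (⟨b y, C.vec (b y) (w y)⟩ : TangentBundle (𝓡 (d + 1)) M)) s :=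
  continuousOn_mk_chartVec hb (C.comp.continuous.comp_continuousOn hw)
    fun y hy => C.subset_source (hs y hy)

theorem contMDiffOn_energy (hm : 0 < m) {c : Y → EuclideanSpace ℝ (Fin d)}
    (hb : ContMDiffOn J (𝓡 (d + 1)) ∞ b s) (hs : ∀ y ∈ s, b y ∈ C.V)
    (hc : ContMDiffOn J 𝓘(ℝ, EuclideanSpace ℝ (Fin d)) ∞ c s) :
    ContMDiffOn J 𝓘(ℝ, ℝ) ∞ (fun y => C.energy m (b y) (c y)) s := by
  have h1 := C.contMDiffOn_vec hb hs (w := fun _ => (1, 0)) contMDiffOn_const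
  have h2 := C.contMDiffOn_vec hb hs (w := fun y => (0, c y))
    ((contDiff_prodMk_right (0 : ℝ)).contMDiff.comp_contMDiffOn hc)
  have hA := g.contMDiffOn_apply (v := fun y => C.vec (b y) (1, 0))
    (w := fun y => C.vec (b y) (1, 0)) h1 h1
  have hB := g.contMDiffOn_apply (v := fun y => C.vec (b y) (0, c y))
    (w := fun y => C.vec (b y) (1, 0)) h2 h1
  have hC := g.contMDiffOn_apply (v := fun y => C.vec (b y) (0, c y))
    (w := fun y => C.vec (b y) (0, c y)) h2 h2
  intro y hy
  have hF : ContDiffAt ℝ ∞ (fun w : ℝ × ℝ × ℝ =>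
      (-w.2.1 - Real.sqrt (w.2.1 ^ 2 - w.1 * (w.2.2 + m ^ 2))) / w.1)
      (g.bilin (b y) (C.vec (b y) (1, 0)) (C.vec (b y) (1, 0)),
        g.bilin (b y) (C.vec (b y) (0, c y)) (C.vec (b y) (1, 0)),
        g.bilin (b y) (C.vec (b y) (0, c y)) (C.vec (b y) (0, c y))) := by
    refine ContDiffAt.div (ContDiffAt.sub (by fun_prop) (ContDiffAt.sqrt (by fun_prop) ?_))
      (by fun_prop) (C.timelike_vec (hs y hy)).ne
    exact ((sq_nonneg _).trans_lt (C.discriminant_pos hm (hs y hy) (c y))).ne'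
  exact hF.contMDiffAt.comp_contMDiffWithinAt y
    ((hA y hy).prodMk_space ((hB y hy).prodMk_space (hC y hy)))

theorem contMDiffOn_lift (hm : 0 < m) {c : Y → EuclideanSpace ℝ (Fin d)}
    (hb : ContMDiffOn J (𝓡 (d + 1)) ∞ b s) (hs : ∀ y ∈ s, b y ∈ C.V)
    (hc : ContMDiffOn J 𝓘(ℝ, EuclideanSpace ℝ (Fin d)) ∞ c s) :
    ContMDiffOn J (𝓡 (d + 1)).tangent ∞
      (fun y => (⟨b y, C.lift m (b y) (c y)⟩ : TangentBundle (𝓡 (d + 1)) M)) s :=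
  C.contMDiffOn_vec hb hs ((C.contMDiffOn_energy hm hb hs hc).prodMk_space hc)

end Smooth

theorem contDiff_energy (hm : 0 < m) {x : M} (hx : x ∈ C.V) : ContDiff ℝ ∞ (C.energy m x) :=
  (contMDiffOn_univ.1 (C.contMDiffOn_energy hm (b := fun _ => x) (c := id) contMDiffOn_const
    (fun _ _ => hx) contMDiff_id.contMDiffOn)).contDiff

theorem contDiff_lift (hm : 0 < m) {x : M} (hx : x ∈ C.V) : ContDiff ℝ ∞ (C.lift m x) :=
  (C.vec x).contDiff.comp ((C.contDiff_energy hm hx).prodMk contDiff_id)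

/-- The components of the derivative of `lift`. -/
noncomputable def liftDeriv (m : ℝ) (x : M) (u v : EuclideanSpace ℝ (Fin d)) :
    ℝ × EuclideanSpace ℝ (Fin d) :=
  (-(g.bilin x (C.lift m x u) (C.vec x (0, v)) / g.bilin x (C.lift m x u) (C.vec x (1, 0))), v)

theorem bilin_lift_vec_neg (hm : 0 < m) {x : M} (hx : x ∈ C.V) (u : EuclideanSpace ℝ (Fin d)) :
    g.bilin x (C.lift m x u) (C.vec x (1, 0)) < 0 := by
  refine LorentzMetric.bilin_neg_of_same_cone (T := τ.vec x) (τ.timelike x) ?_ (C.timelike_vec hx)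
    (C.lift_mem hm hx u).2 (C.future_vec hx)
  rw [C.bilin_lift hm hx]
  exact neg_lt_zero.2 (by positivity)

theorem fderiv_lift (hm : 0 < m) {x : M} (hx : x ∈ C.V) (u v : EuclideanSpace ℝ (Fin d)) :
    fderiv ℝ (C.lift m x) u v = C.vec x (C.liftDeriv m x u v) := by
  have hE := ((C.contDiff_energy hm hx).differentiable (by simp) u).hasFDerivAt
  have hL : HasFDerivAt (C.lift m x) ((C.vec x).comp
      ((fderiv ℝ (C.energy m x) u).prod (ContinuousLinearMap.id ℝ _))) u :=
    (C.vec x).hasFDerivAt.comp u (hE.prodMk (hasFDerivAt_id u))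
  have hq := ((g.bilin x).hasFDerivAt.comp u hL).clm_apply hL
  have hc : (fun u => (g.bilin x ∘ C.lift m x) u (C.lift m x u)) = fun _ => -m ^ 2 :=
    funext fun u => C.bilin_lift hm hx u
  rw [hc] at hq
  have h0 := congrArg (fun L : EuclideanSpace ℝ (Fin d) →L[ℝ] ℝ => L v)
    (hq.unique (hasFDerivAt_const _ u))
  have h1 : g.bilin x (C.lift m x u) (C.vec x (fderiv ℝ (C.energy m x) u v, v)) +
      g.bilin x (C.vec x (fderiv ℝ (C.energy m x) u v, v)) (C.lift m x u) = 0 := h0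
  rw [g.bilin_symm x _ (C.lift m x u), C.vec_mk, map_add, map_smul, smul_eq_mul] at h1
  have hne := (C.bilin_lift_vec_neg hm hx u).ne
  rw [hL.fderiv]
  have h2 : fderiv ℝ (C.energy m x) u v = -(g.bilin x (C.lift m x u) (C.vec x (0, v)) /
      g.bilin x (C.lift m x u) (C.vec x (1, 0))) := by
    rw [← neg_div, eq_div_iff hne]
    linarith
  exact congrArg (fun t => C.vec x (t, v)) h2

variable (o : ManifoldOrientation d M)

/-- The density of `π_x` in the coordinates given by `lift`. -/
noncomputable def density (m : ℝ) (x : M) (u : EuclideanSpace ℝ (Fin d)) : ℝ :=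
  |(fibreForm g o x (C.lift m x u) : EuclideanSpace ℝ (Fin (d + 1)) [⋀^Fin d]→ₗ[ℝ] ℝ)
    fun j => fderiv ℝ (C.lift m x) u (EuclideanSpace.single j 1)|

theorem continuousOn_density (hm : 0 < m) :
    ContinuousOn (fun y : M × EuclideanSpace ℝ (Fin d) => C.density o m y.1 y.2)
      (C.V ×ˢ univ) := by
  have hb : ContMDiffOn ((𝓡 (d + 1)).prod 𝓘(ℝ, EuclideanSpace ℝ (Fin d))) (𝓡 (d + 1)) ∞
      (Prod.fst : M × EuclideanSpace ℝ (Fin d) → M) (C.V ×ˢ univ) := contMDiffOn_fst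
  have hs : ∀ y ∈ C.V ×ˢ (univ : Set (EuclideanSpace ℝ (Fin d))), y.1 ∈ C.V := fun y hy => hy.1
  have hE : ContinuousOn (fun y : M × EuclideanSpace ℝ (Fin d) => C.energy m y.1 y.2)
      (C.V ×ˢ univ) := (C.contMDiffOn_energy hm hb hs contMDiffOn_snd).continuousOn
  have hEu := hE.prodMk (continuousOn_snd (s := C.V ×ˢ (univ : Set (EuclideanSpace ℝ (Fin d)))))
  have hl := C.continuousOn_vec hb.continuousOn hs hEu
  have hv : ∀ w : ℝ × EuclideanSpace ℝ (Fin d), ContinuousOn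
      (fun y : M × EuclideanSpace ℝ (Fin d) => (⟨y.1, C.vec y.1 w⟩ : TangentBundle (𝓡 (d + 1)) M))
      (C.V ×ˢ univ) := fun w => C.continuousOn_vec hb.continuousOn hs continuousOn_const
  let w : M × EuclideanSpace ℝ (Fin d) → Fin (d + 1) → ℝ × EuclideanSpace ℝ (Fin d) := fun y =>
    Matrix.vecCons ((-m ^ 2)⁻¹ • (C.energy m y.1 y.2, y.2))
      fun j => C.liftDeriv m y.1 y.2 (EuclideanSpace.single j 1)
  have hw : ∀ i, ContinuousOn (fun y => w y i) (C.V ×ˢ univ) := by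
    intro i
    refine Fin.cases (hEu.const_smul ((-m ^ 2)⁻¹)) (fun j => ?_) i
    refine ContinuousOn.prodMk (ContinuousOn.neg (ContinuousOn.div ?_ ?_ fun y hy =>
      (C.bilin_lift_vec_neg hm hy.1 y.2).ne)) continuousOn_const
    · exact g.continuousOn_apply (v := fun y : M × EuclideanSpace ℝ (Fin d) =>
        C.lift m y.1 y.2) (w := fun y => C.vec y.1 (0, EuclideanSpace.single j 1)) hl (hv _)
    · exact g.continuousOn_apply (v := fun y : M × EuclideanSpace ℝ (Fin d) =>
        C.lift m y.1 y.2) (w := fun y => C.vec y.1 (1, 0)) hl (hv _)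
  refine (continuousOn_abs_volForm g o (b := Prod.fst) (v := fun y i => C.vec y.1 (w y i))
    fun i => C.continuousOn_vec hb.continuousOn hs (hw i)).congr fun y hy => ?_
  refine congrArg (fun v => |(volForm g o y.1 : EuclideanSpace ℝ (Fin (d + 1))
    [⋀^Fin (d + 1)]→ₗ[ℝ] ℝ) v|) ?_
  funext i
  refine Fin.cases ?_ (fun j => ?_) i
  · change (g.bilin y.1 (C.lift m y.1 y.2) (C.lift m y.1 y.2))⁻¹ • C.lift m y.1 y.2 =
      C.vec y.1 ((-m ^ 2)⁻¹ • (C.energy m y.1 y.2, y.2))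
    rw [C.bilin_lift hm hy.1, map_smul, lift]
  · exact C.fderiv_lift hm hy.1 _ _

/-- The parametrization of the mass hyperboloid by the space components. -/
noncomputable def fibreParam (hm : 0 < m) {x : M} (hx : x ∈ C.V) :
    LocalParam (X := EuclideanSpace ℝ (Fin (d + 1))) (𝓡 (d + 1)) (futureHyperboloid g τ m x) d where
  ψ := C.lift m x
  U := univ
  χ := fun p => (C.coord x p).2
  W := univ
  isOpen_U := isOpen_univ
  isOpen_W := isOpen_univ
  smooth_ψ := (C.contDiff_lift hm hx).contMDiff.contMDiffOn
  smooth_χ := (contDiff_snd.comp (C.coord x).contDiff).contMDiff.contMDiffOn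
  image_eq := by
    ext p
    constructor
    · rintro ⟨u, -, rfl⟩
      exact ⟨C.lift_mem hm hx u, mem_univ _⟩
    · intro hp
      exact ⟨_, mem_univ _, C.lift_coord hm hx hp.1⟩
  left_inv u _ := C.coord_lift hx u

theorem abs_pullbackCoeff_fibreForm (x : M) (u : EuclideanSpace ℝ (Fin d)) :
    |pullbackCoeff (X := EuclideanSpace ℝ (Fin (d + 1))) (𝓡 (d + 1)) (C.lift m x)
      (fibreForm g o x) u| = C.density o m x u := by
  rw [density, pullbackCoeff, mfderiv_eq_fderiv]
  rfl

theorem sign_smul_pullbackCoeff_fibreDensity {G : Type*} [AddCommGroup G] [Module ℝ G]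
    (φ : EuclideanSpace ℝ (Fin (d + 1)) → G) (x : M) (u : EuclideanSpace ℝ (Fin d)) :
    Real.sign (pullbackCoeff (X := EuclideanSpace ℝ (Fin (d + 1))) (𝓡 (d + 1)) (C.lift m x)
      (fibreForm g o x) u) • pullbackCoeff (X := EuclideanSpace ℝ (Fin (d + 1))) (𝓡 (d + 1))
        (C.lift m x) (fibreDensity g o x φ) u = C.density o m x u • φ (C.lift m x u) := by
  rw [← abs_pullbackCoeff_fibreForm, ← Real.sign_mul_self_eq_abs, mul_smul]
  rfl

/-- The mass hyperboloid as a single piece. -/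
noncomputable def fibrePieces (hm : 0 < m) {x : M} (hx : x ∈ C.V) :
    ParamPieces (X := EuclideanSpace ℝ (Fin (d + 1))) (𝓡 (d + 1)) (futureHyperboloid g τ m x) d
      Unit where
  param _ := C.fibreParam hm hx
  dom _ := univ
  measurableSet_dom _ := MeasurableSet.univ
  dom_subset _ := subset_univ _
  disjoint _ _ _ _ _ _ _ := rfl

theorem covers_fibrePieces (hm : 0 < m) {x : M} (hx : x ∈ C.V) :
    (C.fibrePieces hm hx).Covers (futureHyperboloid g τ m x) := fun _ hp =>
  ⟨(), _, mem_univ _, C.lift_coord hm hx hp⟩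

theorem integrand_fibrePieces {G : Type*} [NormedAddCommGroup G] [NormedSpace ℝ G] (hm : 0 < m)
    {x : M} (hx : x ∈ C.V) (φ : EuclideanSpace ℝ (Fin (d + 1)) → G)
    (y : Unit × EuclideanSpace ℝ (Fin d)) :
    (C.fibrePieces hm hx).integrand (futureHyperboloid g τ m x) (fibreForm g o x)
      (fibreDensity g o x φ) y = C.density o m x y.2 • φ (C.lift m x y.2) :=
  (if_pos ⟨mem_univ _, C.lift_mem hm hx y.2⟩).trans
    (C.sign_smul_pullbackCoeff_fibreDensity o φ x y.2)

theorem exists_fibre_isParamCover (hm : 0 < m) {x : M} (hx : x ∈ C.V) :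
    ∃ P : ℕ → LocalParam (X := EuclideanSpace ℝ (Fin (d + 1))) (𝓡 (d + 1))
      (futureHyperboloid g τ m x) d, IsParamCover (𝓡 (d + 1)) P :=
  ⟨fun _ => C.fibreParam hm hx, fun _ _ => mem_iUnion.2 ⟨0, mem_univ _⟩⟩

theorem fibreIntegrable_iff {G : Type*} [NormedAddCommGroup G] [NormedSpace ℝ G] (hm : 0 < m)
    {x : M} (hx : x ∈ C.V) (φ : EuclideanSpace ℝ (Fin (d + 1)) → G) :
    FibreIntegrable g τ o m x φ ↔
      Integrable fun u => C.density o m x u • φ (C.lift m x u) := by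
  refine (formIntegrable_iff _ (C.exists_fibre_isParamCover hm hx) subset_rfl
    (C.covers_fibrePieces hm hx) _ _).trans ?_
  have h := integrableOn_singleton_prod_iff (vol := (volume : Measure (EuclideanSpace ℝ (Fin d))))
    () univ (fun y : Unit × EuclideanSpace ℝ (Fin d) =>
      C.density o m x y.2 • φ (C.lift m x y.2))
  have hu : ({()} ×ˢ univ : Set (Unit × EuclideanSpace ℝ (Fin d))) = univ := by
    ext
    simp
  rw [hu, integrableOn_univ, integrableOn_univ] at h
  rw [← h]
  exact iff_of_eq (congrArg (fun F => Integrable F _)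
    (funext (C.integrand_fibrePieces o hm hx φ)))

theorem fibreIntegral_eq {G : Type*} [NormedAddCommGroup G] [NormedSpace ℝ G] (hm : 0 < m)
    {x : M} (hx : x ∈ C.V) (φ : EuclideanSpace ℝ (Fin (d + 1)) → G) :
    fibreIntegral g τ o m x φ = ∫ u, C.density o m x u • φ (C.lift m x u) := by
  refine (formIntegral_eq _ (C.exists_fibre_isParamCover hm hx) subset_rfl
    (C.covers_fibrePieces hm hx) _ _).trans ?_
  have h := setIntegral_singleton_prod (vol := (volume : Measure (EuclideanSpace ℝ (Fin d))))
    () univ (fun y : Unit × EuclideanSpace ℝ (Fin d) =>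
      C.density o m x y.2 • φ (C.lift m x y.2))
  have hu : ({()} ×ˢ univ : Set (Unit × EuclideanSpace ℝ (Fin d))) = univ := by
    ext
    simp
  rw [hu, setIntegral_univ, setIntegral_univ] at h
  rw [← h]
  exact congrArg (fun F => ∫ y, F y ∂(Measure.count.prod volume))
    (funext (C.integrand_fibrePieces o hm hx φ))

end SplittingFrame

end ShellChart

section Split

variable {k d K : ℕ} (e : Fin k ⊕ Fin d ≃ Fin K)

/-- Splitting the coordinates of `ℝᴷ` into two groups. -/
noncomputable def splitCoords :
    EuclideanSpace ℝ (Fin K) ≃L[ℝ] EuclideanSpace ℝ (Fin k) × EuclideanSpace ℝ (Fin d) :=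
  ((WithLp.linearEquiv 2 ℝ (Fin K → ℝ)).trans ((LinearEquiv.funCongrLeft ℝ ℝ e).trans
    ((LinearEquiv.sumArrowLequivProdArrow (Fin k) (Fin d) ℝ ℝ).trans
      ((WithLp.linearEquiv 2 ℝ (Fin k → ℝ)).symm.prodCongr
        (WithLp.linearEquiv 2 ℝ (Fin d → ℝ)).symm)))).toContinuousLinearEquiv

theorem splitCoords_fst_apply (s : EuclideanSpace ℝ (Fin K)) (i : Fin k) :
    (splitCoords e s).1 i = s (e (Sum.inl i)) := rfl

theorem splitCoords_snd_apply (s : EuclideanSpace ℝ (Fin K)) (j : Fin d) :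
    (splitCoords e s).2 j = s (e (Sum.inr j)) := rfl

theorem splitCoords_single_inl (i : Fin k) :
    splitCoords e (EuclideanSpace.single (e (Sum.inl i)) 1) = (EuclideanSpace.single i 1, 0) := by
  refine Prod.ext ?_ ?_
  · ext i'
    simp [splitCoords_fst_apply]
  · ext j
    simp [splitCoords_snd_apply]

theorem splitCoords_single_inr (j : Fin d) :
    splitCoords e (EuclideanSpace.single (e (Sum.inr j)) 1) = (0, EuclideanSpace.single j 1) := by
  refine Prod.ext ?_ ?_
  · ext i
    simp [splitCoords_fst_apply]
  · ext j'
    simp [splitCoords_snd_apply]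

theorem measurePreserving_splitCoords : MeasurePreserving (splitCoords e) volume volume := by
  have h1 := PiLp.volume_preserving_ofLp (Fin K)
  have h2 := volume_measurePreserving_piCongrLeft (fun _ => ℝ) e
  have h3 := volume_measurePreserving_sumPiEquivProdPi (fun _ : Fin k ⊕ Fin d => ℝ)
  have h4 := (PiLp.volume_preserving_toLp (Fin k)).prod (PiLp.volume_preserving_toLp (Fin d))
  exact h4.comp (h3.comp ((h2.symm _).comp h1))

end Split

section ShellParam

variable {d k K : ℕ} {M : Type*} [TopologicalSpace M]
  [ChartedSpace (EuclideanSpace ℝ (Fin (d + 1))) M] [IsManifold (𝓡 (d + 1)) ∞ M]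

namespace SplittingFrame

variable {g : LorentzMetric d M} {τ : TimeOrientation g} (C : SplittingFrame g τ) {m : ℝ}
  {N : Set M} (P : LocalParam (𝓡 (d + 1)) N k) (e : Fin k ⊕ Fin d ≃ Fin K)

/-- The parametrization of the mass shell over the image of `P` by the parameters of `P` and the
space components. -/
noncomputable def shellMap (m : ℝ) (s : EuclideanSpace ℝ (Fin K)) : TangentBundle (𝓡 (d + 1)) M :=
  ⟨P.ψ (splitCoords e s).1, C.lift m (P.ψ (splitCoords e s).1) (splitCoords e s).2⟩

theorem contMDiffOn_coord :
    ContMDiffOn (𝓡 (d + 1)).tangent 𝓘(ℝ, ℝ × EuclideanSpace ℝ (Fin d)) ∞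
      (fun z : TangentBundle (𝓡 (d + 1)) M => C.coord z.1 z.2) (Bundle.TotalSpace.proj ⁻¹' C.V) := by
  set t := trivializationAt (EuclideanSpace ℝ (Fin (d + 1)))
    (TangentSpace (𝓡 (d + 1)) : M → Type _) C.center
  have hs : Bundle.TotalSpace.proj ⁻¹' C.V ⊆ t.source := fun z hz =>
    t.mem_source.2 (C.subset_source hz)
  have h : ContMDiffOn (𝓡 (d + 1)).tangent 𝓘(ℝ, EuclideanSpace ℝ (Fin (d + 1))) ∞
      (fun z : TangentBundle (𝓡 (d + 1)) M => (t z).2) (Bundle.TotalSpace.proj ⁻¹' C.V) :=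
    contMDiff_snd.comp_contMDiffOn
      ((Bundle.Trivialization.contMDiffOn (IB := 𝓡 (d + 1)) (n := ∞) t).mono hs)
  refine (C.comp.symm.contDiff.contMDiff.comp_contMDiffOn h).congr fun z hz => ?_
  refine congrArg C.comp.symm ?_
  exact congrFun (t.coe_linearMapAt_of_mem (R := ℝ) (C.subset_source hz)) z.2

/-- The local parametrization of the mass shell over `N` associated with one of `N`. -/
noncomputable def shellParam (hm : 0 < m) (hP : P.W ⊆ C.V) :
    LocalParam (𝓡 (d + 1)).tangent (shellOver g τ m N) K where
  ψ := C.shellMap P e m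
  U := {s | (splitCoords e s).1 ∈ P.U}
  χ z := (splitCoords e).symm (P.χ z.1, (C.coord z.1 z.2).2)
  W := Bundle.TotalSpace.proj ⁻¹' P.W
  isOpen_U := P.isOpen_U.preimage (continuous_fst.comp (splitCoords e).continuous)
  isOpen_W := P.isOpen_W.preimage (FiberBundle.continuous_proj _ _)
  smooth_ψ := C.contMDiffOn_lift hm
    (P.smooth_ψ.comp (contDiff_fst.comp (splitCoords e).contDiff).contMDiff.contMDiffOn
      fun s hs => hs)
    (fun s hs => hP (P.mem_of_mem hs).2)
    (contDiff_snd.comp (splitCoords e).contDiff).contMDiff.contMDiffOn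
  smooth_χ := (splitCoords e).symm.contDiff.contMDiff.comp_contMDiffOn
    ((P.smooth_χ.comp (Bundle.contMDiff_proj _).contMDiffOn fun z hz => hz).prodMk_space
      (contDiff_snd.contMDiff.comp_contMDiffOn (C.contMDiffOn_coord.mono fun z hz => hP hz)))
  image_eq := by
    ext z
    constructor
    · rintro ⟨s, hs, rfl⟩
      have h := P.mem_of_mem hs
      exact ⟨⟨h.1, C.lift_mem hm (hP h.2) _⟩, h.2⟩
    · rintro ⟨⟨hN, hz⟩, hW⟩
      obtain ⟨h1, h2⟩ := P.right_inv hN hW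
      refine ⟨(splitCoords e).symm (P.χ z.1, (C.coord z.1 z.2).2), ?_, ?_⟩
      · rw [mem_ofPred_eq, ContinuousLinearEquiv.apply_symm_apply]
        exact h1
      · rw [shellMap, ContinuousLinearEquiv.apply_symm_apply, h2, C.lift_coord hm (hP hW) hz]
  left_inv s hs := by
    have h := P.mem_of_mem hs
    rw [shellMap, C.coord_lift (hP h.2), P.left_inv _ hs, Prod.mk.eta,
      ContinuousLinearEquiv.symm_apply_apply]

variable {C P}

theorem fst_mfderiv_shellMap (hm : 0 < m) (hP : P.W ⊆ C.V) {s : EuclideanSpace ℝ (Fin K)}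
    (hs : (splitCoords e s).1 ∈ P.U) (v : EuclideanSpace ℝ (Fin K)) :
    ((mfderiv (𝓡 K) (𝓡 (d + 1)).tangent (C.shellMap P e m) s : EuclideanSpace ℝ (Fin K) →L[ℝ]
      EuclideanSpace ℝ (Fin (d + 1)) × EuclideanSpace ℝ (Fin (d + 1))) v).1 =
      (mfderiv (𝓡 k) (𝓡 (d + 1)) P.ψ (splitCoords e s).1 : EuclideanSpace ℝ (Fin k) →L[ℝ]
        EuclideanSpace ℝ (Fin (d + 1))) (splitCoords e v).1 := by
  let π : EuclideanSpace ℝ (Fin K) →L[ℝ] EuclideanSpace ℝ (Fin k) :=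
    (ContinuousLinearMap.fst ℝ _ _).comp (splitCoords e).toContinuousLinearMap
  have h1 := mfderiv_comp (I := 𝓡 K) (I' := 𝓡 k) (f := π) s (P.mdifferentiableAt_ψ hs)
    π.differentiableAt.mdifferentiableAt
  have h2 := mfderiv_comp s ((Bundle.contMDiff_proj (n := ∞)
      (TangentSpace (𝓡 (d + 1)) : M → Type _) (C.shellMap P e m s)).mdifferentiableAt (by simp))
    ((C.shellParam P e hm hP).mdifferentiableAt_ψ hs)
  have h3 := h2.symm.trans h1
  have h4 : mfderiv (𝓡 K) (𝓡 k) π s = π := by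
    rw [mfderiv_eq_fderiv]
    exact π.fderiv
  rw [h4] at h3
  have h5 := congrArg (fun L : EuclideanSpace ℝ (Fin K) →L[ℝ] EuclideanSpace ℝ (Fin (d + 1)) => L v)
    h3
  refine Eq.trans ?_ h5
  exact (congrArg (fun L : EuclideanSpace ℝ (Fin (d + 1)) × EuclideanSpace ℝ (Fin (d + 1)) →L[ℝ]
    EuclideanSpace ℝ (Fin (d + 1)) => L ((mfderiv (𝓡 K) (𝓡 (d + 1)).tangent (C.shellMap P e m) s :
      EuclideanSpace ℝ (Fin K) →L[ℝ] EuclideanSpace ℝ (Fin (d + 1)) ×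
        EuclideanSpace ℝ (Fin (d + 1))) v)) (projDeriv_eq_fst (C.shellMap P e m s))).symm

theorem mfderiv_shellMap_vertical (hm : 0 < m) (hP : P.W ⊆ C.V) {s : EuclideanSpace ℝ (Fin K)}
    (hs : (splitCoords e s).1 ∈ P.U) (w : EuclideanSpace ℝ (Fin d)) :
    (mfderiv (𝓡 K) (𝓡 (d + 1)).tangent (C.shellMap P e m) s : EuclideanSpace ℝ (Fin K) →L[ℝ]
      EuclideanSpace ℝ (Fin (d + 1)) × EuclideanSpace ℝ (Fin (d + 1)))
        ((splitCoords e).symm (0, w)) =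
      (0, fderiv ℝ (C.lift m (P.ψ (splitCoords e s).1)) (splitCoords e s).2 w) := by
  set x := P.ψ (splitCoords e s).1 with hx
  have hxV : x ∈ C.V := hP (P.mem_of_mem hs).2
  let c : EuclideanSpace ℝ (Fin d) → EuclideanSpace ℝ (Fin K) := fun u =>
    (splitCoords e).symm ((splitCoords e s).1, u)
  have hc : HasFDerivAt c ((splitCoords e).symm.toContinuousLinearMap.comp
      (ContinuousLinearMap.inr ℝ _ _)) (splitCoords e s).2 :=
    (splitCoords e).symm.hasFDerivAt.comp _ (hasFDerivAt_prodMk_right _ _)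
  have hcs : c (splitCoords e s).2 = s := by
    change (splitCoords e).symm (splitCoords e s) = s
    rw [ContinuousLinearEquiv.symm_apply_apply]
  have h1 := mfderiv_comp_of_eq (I := 𝓡 d) (I' := 𝓡 K) (f := c) (x := (splitCoords e s).2)
    ((C.shellParam P e hm hP).mdifferentiableAt_ψ hs)
    hc.differentiableAt.mdifferentiableAt hcs
  let mk : EuclideanSpace ℝ (Fin (d + 1)) → TangentBundle (𝓡 (d + 1)) M := fun p => ⟨x, p⟩
  have h2 := mfderiv_comp (I := 𝓡 d) (I' := 𝓡 (d + 1)) (f := C.lift m x) (g := mk)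
    (splitCoords e s).2 ((contMDiff_fiberMk x _).mdifferentiableAt (by simp))
    (((C.contDiff_lift hm hxV).differentiable (by simp) _).mdifferentiableAt)
  have h3 : C.shellMap P e m ∘ c = mk ∘ C.lift m x := by
    funext u
    change C.shellMap P e m ((splitCoords e).symm ((splitCoords e s).1, u)) = _
    rw [shellMap, ContinuousLinearEquiv.apply_symm_apply]
    rfl
  have h4 : mfderiv (𝓡 d) (𝓡 (d + 1)).tangent (C.shellMap P e m ∘ c) (splitCoords e s).2 =
      mfderiv (𝓡 d) (𝓡 (d + 1)).tangent (mk ∘ C.lift m x) (splitCoords e s).2 := by rw [h3]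
  have h5 := h1.symm.trans (h4.trans h2)
  have h6 := congrArg (fun L : EuclideanSpace ℝ (Fin d) →L[ℝ] EuclideanSpace ℝ (Fin (d + 1)) ×
    EuclideanSpace ℝ (Fin (d + 1)) => L w) h5
  have h7 := congrArg (fun L : EuclideanSpace ℝ (Fin d) →L[ℝ] EuclideanSpace ℝ (Fin K) => L w)
    (mfderiv_eq_fderiv.trans hc.fderiv)
  have h8 := congrArg (mfderiv (𝓡 K) (𝓡 (d + 1)).tangent (C.shellMap P e m) s :
    EuclideanSpace ℝ (Fin K) →L[ℝ] EuclideanSpace ℝ (Fin (d + 1)) ×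
      EuclideanSpace ℝ (Fin (d + 1))) h7
  have h9 : ∀ s', s' = s → (mfderiv (𝓡 K) (𝓡 (d + 1)).tangent (C.shellMap P e m) s' :
      EuclideanSpace ℝ (Fin K) →L[ℝ] EuclideanSpace ℝ (Fin (d + 1)) ×
        EuclideanSpace ℝ (Fin (d + 1))) =
      mfderiv (𝓡 K) (𝓡 (d + 1)).tangent (C.shellMap P e m) s := by
    rintro _ rfl
    rfl
  refine h8.symm.trans (Eq.trans ?_ (h6.trans ?_))
  · exact congrArg (fun L : EuclideanSpace ℝ (Fin K) →L[ℝ] EuclideanSpace ℝ (Fin (d + 1)) ×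
      EuclideanSpace ℝ (Fin (d + 1)) => L (mfderiv (𝓡 d) (𝓡 K) c (splitCoords e s).2 w))
      (h9 _ hcs).symm
  refine (congrArg (fun L : EuclideanSpace ℝ (Fin (d + 1)) →L[ℝ] EuclideanSpace ℝ (Fin (d + 1)) ×
    EuclideanSpace ℝ (Fin (d + 1)) => L (mfderiv (𝓡 d) (𝓡 (d + 1)) (C.lift m x)
      (splitCoords e s).2 w)) (mfderiv_fiberMk x _)).trans ?_
  rw [mfderiv_eq_fderiv]
  rfl

end SplittingFrame

end ShellParam

section Fubini

variable {k d K : ℕ} (e : Fin k ⊕ Fin d ≃ Fin K) {ι : Type*} [MeasurableSpace ι]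
  [Countable ι]

/-- Splitting the coordinates on countably many copies of `ℝᴷ`. -/
noncomputable def splitCopies : ι × EuclideanSpace ℝ (Fin K) ≃ᵐ
    (ι × EuclideanSpace ℝ (Fin k)) × EuclideanSpace ℝ (Fin d) :=
  ((MeasurableEquiv.refl ι).prodCongr (splitCoords e).toHomeomorph.toMeasurableEquiv).trans
    MeasurableEquiv.prodAssoc.symm

theorem measurePreserving_splitCopies :
    MeasurePreserving (splitCopies e (ι := ι)) (Measure.count.prod volume)
      ((Measure.count.prod volume).prod volume) :=
  MeasurePreserving.comp (g := MeasurableEquiv.prodAssoc.symm) (f := Prod.map id (splitCoords e))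
    (MeasurePreserving.symm MeasurableEquiv.prodAssoc (measurePreserving_prodAssoc _ _ _))
    ((MeasurePreserving.id _).prod (measurePreserving_splitCoords e))

end Fubini

section Coefficients

variable {E' : Type*} [NormedAddCommGroup E'] [NormedSpace ℝ E']
  {H' : Type*} [TopologicalSpace H'] (I' : ModelWithCorners ℝ E' H')
  {X : Type*} [TopologicalSpace X] [ChartedSpace H' X]

theorem sign_smul_pullbackCoeff_smul {k : ℕ} (ψ : EuclideanSpace ℝ (Fin k) → X)
    (β : DForm I' X k ℝ) (f : X → ℝ) (u : EuclideanSpace ℝ (Fin k)) :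
    Real.sign (pullbackCoeff I' ψ β u) • pullbackCoeff I' ψ (fun x => f x • β x) u =
      |pullbackCoeff I' ψ β u| * f (ψ u) := by
  have h : pullbackCoeff I' ψ (fun x => f x • β x) u = f (ψ u) * pullbackCoeff I' ψ β u := rfl
  rw [h, ← Real.sign_mul_self_eq_abs, smul_eq_mul]
  ring

end Coefficients

section Splitting

variable {d k K : ℕ} {M : Type*} [TopologicalSpace M]
  [ChartedSpace (EuclideanSpace ℝ (Fin (d + 1))) M] [IsManifold (𝓡 (d + 1)) ∞ M]
  {g : LorentzMetric d M} {τ : TimeOrientation g} (o : ManifoldOrientation d M) {m : ℝ}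
  (q : ℝ) (F : DForm (𝓡 (d + 1)) M 2 ℝ)

namespace SplittingFrame

variable {C : SplittingFrame g τ} {N : Set M}

theorem abs_pullbackCoeff_shellForm {P : LocalParam (𝓡 (d + 1)) N (d + 1)}
    (e : Fin (d + 1) ⊕ Fin d ≃ Fin (2 * d + 1)) (hm : 0 < m) (hP : P.W ⊆ C.V)
    {s : EuclideanSpace ℝ (Fin (2 * d + 1))} (hs : (splitCoords e s).1 ∈ P.U) :
    |pullbackCoeff (𝓡 (d + 1)).tangent (C.shellMap P e m) (shellForm g q F) s| =
      |pullbackCoeff (𝓡 (d + 1)) P.ψ (volForm g o) (splitCoords e s).1| *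
        C.density o m (P.ψ (splitCoords e s).1) (splitCoords e s).2 := by
  let T : EuclideanSpace ℝ (Fin (2 * d + 1)) →L[ℝ]
    EuclideanSpace ℝ (Fin (d + 1)) × EuclideanSpace ℝ (Fin (d + 1)) :=
    mfderiv (𝓡 (2 * d + 1)) (𝓡 (d + 1)).tangent (C.shellMap P e m) s
  have hv : ∀ j, T (EuclideanSpace.single (e (Sum.inr j)) 1) = (0, fderiv ℝ
      (C.lift m (P.ψ (splitCoords e s).1)) (splitCoords e s).2 (EuclideanSpace.single j 1)) := by
    intro j
    rw [← mfderiv_shellMap_vertical e hm hP hs, ← splitCoords_single_inr,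
      ContinuousLinearEquiv.symm_apply_apply]
    rfl
  have hh : ∀ i, (T (EuclideanSpace.single (e (Sum.inl i)) 1)).1 =
      (mfderiv (𝓡 (d + 1)) (𝓡 (d + 1)) P.ψ (splitCoords e s).1 : EuclideanSpace ℝ (Fin (d + 1)) →L[ℝ]
        EuclideanSpace ℝ (Fin (d + 1))) (EuclideanSpace.single i 1) := by
    intro i
    have h := fst_mfderiv_shellMap e hm hP hs (EuclideanSpace.single (e (Sum.inl i)) 1)
    rw [splitCoords_single_inl] at h
    exact h
  have h := abs_shellForm g o q F (P.ψ (splitCoords e s).1)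
    (C.lift m (P.ψ (splitCoords e s).1) (splitCoords e s).2)
    (fun j => T (EuclideanSpace.single j 1)) e (fun j => by rw [hv])
  simp only [hh, hv] at h
  exact h

theorem abs_pullbackCoeff_fluxForm {P : LocalParam (𝓡 (d + 1)) N d}
    (e : Fin d ⊕ Fin d ≃ Fin (2 * d)) (hm : 0 < m) (hP : P.W ⊆ C.V)
    {s : EuclideanSpace ℝ (Fin (2 * d))} (hs : (splitCoords e s).1 ∈ P.U) :
    |pullbackCoeff (𝓡 (d + 1)).tangent (C.shellMap P e m) (fluxForm g q F) s| =
      |(volForm g o (P.ψ (splitCoords e s).1) : EuclideanSpace ℝ (Fin (d + 1))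
        [⋀^Fin (d + 1)]→ₗ[ℝ] ℝ) (Matrix.vecCons
          (C.lift m (P.ψ (splitCoords e s).1) (splitCoords e s).2)
          fun i => (mfderiv (𝓡 d) (𝓡 (d + 1)) P.ψ (splitCoords e s).1 : EuclideanSpace ℝ (Fin d)
            →L[ℝ] EuclideanSpace ℝ (Fin (d + 1))) (EuclideanSpace.single i 1))| *
        C.density o m (P.ψ (splitCoords e s).1) (splitCoords e s).2 := by
  let T : EuclideanSpace ℝ (Fin (2 * d)) →L[ℝ]
    EuclideanSpace ℝ (Fin (d + 1)) × EuclideanSpace ℝ (Fin (d + 1)) :=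
    mfderiv (𝓡 (2 * d)) (𝓡 (d + 1)).tangent (C.shellMap P e m) s
  have hv : ∀ j, T (EuclideanSpace.single (e (Sum.inr j)) 1) = (0, fderiv ℝ
      (C.lift m (P.ψ (splitCoords e s).1)) (splitCoords e s).2 (EuclideanSpace.single j 1)) := by
    intro j
    rw [← mfderiv_shellMap_vertical e hm hP hs, ← splitCoords_single_inr,
      ContinuousLinearEquiv.symm_apply_apply]
    rfl
  have hh : ∀ i, (T (EuclideanSpace.single (e (Sum.inl i)) 1)).1 =
      (mfderiv (𝓡 d) (𝓡 (d + 1)) P.ψ (splitCoords e s).1 : EuclideanSpace ℝ (Fin d) →L[ℝ]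
        EuclideanSpace ℝ (Fin (d + 1))) (EuclideanSpace.single i 1) := by
    intro i
    have h := fst_mfderiv_shellMap e hm hP hs (EuclideanSpace.single (e (Sum.inl i)) 1)
    rw [splitCoords_single_inl] at h
    exact h
  have h := abs_fluxForm g o q F (P.ψ (splitCoords e s).1)
    (C.lift m (P.ψ (splitCoords e s).1) (splitCoords e s).2)
    (fun j => T (EuclideanSpace.single j 1)) e (fun j => by rw [hv])
  simp only [hh, hv] at h
  exact h

end SplittingFrame

variable {N : Set M}

/-- The pieces of the mass shell over the pieces of `N`. -/
noncomputable def shellPieces (D : ParamPieces (𝓡 (d + 1)) N k ℕ) {C : ℕ → SplittingFrame g τ}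
    (hC : ∀ i, (D.param i).W ⊆ (C i).V) (e : Fin k ⊕ Fin d ≃ Fin K) (hm : 0 < m) :
    ParamPieces (𝓡 (d + 1)).tangent (shellOver g τ m N) K ℕ where
  param i := (C i).shellParam (D.param i) e hm (hC i)
  dom i := {s | (splitCoords e s).1 ∈ D.dom i}
  measurableSet_dom i :=
    measurable_fst.comp (splitCoords e).continuous.measurable (D.measurableSet_dom i)
  dom_subset i _ hs := D.dom_subset i hs
  disjoint i j _ _ hs ht h := D.disjoint i j _ _ hs ht (congrArg Bundle.TotalSpace.proj h)

theorem covers_shellPieces {D : ParamPieces (𝓡 (d + 1)) N k ℕ} {C : ℕ → SplittingFrame g τ}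
    (hC : ∀ i, (D.param i).W ⊆ (C i).V) (e : Fin k ⊕ Fin d ≃ Fin K) (hm : 0 < m) {A : Set M}
    (hD : D.Covers A) : (shellPieces D hC e hm).Covers (shellOver g τ m A) := by
  rintro z ⟨hA, hz⟩
  obtain ⟨i, u, hu, h⟩ := hD _ hA
  have hV : z.1 ∈ (C i).V := h ▸ hC i ((D.param i).mem_of_mem (D.dom_subset i hu)).2
  refine ⟨i, (splitCoords e).symm (u, ((C i).coord z.1 z.2).2), ?_, ?_⟩
  · change (splitCoords e ((splitCoords e).symm (u, ((C i).coord z.1 z.2).2))).1 ∈ D.dom i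
    rw [ContinuousLinearEquiv.apply_symm_apply]
    exact hu
  · change (C i).shellMap (D.param i) e m ((splitCoords e).symm (u, ((C i).coord z.1 z.2).2)) = z
    rw [SplittingFrame.shellMap, ContinuousLinearEquiv.apply_symm_apply, h,
      (C i).lift_coord hm hV hz]

theorem ParamPieces.exists_isParamCover {E' : Type*} [NormedAddCommGroup E'] [NormedSpace ℝ E']
    {H' : Type*} [TopologicalSpace H'] {I' : ModelWithCorners ℝ E' H'}
    {X : Type*} [TopologicalSpace X] [ChartedSpace H' X] {N : Set X} {k : ℕ}
    (D : ParamPieces I' N k ℕ) (hD : D.Covers N) :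
    ∃ P : ℕ → LocalParam I' N k, IsParamCover I' P := by
  refine ⟨D.param, fun x hx => ?_⟩
  obtain ⟨i, u, hu, rfl⟩ := hD x hx
  exact mem_iUnion.2 ⟨i, ((D.param i).mem_of_mem (D.dom_subset i hu)).2⟩

open Classical in
/-- Splitting of the integral over the mass shell. -/
theorem formIntegral_shellForm {D : ParamPieces (𝓡 (d + 1)) N (d + 1) ℕ} (hD : D.Covers N)
    {C : ℕ → SplittingFrame g τ} (hC : ∀ i, (D.param i).W ⊆ (C i).V) (hm : 0 < m) {A : Set M}
    (hA : A ⊆ N) (f : TangentBundle (𝓡 (d + 1)) M → ℝ)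
    (hf : FormIntegrable (𝓡 (d + 1)).tangent (shellOver g τ m N) (shellOver g τ m A)
      (shellForm g q F) (fun z => f z • shellForm g q F z)) :
    FormIntegrable (𝓡 (d + 1)) N A (volForm g o)
      (fun x => fibreIntegral g τ o m x (fun p => f ⟨x, p⟩) • volForm g o x) ∧
    formIntegral (𝓡 (d + 1)).tangent (shellOver g τ m N) (shellOver g τ m A)
      (shellForm g q F) (fun z => f z • shellForm g q F z) =
    formIntegral (𝓡 (d + 1)) N A (volForm g o)
      (fun x => fibreIntegral g τ o m x (fun p => f ⟨x, p⟩) • volForm g o x) := by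
  let e : Fin (d + 1) ⊕ Fin d ≃ Fin (2 * d + 1) := finSumFinEquiv.trans (finCongr (by omega))
  have hDA : D.Covers A := fun x hx => hD x (hA hx)
  have hcov := D.exists_isParamCover hD
  have hcov' := (shellPieces D hC e hm).exists_isParamCover (covers_shellPieces hC e hm hD)
  have hA' : shellOver g τ m A ⊆ shellOver g τ m N := fun z hz => ⟨hA hz.1, hz.2⟩
  have hDA' := covers_shellPieces hC e hm hDA
  rw [formIntegrable_iff _ hcov' hA' hDA'] at hf
  rw [formIntegral_eq _ hcov' hA' hDA', formIntegral_eq D hcov hA hDA,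
    formIntegrable_iff D hcov hA hDA]
  let h : (ℕ × EuclideanSpace ℝ (Fin (d + 1))) × EuclideanSpace ℝ (Fin d) → ℝ := fun y =>
    if y.1.2 ∈ D.dom y.1.1 ∧ (D.param y.1.1).ψ y.1.2 ∈ A then
      |pullbackCoeff (𝓡 (d + 1)) (D.param y.1.1).ψ (volForm g o) y.1.2| *
        ((C y.1.1).density o m ((D.param y.1.1).ψ y.1.2) y.2 • f ⟨(D.param y.1.1).ψ y.1.2,
          (C y.1.1).lift m ((D.param y.1.1).ψ y.1.2) y.2⟩)
    else 0
  have h1 : (shellPieces D hC e hm).integrand (shellOver g τ m A) (shellForm g q F)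
      (fun z => f z • shellForm g q F z) = h ∘ splitCopies e := by
    funext y
    obtain ⟨i, s⟩ := y
    by_cases hs : (splitCoords e s).1 ∈ D.dom i ∧ (D.param i).ψ (splitCoords e s).1 ∈ A
    · have hU := D.dom_subset i hs.1
      refine (if_pos ⟨hs.1, hs.2, (C i).lift_mem hm
        (hC i ((D.param i).mem_of_mem hU).2) _⟩).trans (Eq.trans ?_ (if_pos hs).symm)
      refine (sign_smul_pullbackCoeff_smul _ _ _ _ _).trans ?_
      refine (congrArg (· * _) (SplittingFrame.abs_pullbackCoeff_shellForm o q F e hm (hC i)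
        hU)).trans ?_
      exact mul_assoc _ _ _
    · exact (if_neg fun h => hs ⟨h.1, h.2.1⟩).trans (if_neg hs).symm
  have h2 : D.integrand A (volForm g o)
      (fun x => fibreIntegral g τ o m x (fun p => f ⟨x, p⟩) • volForm g o x) =
      fun y => ∫ u, h (y, u) := by
    funext y
    obtain ⟨i, s⟩ := y
    by_cases hs : s ∈ D.dom i ∧ (D.param i).ψ s ∈ A
    · refine (if_pos hs).trans ?_
      have h3 : ∀ u, h ((i, s), u) = |pullbackCoeff (𝓡 (d + 1)) (D.param i).ψ (volForm g o) s| *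
        ((C i).density o m ((D.param i).ψ s) u • f ⟨(D.param i).ψ s,
          (C i).lift m ((D.param i).ψ s) u⟩) := fun u => if_pos hs
      simp only [h3]
      rw [integral_const_mul, ← (C i).fibreIntegral_eq o hm
        (hC i ((D.param i).mem_of_mem (D.dom_subset i hs.1)).2) (fun p => f ⟨(D.param i).ψ s, p⟩)]
      exact sign_smul_pullbackCoeff_smul _ _ _ _ _
    · refine (if_neg hs).trans ?_
      have h3 : ∀ u, h ((i, s), u) = 0 := fun u => if_neg hs
      simp only [h3, integral_zero]
  rw [h1, (measurePreserving_splitCopies e).integrable_comp_emb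
    (splitCopies e).measurableEmbedding] at hf
  rw [h1, h2]
  refine ⟨hf.integral_prod_left, ?_⟩
  rw [← integral_prod _ hf]
  exact (measurePreserving_splitCopies e).integral_comp (splitCopies e).measurableEmbedding h

/-- The volume form with the coordinate vectors of a parametrized hypersurface inserted behind the
first place. -/
noncomputable def fluxFunctional (g : LorentzMetric d M) (o : ManifoldOrientation d M)
    (ψ : EuclideanSpace ℝ (Fin d) → M) (u : EuclideanSpace ℝ (Fin d)) :
    EuclideanSpace ℝ (Fin (d + 1)) →L[ℝ] ℝ :=
  LinearMap.toContinuousLinearMap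
    { toFun := fun p => (volForm g o (ψ u) : EuclideanSpace ℝ (Fin (d + 1))
        [⋀^Fin (d + 1)]→ₗ[ℝ] ℝ) (Matrix.vecCons p fun i => (mfderiv (𝓡 d) (𝓡 (d + 1)) ψ u :
          EuclideanSpace ℝ (Fin d) →L[ℝ] EuclideanSpace ℝ (Fin (d + 1))) (EuclideanSpace.single i 1))
      map_add' := fun _ _ => AlternatingMap.map_vecCons_add _ _ _ _
      map_smul' := fun _ _ => AlternatingMap.map_vecCons_smul _ _ _ _ }

theorem pullbackCoeff_contractVol (ψ : EuclideanSpace ℝ (Fin d) → M)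
    (Y : ∀ x : M, TangentSpace (𝓡 (d + 1)) x) (u : EuclideanSpace ℝ (Fin d)) :
    pullbackCoeff (𝓡 (d + 1)) ψ (contractVol g o Y) u = fluxFunctional g o ψ u (Y (ψ u)) := rfl

open Classical in
/-- Splitting of the flux through a hypersurface. -/
theorem formIntegral_fluxForm {D : ParamPieces (𝓡 (d + 1)) N d ℕ} (hD : D.Covers N)
    {C : ℕ → SplittingFrame g τ} (hC : ∀ i, (D.param i).W ⊆ (C i).V) (hm : 0 < m)
    (hN : ∀ i, ∀ u ∈ (D.param i).U, ∀ p ∈ futureHyperboloid g τ m ((D.param i).ψ u),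
      Real.sign (fluxFunctional g o (D.param i).ψ u (τ.vec ((D.param i).ψ u))) *
        fluxFunctional g o (D.param i).ψ u p = |fluxFunctional g o (D.param i).ψ u p|)
    (f : TangentBundle (𝓡 (d + 1)) M → ℝ)
    (hJ : ∀ x, FibreIntegrable g τ o m x (currentIntegrand f x))
    (hf : FormIntegrable (𝓡 (d + 1)).tangent (shellOver g τ m N) (shellOver g τ m N)
      (fluxForm g q F) (fun z => f z • fluxForm g q F z)) :
    FormIntegrable (𝓡 (d + 1)) N N (contractVol g o τ.vec)
      (contractVol g o (currentDensity g τ o m f)) ∧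
    formIntegral (𝓡 (d + 1)).tangent (shellOver g τ m N) (shellOver g τ m N)
      (fluxForm g q F) (fun z => f z • fluxForm g q F z) =
    formIntegral (𝓡 (d + 1)) N N (contractVol g o τ.vec)
      (contractVol g o (currentDensity g τ o m f)) := by
  let e : Fin d ⊕ Fin d ≃ Fin (2 * d) := finSumFinEquiv.trans (finCongr (by omega))
  have hcov := D.exists_isParamCover hD
  have hDA' := covers_shellPieces hC e hm hD
  have hcov' := (shellPieces D hC e hm).exists_isParamCover hDA'
  rw [formIntegrable_iff _ hcov' subset_rfl hDA'] at hf
  rw [formIntegral_eq _ hcov' subset_rfl hDA', formIntegral_eq D hcov subset_rfl hD,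
    formIntegrable_iff D hcov subset_rfl hD]
  let h : (ℕ × EuclideanSpace ℝ (Fin d)) × EuclideanSpace ℝ (Fin d) → ℝ := fun y =>
    if y.1.2 ∈ D.dom y.1.1 ∧ (D.param y.1.1).ψ y.1.2 ∈ N then
      |fluxFunctional g o (D.param y.1.1).ψ y.1.2
          ((C y.1.1).lift m ((D.param y.1.1).ψ y.1.2) y.2)| *
        (C y.1.1).density o m ((D.param y.1.1).ψ y.1.2) y.2 * f ⟨(D.param y.1.1).ψ y.1.2,
          (C y.1.1).lift m ((D.param y.1.1).ψ y.1.2) y.2⟩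
    else 0
  have h1 : (shellPieces D hC e hm).integrand (shellOver g τ m N) (fluxForm g q F)
      (fun z => f z • fluxForm g q F z) = h ∘ splitCopies e := by
    funext y
    obtain ⟨i, s⟩ := y
    by_cases hs : (splitCoords e s).1 ∈ D.dom i ∧ (D.param i).ψ (splitCoords e s).1 ∈ N
    · have hU := D.dom_subset i hs.1
      refine (if_pos ⟨hs.1, hs.2, (C i).lift_mem hm
        (hC i ((D.param i).mem_of_mem hU).2) _⟩).trans (Eq.trans ?_ (if_pos hs).symm)
      refine (sign_smul_pullbackCoeff_smul _ _ _ _ _).trans ?_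
      exact congrArg (· * _) (SplittingFrame.abs_pullbackCoeff_fluxForm o q F e hm (hC i) hU)
    · exact (if_neg fun h => hs ⟨h.1, h.2.1⟩).trans (if_neg hs).symm
  have h2 : D.integrand N (contractVol g o τ.vec) (contractVol g o (currentDensity g τ o m f)) =
      fun y => ∫ u, h (y, u) := by
    funext y
    obtain ⟨i, s⟩ := y
    by_cases hs : s ∈ D.dom i ∧ (D.param i).ψ s ∈ N
    · refine (if_pos hs).trans ?_
      have hU := D.dom_subset i hs.1
      have hV := hC i ((D.param i).mem_of_mem hU).2
      have hint := ((C i).fibreIntegrable_iff o hm hV _).1 (hJ ((D.param i).ψ s))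
      have hJ' : currentDensity g τ o m f ((D.param i).ψ s) = _ :=
        (C i).fibreIntegral_eq o hm hV (currentIntegrand f ((D.param i).ψ s))
      rw [pullbackCoeff_contractVol, pullbackCoeff_contractVol, hJ']
      refine (congrArg (Real.sign _ • ·) (ContinuousLinearMap.integral_comp_comm _ hint).symm).trans
        ?_
      rw [smul_eq_mul, ← integral_const_mul]
      refine integral_congr_ae (Filter.Eventually.of_forall fun u => ?_)
      refine Eq.trans ?_ (if_pos hs).symm
      have h3 : currentIntegrand f ((D.param i).ψ s) ((C i).lift m ((D.param i).ψ s) u) =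
        f ⟨(D.param i).ψ s, (C i).lift m ((D.param i).ψ s) u⟩ • (C i).lift m ((D.param i).ψ s) u :=
        rfl
      have h4 := hN i s hU _ ((C i).lift_mem hm hV u)
      beta_reduce
      rw [h3, map_smul, map_smul, smul_eq_mul, smul_eq_mul]
      linear_combination ((C i).density o m ((D.param i).ψ s) u *
        f ⟨(D.param i).ψ s, (C i).lift m ((D.param i).ψ s) u⟩) * h4
    · refine (if_neg hs).trans ?_
      have h3 : ∀ u, h ((i, s), u) = 0 := fun u => if_neg hs
      simp only [h3, integral_zero]
  rw [h1, (measurePreserving_splitCopies e).integrable_comp_emb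
    (splitCopies e).measurableEmbedding] at hf
  rw [h1, h2]
  refine ⟨hf.integral_prod_left, ?_⟩
  rw [← integral_prod _ hf]
  exact (measurePreserving_splitCopies e).integral_comp (splitCopies e).measurableEmbedding h

end Splitting

theorem ContinuousOn.isOpen_inter_norm_sub_mul_lt_one {X F : Type*} [TopologicalSpace X]
    [SeminormedAddCommGroup F] {G : X → F} {S : Set X} (hG : ContinuousOn G S) (hS : IsOpen S)
    (x₀ : X) (c : ℝ) :
    IsOpen (S ∩ (fun x => ‖G x - G x₀‖ * c) ⁻¹' Iio 1) ∧ ‖G x₀ - G x₀‖ * c < 1 := by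
  refine ⟨((hG.sub continuousOn_const).norm.mul continuousOn_const).isOpen_inter_preimage hS
    isOpen_Iio, ?_⟩
  rw [sub_self, norm_zero, zero_mul]
  exact one_pos

section Existence

variable {d : ℕ} {M : Type*} [TopologicalSpace M]
  [ChartedSpace (EuclideanSpace ℝ (Fin (d + 1))) M] [IsManifold (𝓡 (d + 1)) ∞ M]
  {g : LorentzMetric d M} (τ : TimeOrientation g)

theorem TimeOrientation.exists_orthonormalBasis (x : M) :
    ∃ b : Module.Basis (Fin (d + 1)) ℝ (EuclideanSpace ℝ (Fin (d + 1))),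
      (∀ i j, g.bilin x (b i) (b j) = if i = j then (if i = 0 then -1 else 1) else 0) ∧
      g.bilin x (τ.vec x) (b 0) < 0 := by
  obtain ⟨b, hb⟩ := g.exists_orthonormalBasis x
  have hb0 : g.bilin x (b 0) (b 0) < 0 := by
    rw [hb]
    norm_num
  have hne := LorentzMetric.bilin_ne_zero_of_timelike (τ.timelike x) hb0
  change g.bilin x (τ.vec x) (b 0) ≠ 0 at hne
  rcases hne.lt_or_gt with h | h
  · exact ⟨b, hb, h⟩
  · refine ⟨b.unitsSMul fun _ => -1, fun i j => ?_, ?_⟩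
    · simp [Module.Basis.unitsSMul_apply, hb]
    · simp only [Module.Basis.unitsSMul_apply, Units.smul_def, Units.val_neg, Units.val_one,
        map_smul, smul_eq_mul]
      linarith

theorem exists_splittingFrame (x₀ : M) : ∃ C : SplittingFrame g τ, x₀ ∈ C.V := by
  obtain ⟨b, hb, hτ⟩ := τ.exists_orthonormalBasis x₀
  let A : (ℝ × EuclideanSpace ℝ (Fin d)) ≃L[ℝ] EuclideanSpace ℝ (Fin (d + 1)) :=
    (((LinearEquiv.refl ℝ ℝ).prodCongr (WithLp.linearEquiv 2 ℝ (Fin d → ℝ))).trans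
      ((Fin.consLinearEquiv ℝ (fun _ : Fin (d + 1) => ℝ)).trans
        b.equivFun.symm)).toContinuousLinearEquiv
  have hA : ∀ t u i, b.repr (A (t, u)) i = (Fin.cons t u : Fin (d + 1) → ℝ) i := fun t u i =>
    congrFun (b.equivFun.apply_symm_apply (Fin.cons t u)) i
  have hA0 : A (1, 0) = b 0 := by
    refine b.ext_elem fun i => ?_
    rw [hA, b.repr_self, Finsupp.single_apply]
    refine Fin.cases ?_ (fun j => ?_) i
    · simp
    · simp [(Fin.succ_ne_zero j).symm]
  let κ : EuclideanSpace ℝ (Fin d) →L[ℝ] EuclideanSpace ℝ (Fin (d + 1)) :=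
    A.toContinuousLinearMap.comp (ContinuousLinearMap.inr ℝ _ _)
  have hκ : ∀ u, g.bilin x₀ (κ u) (κ u) = ‖u‖ ^ 2 := by
    intro u
    rw [g.bilin_eq_sum hb, EuclideanSpace.norm_sq_eq]
    have h0 : ∀ i, b.repr (κ u) i = (Fin.cons 0 u : Fin (d + 1) → ℝ) i := hA 0 u
    simp [h0, ← sq]
  let G : M → EuclideanSpace ℝ (Fin (d + 1)) →L[ℝ] EuclideanSpace ℝ (Fin (d + 1)) →L[ℝ] ℝ :=
    fun x => (g.bilin x).bilinearComp (chartVec x₀ x) (chartVec x₀ x)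
  set S := (chartAt (EuclideanSpace ℝ (Fin (d + 1))) x₀).source with hS
  have hSo : IsOpen S := (chartAt (EuclideanSpace ℝ (Fin (d + 1))) x₀).open_source
  have hx₀ : x₀ ∈ S := mem_chart_source _ x₀
  have hG : ContinuousOn G S := by
    have h1 := (contDiffOn_inChart g x₀).continuousOn.comp (t := (extChartAt (𝓡 (d + 1)) x₀).target)
      (continuousOn_extChartAt x₀) (extChartAt (𝓡 (d + 1)) x₀).mapsTo
    rw [extChartAt_source] at h1
    refine h1.congr fun x hx => ?_
    have h2 := (extChartAt (𝓡 (d + 1)) x₀).left_inv (x := x) (by rwa [extChartAt_source])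
    change G x = g.inChart x₀ (extChartAt (𝓡 (d + 1)) x₀ x)
    rw [LorentzMetric.inChart, h2]
  have hGx : ∀ v w, G x₀ v w = g.bilin x₀ v w := by
    intro v w
    change g.bilin x₀ (chartVec x₀ x₀ v) (chartVec x₀ x₀ w) = _
    rw [chartVec_self, chartVec_self]
  have h1 : ContinuousOn (fun x => G x (A (1, 0)) (A (1, 0))) S :=
    (hG.clm_apply continuousOn_const).clm_apply continuousOn_const
  have h2 : ContinuousOn (fun x => g.bilin x (τ.vec x) (chartVec x₀ x (A (1, 0)))) S :=
    g.continuousOn_apply (v := τ.vec) (w := fun x => chartVec x₀ x (A (1, 0)))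
      τ.continuous_vec.continuousOn
      (continuousOn_mk_chartVec continuousOn_id continuousOn_const fun x hx => hx)
  have h3 := ContinuousOn.isOpen_inter_norm_sub_mul_lt_one
    (F := EuclideanSpace ℝ (Fin (d + 1)) →L[ℝ] EuclideanSpace ℝ (Fin (d + 1)) →L[ℝ] ℝ) hG hSo x₀
    (‖κ‖ ^ 2)
  refine ⟨⟨x₀, (S ∩ (fun x => G x (A (1, 0)) (A (1, 0))) ⁻¹' Iio 0) ∩
    ((S ∩ (fun x => g.bilin x (τ.vec x) (chartVec x₀ x (A (1, 0)))) ⁻¹' Iio 0) ∩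
      (S ∩ (fun x => ‖G x - G x₀‖ * ‖κ‖ ^ 2) ⁻¹' Iio 1)), A,
    (h1.isOpen_inter_preimage hSo isOpen_Iio).inter
      ((h2.isOpen_inter_preimage hSo isOpen_Iio).inter h3.1),
    fun x hx => hx.1.1, fun x hx => hx.1.2, fun x hx => hx.2.1.2, fun x hx u hu => ?_⟩,
    ⟨hx₀, ?_⟩, ⟨hx₀, ?_⟩, hx₀, ?_⟩
  · have h4 : ‖G x - G x₀‖ * ‖κ‖ ^ 2 < 1 := hx.2.2.2
    have h5 := (G x - G x₀).le_opNorm₂ (κ u) (κ u)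
    have h6 : (G x - G x₀) (κ u) (κ u) = G x (κ u) (κ u) - ‖u‖ ^ 2 := by
      rw [← hκ, ← hGx]
      rfl
    rw [h6, Real.norm_eq_abs] at h5
    have h7 := κ.le_opNorm u
    have h8 : ‖κ u‖ * ‖κ u‖ ≤ (‖κ‖ * ‖u‖) * (‖κ‖ * ‖u‖) := by gcongr
    have h9 : 0 < ‖u‖ ^ 2 := by positivity
    have h10 : ‖G x - G x₀‖ * ‖κ u‖ * ‖κ u‖ ≤ (‖G x - G x₀‖ * ‖κ‖ ^ 2) * ‖u‖ ^ 2 := by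
      calc _ = ‖G x - G x₀‖ * (‖κ u‖ * ‖κ u‖) := by ring
        _ ≤ ‖G x - G x₀‖ * ((‖κ‖ * ‖u‖) * (‖κ‖ * ‖u‖)) := by gcongr
        _ = _ := by ring
    have h11 : (‖G x - G x₀‖ * ‖κ‖ ^ 2) * ‖u‖ ^ 2 < 1 * ‖u‖ ^ 2 := by gcongr
    change 0 < G x (κ u) (κ u)
    linarith [neg_abs_le (G x (κ u) (κ u) - ‖u‖ ^ 2)]
  · change G x₀ (A (1, 0)) (A (1, 0)) < 0
    rw [hGx, hA0, hb]
    norm_num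
  · change g.bilin x₀ (τ.vec x₀) (chartVec x₀ x₀ (A (1, 0))) < 0
    rw [chartVec_self, hA0]
    exact hτ
  · exact h3.2

/-- The chart at `x` as a local parametrization. -/
noncomputable def chartParam (x : M) : LocalParam (𝓡 (d + 1)) (univ : Set M) (d + 1) where
  ψ := (extChartAt (𝓡 (d + 1)) x).symm
  U := (extChartAt (𝓡 (d + 1)) x).target
  χ := extChartAt (𝓡 (d + 1)) x
  W := (extChartAt (𝓡 (d + 1)) x).source
  isOpen_U := isOpen_extChartAt_target x
  isOpen_W := isOpen_extChartAt_source x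
  smooth_ψ := contMDiffOn_extChartAt_symm x
  smooth_χ := by
    rw [extChartAt_source]
    exact contMDiffOn_extChartAt
  image_eq := by
    rw [univ_inter]
    exact (extChartAt (𝓡 (d + 1)) x).symm_image_target_eq_source
  left_inv u hu := (extChartAt (𝓡 (d + 1)) x).right_inv hu

theorem isEmbeddedSubmanifold_univ : IsEmbeddedSubmanifold (𝓡 (d + 1)) (univ : Set M) (d + 1) :=
  fun x _ => ⟨chartParam x, mem_extChartAt_source x⟩

theorem IsEmbeddedSubmanifold.exists_param_subset_frame {N : Set M} {k : ℕ}
    (hN : IsEmbeddedSubmanifold (𝓡 (d + 1)) N k) {x : M} (hx : x ∈ N) :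
    ∃ P : LocalParam (𝓡 (d + 1)) N k, x ∈ P.W ∧ ∃ C : SplittingFrame g τ, P.W ⊆ C.V := by
  obtain ⟨P, hP⟩ := hN x hx
  obtain ⟨C, hC⟩ := exists_splittingFrame τ x
  exact ⟨P.restrict C.isOpen_V, ⟨hP, hC⟩, C, inter_subset_right⟩

theorem IsEmbeddedSubmanifold.exists_pieces [SecondCountableTopology M] [Nonempty M] {N : Set M}
    {k : ℕ} (hN : IsEmbeddedSubmanifold (𝓡 (d + 1)) N k) :
    ∃ (D : ParamPieces (𝓡 (d + 1)) N k ℕ) (C : ℕ → SplittingFrame g τ), D.Covers N ∧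
      ∀ i, (D.param i).W ⊆ (C i).V := by
  obtain ⟨C₀, -⟩ := exists_splittingFrame τ (Classical.arbitrary M)
  obtain ⟨P, hP, hPC⟩ := exists_isParamCover (p := fun P => ∃ C : SplittingFrame g τ, P.W ⊆ C.V)
    ⟨C₀, empty_subset _⟩ fun x hx => hN.exists_param_subset_frame τ hx
  choose C hC using hPC
  exact ⟨firstPieces P, C, covers_firstPieces subset_rfl hP, hC⟩

end Existence

section Spacelike

variable {d : ℕ} {M : Type*} [TopologicalSpace M]
  [ChartedSpace (EuclideanSpace ℝ (Fin (d + 1))) M] [IsManifold (𝓡 (d + 1)) ∞ M]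
  {g : LorentzMetric d M} (o : ManifoldOrientation d M)

theorem exists_eq_mfderiv_of_fluxFunctional_eq_zero {ψ : EuclideanSpace ℝ (Fin d) → M}
    {u : EuclideanSpace ℝ (Fin d)} {L : EuclideanSpace ℝ (Fin d) →L[ℝ] EuclideanSpace ℝ (Fin (d + 1))}
    (hL : L = mfderiv (𝓡 d) (𝓡 (d + 1)) ψ u) (hinj : Function.Injective L)
    {r : EuclideanSpace ℝ (Fin (d + 1))} (hr : fluxFunctional g o ψ u r = 0) : ∃ v, L v = r := by
  obtain ⟨b, hb⟩ := g.exists_orthonormalBasis (ψ u)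
  have h0 : b.det (Matrix.vecCons r fun i => L (EuclideanSpace.single i 1)) = 0 := by
    rw [← abs_eq_zero, ← abs_volForm_eq_abs_det g o hb, abs_eq_zero, hL]
    exact hr
  have hli : LinearIndependent ℝ fun i : Fin d => L (EuclideanSpace.single i 1) := by
    have := (EuclideanSpace.basisFun (Fin d) ℝ).toBasis.linearIndependent.map' L.toLinearMap
      (LinearMap.ker_eq_bot.2 hinj)
    simpa [Function.comp_def] using this
  have hmem : r ∈ Submodule.span ℝ (range fun i : Fin d => L (EuclideanSpace.single i 1)) := by
    by_contra hmem
    have h1 := linearIndependent_finCons.2 ⟨hli, hmem⟩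
    have h2 := h1.span_eq_top_of_card_eq_finrank' (by simp)
    have h3 := (b.is_basis_iff_det).1 ⟨h1, h2⟩
    exact h3.ne_zero h0
  have hle : Submodule.span ℝ (range fun i : Fin d => L (EuclideanSpace.single i 1)) ≤
      LinearMap.range L.toLinearMap :=
    Submodule.span_le.2 (range_subset_iff.2 fun i => ⟨_, rfl⟩)
  exact hle hmem

theorem sign_fluxFunctional_mul {S : Set M} (hS : IsSpacelike g S) (P : LocalParam (𝓡 (d + 1)) S d)
    {u : EuclideanSpace ℝ (Fin d)} (hu : u ∈ P.U) {T p : EuclideanSpace ℝ (Fin (d + 1))}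
    (hT : g.bilin (P.ψ u) T T < 0) (hp : g.bilin (P.ψ u) p p < 0) (hTp : g.bilin (P.ψ u) T p < 0) :
    Real.sign (fluxFunctional g o P.ψ u T) * fluxFunctional g o P.ψ u p =
      |fluxFunctional g o P.ψ u p| := by
  obtain ⟨L, hL⟩ : ∃ L : EuclideanSpace ℝ (Fin d) →L[ℝ] EuclideanSpace ℝ (Fin (d + 1)),
    L = mfderiv (𝓡 d) (𝓡 (d + 1)) P.ψ u := ⟨_, rfl⟩
  have hpos : ∀ v, v ≠ 0 → 0 < g.bilin (P.ψ u) (L v) (L v) := by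
    intro v hv
    rw [hL]
    exact hS P u hu v hv
  have hnn : ∀ v, 0 ≤ g.bilin (P.ψ u) (L v) (L v) := by
    intro v
    rcases eq_or_ne v 0 with rfl | hv
    · rw [map_zero, map_zero]
    · exact (hpos v hv).le
  have hinj : Function.Injective L := by
    rw [injective_iff_map_eq_zero]
    intro v hv
    by_contra hne
    have := hpos v hne
    rw [hv, map_zero] at this
    exact lt_irrefl _ this
  have hne : ∀ r, g.bilin (P.ψ u) r r < 0 → fluxFunctional g o P.ψ u r ≠ 0 := by
    intro r hr h0
    obtain ⟨v, rfl⟩ := exists_eq_mfderiv_of_fluxFunctional_eq_zero o hL hinj h0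
    exact absurd hr (hnn v).not_gt
  have ha := hne T hT
  have hc := hne p hp
  have hac : 0 < fluxFunctional g o P.ψ u p / fluxFunctional g o P.ψ u T := by
    by_contra! h
    have h1 := LorentzMetric.bilin_add_smul_neg hT hp hT hTp hT (neg_nonneg.2 h)
    refine hne _ h1 ?_
    rw [map_add, map_smul, smul_eq_mul, neg_mul, div_mul_cancel₀ _ ha, add_neg_cancel]
  have hmul := div_mul_cancel₀ (fluxFunctional g o P.ψ u p) ha
  rcases ha.lt_or_gt with h | h
  · rw [Real.sign_of_neg h, abs_of_neg (hmul ▸ mul_neg_of_pos_of_neg hac h), neg_one_mul]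
  · rw [Real.sign_of_pos h, abs_of_pos (hmul ▸ mul_pos hac h), one_mul]

end Spacelike

section Integrability

variable {d : ℕ} {M : Type*} [TopologicalSpace M]
  [ChartedSpace (EuclideanSpace ℝ (Fin (d + 1))) M] [IsManifold (𝓡 (d + 1)) ∞ M]
  {g : LorentzMetric d M} {τ : TimeOrientation g} (o : ManifoldOrientation d M) {m : ℝ}
  (q : ℝ) (F : DForm (𝓡 (d + 1)) M 2 ℝ)

theorem isClosed_futureShell (hm : 0 < m) : IsClosed (futureShell g τ m) := by
  have h1 : Continuous fun z : TangentBundle (𝓡 (d + 1)) M => g.val z.1 z.2 z.2 :=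
    continuousOn_univ.1 (g.continuousOn_apply (b := fun z : TangentBundle (𝓡 (d + 1)) M => z.1)
      (v := fun z => z.2) (w := fun z => z.2) continuousOn_id continuousOn_id)
  have h2 : Continuous fun z : TangentBundle (𝓡 (d + 1)) M => g.val z.1 (τ.vec z.1) z.2 :=
    continuousOn_univ.1 (g.continuousOn_apply (b := fun z : TangentBundle (𝓡 (d + 1)) M => z.1)
      (v := fun z => τ.vec z.1) (w := fun z => z.2)
      (τ.continuous_vec.comp (FiberBundle.continuous_proj _ _)).continuousOn continuousOn_id)
  have h3 : futureShell g τ m = {z | g.val z.1 z.2 z.2 = -m ^ 2} ∩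
      {z | g.val z.1 (τ.vec z.1) z.2 ≤ 0} := by
    ext z
    constructor
    · rintro ⟨-, hz1, hz2⟩
      exact ⟨hz1, hz2.le⟩
    · rintro ⟨hz1, hz2⟩
      refine ⟨mem_univ _, hz1, lt_of_le_of_ne hz2 ?_⟩
      refine LorentzMetric.bilin_ne_zero_of_timelike (τ.timelike z.1) ?_
      change g.val z.1 z.2 z.2 < 0
      rw [show g.val z.1 z.2 z.2 = -m ^ 2 from hz1]
      exact neg_lt_zero.2 (by positivity)
  rw [h3]
  exact (isClosed_eq h1 continuous_const).inter (isClosed_le h2 continuous_const)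

variable {f : TangentBundle (𝓡 (d + 1)) M → ℝ}

theorem continuousOn_density_comp {Y : Type*} [TopologicalSpace Y] (C : SplittingFrame g τ)
    (hm : 0 < m) {b : Y → M} {c : Y → EuclideanSpace ℝ (Fin d)} {s : Set Y}
    (hb : ContinuousOn b s) (hc : ContinuousOn c s) (hs : ∀ y ∈ s, b y ∈ C.V) :
    ContinuousOn (fun y => C.density o m (b y) (c y)) s :=
  ContinuousOn.comp (g := fun y : M × EuclideanSpace ℝ (Fin d) => C.density o m y.1 y.2)
    (f := fun y => (b y, c y)) (C.continuousOn_density o hm) (hb.prodMk hc)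
    fun y hy => ⟨hs y hy, mem_univ _⟩

theorem fibreIntegrable_of_isCompact [T2Space M] (hm : 0 < m)
    (hf : ContMDiffOn (𝓡 (d + 1)).tangent 𝓘(ℝ, ℝ) ∞ f (futureShell g τ m))
    (hfc : IsCompact (closure (futureShell g τ m ∩ Function.support f)))
    {G : Type*} [NormedAddCommGroup G] [NormedSpace ℝ G]
    (w : EuclideanSpace ℝ (Fin (d + 1)) → G) (hw : Continuous w) (x : M) :
    FibreIntegrable g τ o m x fun p => f ⟨x, p⟩ • w p := by
  obtain ⟨C, hx⟩ := exists_splittingFrame τ x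
  have hmem : ∀ u, (⟨x, C.lift m x u⟩ : TangentBundle (𝓡 (d + 1)) M) ∈ futureShell g τ m :=
    fun u => ⟨mem_univ _, C.lift_mem hm hx u⟩
  have hl := (C.contDiff_lift hm hx).continuous
  have hc1 : Continuous (C.density o m x) :=
    continuousOn_univ.1 (continuousOn_density_comp o C hm (b := fun _ => x) (c := id)
      continuousOn_const continuousOn_id fun _ _ => hx)
  have hc2 : Continuous fun u => f ⟨x, C.lift m x u⟩ :=
    hf.continuousOn.comp_continuous ((contMDiff_fiberMk x).continuous.comp hl) hmem
  suffices hint : Integrable fun u => C.density o m x u • f ⟨x, C.lift m x u⟩ • w (C.lift m x u) from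
    (C.fibreIntegrable_iff o hm hx _).2 hint
  refine (hc1.smul (hc2.smul (hw.comp hl))).integrable_of_hasCompactSupport ?_
  have hK : IsCompact (closure (futureShell g τ m ∩ Function.support f) ∩
      Bundle.TotalSpace.proj ⁻¹' {x}) :=
    hfc.inter_right (isClosed_singleton.preimage (FiberBundle.continuous_proj _ _))
  have hcoord : ContinuousOn (fun z : TangentBundle (𝓡 (d + 1)) M => (C.coord z.1 z.2).2)
      (closure (futureShell g τ m ∩ Function.support f) ∩ Bundle.TotalSpace.proj ⁻¹' {x}) :=
    continuous_snd.comp_continuousOn (C.contMDiffOn_coord.continuousOn.mono (by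
      rintro z ⟨-, rfl⟩
      exact hx))
  have hK' := hK.image_of_continuousOn hcoord
  have h0 : ∀ u, u ∉ (fun z : TangentBundle (𝓡 (d + 1)) M => (C.coord z.1 z.2).2) ''
      (closure (futureShell g τ m ∩ Function.support f) ∩ Bundle.TotalSpace.proj ⁻¹' {x}) →
      f ⟨x, C.lift m x u⟩ = 0 := by
    intro u hu
    by_contra hne
    exact hu ⟨⟨x, C.lift m x u⟩, ⟨subset_closure ⟨hmem u, hne⟩, rfl⟩, C.coord_lift hx u⟩
  refine HasCompactSupport.intro hK' fun u hu => ?_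
  exact (congrArg (fun t : ℝ => C.density o m x u • t • w (C.lift m x u)) (h0 u hu)).trans (by simp)

theorem LocalParam.continuousOn_mfderiv {N : Set M} {k : ℕ} (P : LocalParam (𝓡 (d + 1)) N k)
    (v : EuclideanSpace ℝ (Fin k)) :
    ContinuousOn (fun u => (⟨P.ψ u, mfderiv (𝓡 k) (𝓡 (d + 1)) P.ψ u v⟩ :
      TangentBundle (𝓡 (d + 1)) M)) P.U := by
  have h := P.smooth_ψ.continuousOn_tangentMapWithin (by simp) P.isOpen_U.uniqueMDiffOn
  have hs : Continuous fun u : EuclideanSpace ℝ (Fin k) =>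
      (⟨u, v⟩ : TangentBundle (𝓡 k) (EuclideanSpace ℝ (Fin k))) :=
    (tangentBundleModelSpaceHomeomorph (𝓡 k)).symm.continuous.comp
      (Continuous.prodMk_left v)
  refine (h.comp hs.continuousOn (s := P.U) fun u hu => hu).congr fun u hu => ?_
  rw [Function.comp_apply, tangentMapWithin, mfderivWithin_of_isOpen P.isOpen_U hu]

/-- Integrability over the part of the mass shell over `A`. -/
theorem formIntegrable_shell_of_isCompact {k K : ℕ} {N : Set M} (e : Fin k ⊕ Fin d ≃ Fin K)
    (hm : 0 < m) (hN : IsEmbeddedSubmanifold (𝓡 (d + 1)) N k)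
    [SecondCountableTopology M] [Nonempty M]
    (β : DForm (𝓡 (d + 1)).tangent (TangentBundle (𝓡 (d + 1)) M) K ℝ)
    (hβ : ∀ (P : LocalParam (𝓡 (d + 1)) N k) (C : SplittingFrame g τ), P.W ⊆ C.V →
      ContinuousOn (fun s => |pullbackCoeff (𝓡 (d + 1)).tangent (C.shellMap P e m) β s|)
        {s | (splitCoords e s).1 ∈ P.U})
    (hf : ContMDiffOn (𝓡 (d + 1)).tangent 𝓘(ℝ, ℝ) ∞ f (futureShell g τ m)) {A : Set M}
    (hA : A ⊆ N) {Z : Set (TangentBundle (𝓡 (d + 1)) M)} (hZ : IsClosed Z)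
    (hNZ : shellOver g τ m N ∩ Z ⊆ shellOver g τ m A) (hcomp : IsCompact (shellOver g τ m N ∩ Z))
    (h0 : ∀ z ∈ shellOver g τ m A, z ∉ Z → f z = 0) :
    FormIntegrable (𝓡 (d + 1)).tangent (shellOver g τ m N) (shellOver g τ m A) β
      (fun z => f z • β z) := by
  obtain ⟨D, C, hD, hC⟩ := hN.exists_pieces τ
  refine formIntegrable_of_isCompact
    ((shellPieces D hC e hm).exists_isParamCover (covers_shellPieces hC e hm hD))
    (fun z hz => ⟨hA hz.1, hz.2⟩) _ _ hZ hNZ hcomp (fun z hz hzZ => ?_) fun z hz => ?_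
  · rw [h0 z hz hzZ, zero_smul]
  · obtain ⟨P, hzP, C, hPC⟩ := hN.exists_param_subset_frame τ hz.1
    let Q := C.shellParam P e hm hPC
    refine ⟨Q, hzP, ?_⟩
    refine ContinuousOn.congr ((hβ P C hPC).mul (hf.continuousOn.comp Q.continuousOn_ψ
      fun s hs => ?_)) fun s hs => sign_smul_pullbackCoeff_smul _ _ _ _ _
    have h := (Q.mem_of_mem hs).1
    exact ⟨mem_univ _, h.2⟩

theorem continuousOn_abs_pullbackCoeff_shellForm (o : ManifoldOrientation d M) {N : Set M}
    (e : Fin (d + 1) ⊕ Fin d ≃ Fin (2 * d + 1))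
    (hm : 0 < m) (P : LocalParam (𝓡 (d + 1)) N (d + 1)) (C : SplittingFrame g τ)
    (hPC : P.W ⊆ C.V) :
    ContinuousOn (fun s => |pullbackCoeff (𝓡 (d + 1)).tangent (C.shellMap P e m)
      (shellForm g q F) s|) {s | (splitCoords e s).1 ∈ P.U} := by
  have hsplit := (splitCoords e).continuous
  have hb := P.continuousOn_ψ.comp (hsplit.fst.continuousOn
    (s := {s | (splitCoords e s).1 ∈ P.U})) fun s hs => hs
  have h1 := (continuousOn_abs_volForm g o (b := P.ψ) (s := P.U)
    (v := fun u i => (mfderiv (𝓡 (d + 1)) (𝓡 (d + 1)) P.ψ u : EuclideanSpace ℝ (Fin (d + 1)) →L[ℝ]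
      EuclideanSpace ℝ (Fin (d + 1))) (EuclideanSpace.single i 1))
    fun i => P.continuousOn_mfderiv _).comp (hsplit.fst.continuousOn
    (s := {s | (splitCoords e s).1 ∈ P.U})) fun s hs => hs
  have h2 := continuousOn_density_comp o C hm hb hsplit.snd.continuousOn
    fun s hs => hPC (P.mem_of_mem hs).2
  exact (h1.mul h2).congr fun s hs =>
    SplittingFrame.abs_pullbackCoeff_shellForm o q F e hm hPC hs

theorem continuousOn_abs_pullbackCoeff_fluxForm (o : ManifoldOrientation d M) {N : Set M}
    (e : Fin d ⊕ Fin d ≃ Fin (2 * d))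
    (hm : 0 < m) (P : LocalParam (𝓡 (d + 1)) N d) (C : SplittingFrame g τ)
    (hPC : P.W ⊆ C.V) :
    ContinuousOn (fun s => |pullbackCoeff (𝓡 (d + 1)).tangent (C.shellMap P e m)
      (fluxForm g q F) s|) {s | (splitCoords e s).1 ∈ P.U} := by
  have hsplit := (splitCoords e).continuous
  have hb := P.continuousOn_ψ.comp (hsplit.fst.continuousOn
    (s := {s | (splitCoords e s).1 ∈ P.U})) fun s hs => hs
  have h1 := continuousOn_abs_volForm g o (b := fun s => P.ψ (splitCoords e s).1)
    (s := {s | (splitCoords e s).1 ∈ P.U})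
    (v := fun s => Matrix.vecCons (C.lift m (P.ψ (splitCoords e s).1) (splitCoords e s).2)
      fun i => (mfderiv (𝓡 d) (𝓡 (d + 1)) P.ψ (splitCoords e s).1 : EuclideanSpace ℝ (Fin d) →L[ℝ]
      EuclideanSpace ℝ (Fin (d + 1))) (EuclideanSpace.single i 1))
    (Fin.cases (C.shellParam P e hm hPC).continuousOn_ψ fun i =>
      (P.continuousOn_mfderiv (EuclideanSpace.single i 1)).comp hsplit.fst.continuousOn
        fun s hs => hs)
  have h2 := continuousOn_density_comp o C hm hb hsplit.snd.continuousOn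
    fun s hs => hPC (P.mem_of_mem hs).2
  exact (h1.mul h2).congr fun s hs =>
    SplittingFrame.abs_pullbackCoeff_fluxForm o q F e hm hPC hs

end Integrability

theorem mainTheorem11 (d : ℕ) (M : Type*) [TopologicalSpace M] [T2Space M]
    [SecondCountableTopology M] [Nonempty M]
    [ChartedSpace (EuclideanSpace ℝ (Fin (d + 1))) M] [IsManifold (𝓡 (d + 1)) ∞ M]
    (g : LorentzMetric d M) (o : ManifoldOrientation d M) (τ : TimeOrientation g)
    (m : ℝ) (hm : 0 < m) (q : ℝ) (F : DForm (𝓡 (d + 1)) M 2 ℝ)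
    (f : TangentBundle (𝓡 (d + 1)) M → ℝ)
    (hf : ContMDiffOn (𝓡 (d + 1)).tangent 𝓘(ℝ, ℝ) ∞ f (futureShell g τ m))
    (hfc : IsCompact (closure (futureShell g τ m ∩ Function.support f))) :
    -- the fibre integrals of `f` and of `f p` exist
    (∀ x : M, FibreIntegrable g τ o m x (fun p => f ⟨x, p⟩) ∧
      FibreIntegrable g τ o m x (currentIntegrand f x)) ∧
    -- splitting I
    (∀ K : Set M, IsCompact K →
      (∃ e ∈ IsManifold.maximalAtlas (𝓡 (d + 1)) ∞ M, K ⊆ e.source) →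
      FormIntegrable (𝓡 (d + 1)).tangent (futureShell g τ m) (shellOver g τ m K)
        (shellForm g q F) (fun z => f z • shellForm g q F z) ∧
      FormIntegrable (𝓡 (d + 1)) univ K (volForm g o)
        (fun x => fibreIntegral g τ o m x (fun p => f ⟨x, p⟩) • volForm g o x) ∧
      formIntegral (𝓡 (d + 1)).tangent (futureShell g τ m) (shellOver g τ m K)
          (shellForm g q F) (fun z => f z • shellForm g q F z) =
        formIntegral (𝓡 (d + 1)) univ K (volForm g o)
          (fun x => fibreIntegral g τ o m x (fun p => f ⟨x, p⟩) • volForm g o x)) ∧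
    -- splitting II
    (∀ S : Set M, IsEmbeddedSubmanifold (𝓡 (d + 1)) S d → IsSpacelike g S →
      (∃ e ∈ IsManifold.maximalAtlas (𝓡 (d + 1)) ∞ M, S ⊆ e.source) →
      (IsCompact (closure (futureShell g τ m ∩ Function.support f) ∩ shellOver g τ m S) →
        FormIntegrable (𝓡 (d + 1)).tangent (shellOver g τ m S) (shellOver g τ m S)
          (fluxForm g q F) (fun z => f z • fluxForm g q F z)) ∧
      (FormIntegrable (𝓡 (d + 1)).tangent (shellOver g τ m S) (shellOver g τ m S)
          (fluxForm g q F) (fun z => f z • fluxForm g q F z) →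
        FormIntegrable (𝓡 (d + 1)) S S (contractVol g o τ.vec)
          (contractVol g o (currentDensity g τ o m f)) ∧
        formIntegral (𝓡 (d + 1)).tangent (shellOver g τ m S) (shellOver g τ m S)
            (fluxForm g q F) (fun z => f z • fluxForm g q F z) =
          formIntegral (𝓡 (d + 1)) S S (contractVol g o τ.vec)
            (contractVol g o (currentDensity g τ o m f)))) := by
  have hJ : ∀ x, FibreIntegrable g τ o m x (currentIntegrand f x) := fun x =>
    fibreIntegrable_of_isCompact o hm hf hfc (fun p => p) continuous_id x
  refine ⟨fun x => ⟨?_, hJ x⟩, fun K hK _ => ?_, fun S hS hSs _ => ⟨fun hc => ?_, fun hint => ?_⟩⟩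
  · have h := fibreIntegrable_of_isCompact o hm hf hfc (fun _ => (1 : ℝ)) continuous_const x
    simpa only [smul_eq_mul, mul_one] using h
  · obtain ⟨D, C, hD, hC⟩ := isEmbeddedSubmanifold_univ.exists_pieces τ
    let e : Fin (d + 1) ⊕ Fin d ≃ Fin (2 * d + 1) := finSumFinEquiv.trans (finCongr (by omega))
    have hint : FormIntegrable (𝓡 (d + 1)).tangent (futureShell g τ m) (shellOver g τ m K)
        (shellForm g q F) (fun z => f z • shellForm g q F z) := by
      have hKc : IsClosed (Bundle.TotalSpace.proj ⁻¹' K : Set (TangentBundle (𝓡 (d + 1)) M)) :=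
        hK.isClosed.preimage (FiberBundle.continuous_proj _ _)
      refine formIntegrable_shell_of_isCompact e hm isEmbeddedSubmanifold_univ _
        (continuousOn_abs_pullbackCoeff_shellForm q F o e hm) hf (subset_univ K)
        (Z := closure (futureShell g τ m ∩ Function.support f) ∩ Bundle.TotalSpace.proj ⁻¹' K)
        (isClosed_closure.inter hKc) (fun z hz => ⟨hz.2.2, hz.1.2⟩)
        ((hfc.inter_right hKc).inter_left (isClosed_futureShell hm)) fun z hz hzZ => ?_
      by_contra hne
      exact hzZ ⟨subset_closure ⟨⟨mem_univ _, hz.2⟩, hne⟩, hz.1⟩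
    exact ⟨hint, formIntegral_shellForm o q F hD hC hm (subset_univ K) f hint⟩
  · let e : Fin d ⊕ Fin d ≃ Fin (2 * d) := finSumFinEquiv.trans (finCongr (by omega))
    refine formIntegrable_shell_of_isCompact e hm hS _
      (continuousOn_abs_pullbackCoeff_fluxForm q F o e hm) hf subset_rfl isClosed_closure
      inter_subset_left (inter_comm _ _ ▸ hc) fun z hz hzZ => ?_
    by_contra hne
    exact hzZ (subset_closure ⟨⟨mem_univ _, hz.2⟩, hne⟩)
  · obtain ⟨D, C, hD, hC⟩ := hS.exists_pieces τ
    refine formIntegral_fluxForm o q F hD hC hm (fun i u hu p hp => ?_) f hJ hint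
    refine sign_fluxFunctional_mul o hSs (D.param i) hu (τ.timelike _) ?_ hp.2
    exact hp.1.trans_lt (neg_lt_zero.2 (by positivity))
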